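/- Let $M^2$ be a real analytic $2$-manifold and $ds^2$ a real analytic Kossowski metric on $M^2$, that is: $ds^2$ is a positive semi-definite real analytic symmetric $2$-tensor such that, at each point $q$ where $ds^2$ is not positive definite (a \emph{semi-definite point}; the other points are called \emph{regular}), (a) $\Theta(X,Y,Z)(q)=0$ for all real analytic vector fields $X,Y,Z$ near $q$ with $Z(q)$ in the null space $\{v: ds^2(v,\cdot)=0\}$ of $ds^2$ at $q$, where, with $\langle\,,\rangle=ds^2$, $$\Theta(X,Y,Z)=\tfrac12\bigl(X\langle Y,Z\rangle+Y\langle X,Z\rangle-Z\langle X,Y\rangle+\langle[X,Y],Z\rangle-\langle[X,Z],Y\rangle-\langle[Y,Z],X\rangle\bigr),$$ and (b) there are a real analytic coordinate neighbourhood $(U;u,v)$ of $q$ and a real analytic function $\lambda$ on $U$ such that $EG-F^2=\lambda^2$ on $U$, where $ds^2=E\,du^2+2F\,du\,dv+G\,dv^2$, and $d\lambda(q)\ne0$. A semi-definite point $q$ is called \emph{non-parabolic} if the Euler form $\Omega=K\lambda\,du\wedge dv$ ($K$ the Gaussian curvature on the set of regular points, $\Omega$ extended real analytically across the semi-definite points)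 does not vanish at $q$. Let $p\in M^2$ and let $\gamma(t)$ be a germ at $t=0$ of a real analytic regular curve in $M^2$ with $\gamma(0)=p$ and $ds^2(\gamma'(0),\gamma'(0))>0$. Let $I\subset\mathbb R$ be an interval, and let $\{\omega_s(t)\}_{s\in I}$ and $\{\mu_s(t)\}_{s\in I}$ be two families of real analytic function germs at $t=0$ depending real analytically on $s$, i.e. $(s,t)\mapsto\omega_s(t)$ and $(s,t)\mapsto\mu_s(t)$ are real analytic at $(s,0)$ for each $s\in I$ (relative to $I\times\mathbb R$ if $s$ is an end point of $I$). Then there is a family $\{f_s\}_{s\in I}$ of map germs $f_s:(M^2,p)\to\mathbb R^3$ which depends real analytically on $s$, i.e. $(s,q)\mapsto f_s(q)$ is real analytic at $(s,p)$ for each $s\in I$ (relative to $I\times M^2$ if $s$ is an end point of $I$), such that for each $s\in I$ the germ $f_s$ is a real analytic frontal with a real analytic unit normal vector field $\nu_s$ (that is, $|\nu_s|=1$ and $\nu_s\perp df_s(TM^2)$ near $p$) satisfying: (1) $ds^2$ is the first fundamental form of $f_s$ near $p$; (2) with $\hat\gamma=f_s\circ\gamma$, the normal curvature $\hat\gamma''(t)\cdot\nu_s(\gamma(t))/|\hat\gamma'(t)|^2$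 equals $e^{\omega_s(t)}$ for all $t$ near $0$; (3) the torsion function of the space curve $\hat\gamma=f_s\circ\gamma$ equals $\mu_s(t)$ for all $t$ near $0$; (4) if $p$ is a regular point of $ds^2$, then $f_s$ is an immersion near $p$; if $p$ is a non-parabolic semi-definite point of $ds^2$, then $f_s$ is a wave front near $p$ (that is, $(f_s,\nu_s)$ is an immersion), $p$ is a non-degenerate singular point of $f_s$ (that is, $\det(\partial_u f_s,\partial_v f_s,\nu_s)$ vanishes at $p$ and has non-zero differential there), and the limiting normal curvature of $f_s$ at $p$ is non-zero: $\partial_u^2f_s(p)\cdot\nu_s(p)/|\partial_uf_s(p)|^2\neq0$ for every real analytic coordinate system $(u,v)$ centered at $p$ with $\partial_vf_s(p)=0$. -/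

import Mathlib

open Set Filter
open scoped Manifold ContDiff Topology

noncomputable section

namespace Kossowski

/-- The coordinate plane (the model space of a `2`-manifold). -/
abbrev Plane : Type := EuclideanSpace ℝ (Fin 2)

/-- Euclidean `3`-space. -/
abbrev Space : Type := EuclideanSpace ℝ (Fin 3)

/-- The `i`-th partial derivative of a function on the coordinate plane
(`i = 0` for `u`, `i = 1` for `v`). -/
def pd {E : Type*} [NormedAddCommGroup E] [NormedSpace ℝ E] (i : Fin 2) (h : Plane → E)
    (x : Plane) : E :=
  fderiv ℝ h x (EuclideanSpace.single i 1)

/-- The determinant of three vectors of `ℝ³`. -/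
def det3 (a b c : Space) : ℝ :=
  Matrix.det !![a 0, a 1, a 2; b 0, b 1, b 2; c 0, c 1, c 2]

/-- The vector product of two vectors of `ℝ³`. -/
def cross (a b : Space) : Space :=
  !₂[a 1 * b 2 - a 2 * b 1, a 2 * b 0 - a 0 * b 2, a 0 * b 1 - a 1 * b 0]

/-! ### Metrics and their coefficients -/

/-- A field of bilinear forms on the tangent spaces of a `2`-manifold. -/
abbrev BilinField (M : Type*) [TopologicalSpace M] [ChartedSpace Plane M] : Type _ :=
  ∀ q : M, TangentSpace (𝓡 2) q →L[ℝ] TangentSpace (𝓡 2) q →L[ℝ] ℝ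

/-- `φ` is a real analytic local coordinate system whose domain contains `p`. -/
def IsCoordAt {M : Type*} [TopologicalSpace M] [ChartedSpace Plane M]
    (φ : OpenPartialHomeomorph M Plane) (p : M) : Prop :=
  φ ∈ IsManifold.maximalAtlas (𝓡 2) ω M ∧ p ∈ φ.source

/-- The coordinate vector `∂ᵢ` of the coordinate system `φ`, at the point with coordinates `x`. -/
def coordVec {M : Type*} [TopologicalSpace M] [ChartedSpace Plane M]
    (φ : OpenPartialHomeomorph M Plane) (i : Fin 2) (x : Plane) :
    TangentSpace (𝓡 2) (φ.symm x) :=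
  mfderiv (𝓡 2) (𝓡 2) φ.symm x (EuclideanSpace.single i 1)

/-- The coefficient `g(∂ᵢ, ∂ⱼ)` in the coordinate system `φ`, as a function of the coordinates.
With `i j = 0 0, 0 1, 1 1` these are the functions `E, F, G`. -/
def coeff {M : Type*} [TopologicalSpace M] [ChartedSpace Plane M] (g : BilinField M)
    (φ : OpenPartialHomeomorph M Plane) (i j : Fin 2) (x : Plane) : ℝ :=
  g (φ.symm x) (coordVec φ i x) (coordVec φ j x)

/-- `E G - F ^ 2`. -/
def discr {M : Type*} [TopologicalSpace M] [ChartedSpace Plane M] (g : BilinField M)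
    (φ : OpenPartialHomeomorph M Plane) (x : Plane) : ℝ :=
  coeff g φ 0 0 x * coeff g φ 1 1 x - coeff g φ 0 1 x ^ 2

/-- The metric is positive definite at `p`, i.e. `p` is a regular point. -/
def IsRegularPoint {M : Type*} [TopologicalSpace M] [ChartedSpace Plane M] (g : BilinField M)
    (p : M) : Prop :=
  ∀ v : TangentSpace (𝓡 2) p, v ≠ 0 → 0 < g p v v

/-- The metric is not positive definite at `p`. -/
def IsSemidefinitePoint {M : Type*} [TopologicalSpace M] [ChartedSpace Plane M]
    (g : BilinField M) (p : M) : Prop :=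
  ¬ IsRegularPoint g p

/-- `v` belongs to the null space (the radical) of the metric at `p`. -/
def InNullSpace {M : Type*} [TopologicalSpace M] [ChartedSpace Plane M] (g : BilinField M)
    (p : M) (v : TangentSpace (𝓡 2) p) : Prop :=
  ∀ w : TangentSpace (𝓡 2) p, g p v w = 0

/-! ### The Kossowski pseudo-connection -/

/-- The vector field `X` is real analytic near `p`. -/
def IsAnalyticFieldAt {M : Type*} [TopologicalSpace M] [ChartedSpace Plane M]
    [IsManifold (𝓡 2) ω M] (X : ∀ q : M, TangentSpace (𝓡 2) q) (p : M) : Prop :=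
  ContMDiffAt (𝓡 2) (𝓡 2).tangent ω (fun q => (⟨q, X q⟩ : TangentBundle (𝓡 2) M)) p

/-- The derivative `X h` of a function `h` in the direction of the vector field `X`. -/
def fieldDeriv {M : Type*} [TopologicalSpace M] [ChartedSpace Plane M]
    (X : ∀ q : M, TangentSpace (𝓡 2) q) (h : M → ℝ) (p : M) : ℝ :=
  mfderiv (𝓡 2) 𝓘(ℝ, ℝ) h p (X p)

/-- The Kossowski pseudo-connection `Θ(X, Y, Z)`. -/
def pseudoConnection {M : Type*} [TopologicalSpace M] [ChartedSpace Plane M] (g : BilinField M)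
    (X Y Z : ∀ q : M, TangentSpace (𝓡 2) q) (p : M) : ℝ :=
  (1 / 2 : ℝ) *
    (fieldDeriv X (fun q => g q (Y q) (Z q)) p + fieldDeriv Y (fun q => g q (X q) (Z q)) p
      - fieldDeriv Z (fun q => g q (X q) (Y q)) p
      + g p (VectorField.mlieBracket (𝓡 2) X Y p) (Z p)
      - g p (VectorField.mlieBracket (𝓡 2) X Z p) (Y p)
      - g p (VectorField.mlieBracket (𝓡 2) Y Z p) (X p))

/-- Admissibility of a point `p`: `Θ(X, Y, Z)(p) = 0` whenever `Z(p)` is in the null space. -/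
def IsAdmissible {M : Type*} [TopologicalSpace M] [ChartedSpace Plane M]
    [IsManifold (𝓡 2) ω M] (g : BilinField M) (p : M) : Prop :=
  ∀ X Y Z : ∀ q : M, TangentSpace (𝓡 2) q,
    IsAnalyticFieldAt X p → IsAnalyticFieldAt Y p → IsAnalyticFieldAt Z p →
    InNullSpace g p (Z p) → pseudoConnection g X Y Z p = 0

/-! ### Kossowski metrics -/

/-- `lam` is a real analytic function on the coordinate domain with `E G - F ^ 2 = lam ^ 2`. -/
def IsSignedAreaDensity {M : Type*} [TopologicalSpace M] [ChartedSpace Plane M]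
    (g : BilinField M) (φ : OpenPartialHomeomorph M Plane) (lam : Plane → ℝ) : Prop :=
  AnalyticOnNhd ℝ lam φ.target ∧ ∀ x ∈ φ.target, discr g φ x = lam x ^ 2

/-- `g` is a real analytic Kossowski metric. -/
structure IsKossowskiMetric {M : Type*} [TopologicalSpace M] [ChartedSpace Plane M]
    [IsManifold (𝓡 2) ω M] (g : BilinField M) : Prop where
  symm : ∀ (q : M) (v w : TangentSpace (𝓡 2) q), g q v w = g q w v
  nonneg : ∀ (q : M) (v : TangentSpace (𝓡 2) q), 0 ≤ g q v v
  analytic : ∀ φ ∈ IsManifold.maximalAtlas (𝓡 2) ω M, ∀ i j : Fin 2,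
    AnalyticOnNhd ℝ (coeff g φ i j) φ.target
  admissible : ∀ p : M, IsSemidefinitePoint g p → IsAdmissible g p
  density : ∀ p : M, IsSemidefinitePoint g p →
    ∃ φ : OpenPartialHomeomorph M Plane, IsCoordAt φ p ∧
      ∃ lam : Plane → ℝ, IsSignedAreaDensity g φ lam ∧ fderiv ℝ lam (φ p) ≠ 0

/-! ### Gaussian curvature and parabolic points -/

/-- The Gaussian curvature of the metric (at the regular points), expressed through `E, F, G` by
Brioschi's formula. -/
def gaussCurvature {M : Type*} [TopologicalSpace M] [ChartedSpace Plane M] (g : BilinField M)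
    (φ : OpenPartialHomeomorph M Plane) (x : Plane) : ℝ :=
  let E := coeff g φ 0 0
  let F := coeff g φ 0 1
  let G := coeff g φ 1 1
  (Matrix.det
      !![-(1 / 2) * pd 1 (pd 1 E) x + pd 1 (pd 0 F) x - (1 / 2) * pd 0 (pd 0 G) x,
          (1 / 2) * pd 0 E x, pd 0 F x - (1 / 2) * pd 1 E x;
         pd 1 F x - (1 / 2) * pd 0 G x, E x, F x;
         (1 / 2) * pd 1 G x, F x, G x]
    - Matrix.det
      !![0, (1 / 2) * pd 1 E x, (1 / 2) * pd 0 G x;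
         (1 / 2) * pd 1 E x, E x, F x;
         (1 / 2) * pd 0 G x, F x, G x]) / discr g φ x ^ 2

/-- `Om du ∧ dv` is the Euler form of the metric in the coordinate system `φ`: the real analytic
extension of `K lam du ∧ dv` from the set of regular points. -/
def IsEulerDensity {M : Type*} [TopologicalSpace M] [ChartedSpace Plane M] (g : BilinField M)
    (φ : OpenPartialHomeomorph M Plane) (lam Om : Plane → ℝ) : Prop :=
  AnalyticOnNhd ℝ Om φ.target ∧
    ∀ x ∈ φ.target, IsRegularPoint g (φ.symm x) → Om x = gaussCurvature g φ x * lam x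

/-- The Euler form of the metric does not vanish at `p`. -/
def IsNonParabolic {M : Type*} [TopologicalSpace M] [ChartedSpace Plane M] (g : BilinField M)
    (p : M) : Prop :=
  ∃ φ : OpenPartialHomeomorph M Plane, IsCoordAt φ p ∧
    ∃ lam Om : Plane → ℝ, IsSignedAreaDensity g φ lam ∧ IsEulerDensity g φ lam Om ∧ Om (φ p) ≠ 0

/-! ### Frontals -/

/-- The differential of `f` at `q`. -/
def diff {M : Type*} [TopologicalSpace M] [ChartedSpace Plane M] (f : M → Space) (q : M)
    (v : TangentSpace (𝓡 2) q) : Space :=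
  mfderiv (𝓡 2) (𝓡 3) f q v

/-- The germ at `p` of `f` is a real analytic frontal, with unit normal vector field `ν`. -/
structure IsFrontalGerm {M : Type*} [TopologicalSpace M] [ChartedSpace Plane M]
    (f ν : M → Space) (p : M) : Prop where
  analytic : ContMDiffAt (𝓡 2) (𝓡 3) ω f p
  analytic_normal : ContMDiffAt (𝓡 2) (𝓡 3) ω ν p
  unit : ∀ᶠ q in 𝓝 p, ‖ν q‖ = 1
  orthogonal : ∀ᶠ q in 𝓝 p, ∀ v : TangentSpace (𝓡 2) q, inner ℝ (diff f q v) (ν q) = 0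

/-- Near `p`, the metric `g` is the first fundamental form of `f`. -/
def IsFirstFundamentalForm {M : Type*} [TopologicalSpace M] [ChartedSpace Plane M]
    (g : BilinField M) (f : M → Space) (p : M) : Prop :=
  ∀ᶠ q in 𝓝 p, ∀ v w : TangentSpace (𝓡 2) q, inner ℝ (diff f q v) (diff f q w) = g q v w

/-- The germ of `f` at `p` is an immersion. -/
def IsImmersionGerm {M : Type*} [TopologicalSpace M] [ChartedSpace Plane M] (f : M → Space)
    (p : M) : Prop :=
  ∀ᶠ q in 𝓝 p, Function.Injective (diff f q)

/-- The germ at `p` of the frontal `f` with unit normal `ν` is a wave front: the map `(f, ν)` is an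
immersion. -/
def IsWaveFrontGerm {M : Type*} [TopologicalSpace M] [ChartedSpace Plane M] (f ν : M → Space)
    (p : M) : Prop :=
  ∀ᶠ q in 𝓝 p, Function.Injective fun v : TangentSpace (𝓡 2) q => (diff f q v, diff ν q v)

/-- The signed area density function `det(f_u, f_v, ν)` of a frontal, as a function of the
coordinates. -/
def frontalDensity {M : Type*} [TopologicalSpace M] [ChartedSpace Plane M] (f ν : M → Space)
    (φ : OpenPartialHomeomorph M Plane) (x : Plane) : ℝ :=
  det3 (pd 0 (f ∘ φ.symm) x) (pd 1 (f ∘ φ.symm) x) (ν (φ.symm x))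

/-- `p` is a non-degenerate singular point of the frontal `f` with unit normal `ν`. -/
def IsNondegenerateSingularPoint {M : Type*} [TopologicalSpace M] [ChartedSpace Plane M]
    (f ν : M → Space) (p : M) : Prop :=
  ∀ φ : OpenPartialHomeomorph M Plane, IsCoordAt φ p →
    frontalDensity f ν φ (φ p) = 0 ∧ fderiv ℝ (frontalDensity f ν φ) (φ p) ≠ 0

/-- The coordinate system `φ` around `p` is centered at `p` and adjusted: `f_v(p) = 0`. -/
def IsAdjustedCoord {M : Type*} [TopologicalSpace M] [ChartedSpace Plane M] (f : M → Space)
    (φ : OpenPartialHomeomorph M Plane) (p : M) : Prop :=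
  IsCoordAt φ p ∧ φ p = 0 ∧ pd 1 (f ∘ φ.symm) (φ p) = 0

/-- `f_uu(p) · ν(p) / |f_u(p)|²`, which for an adjusted coordinate system is the limiting normal
curvature of `f` at `p`. -/
def limitingNormalCurvature {M : Type*} [TopologicalSpace M] [ChartedSpace Plane M]
    (f ν : M → Space) (φ : OpenPartialHomeomorph M Plane) (p : M) : ℝ :=
  inner ℝ (pd 0 (pd 0 (f ∘ φ.symm)) (φ p)) (ν p) / ‖pd 0 (f ∘ φ.symm) (φ p)‖ ^ 2

/-- `p` is a non-degenerate singular point of `f` and the limiting normal curvature of `f` at `p`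
does not vanish. -/
def HasNonvanishingLimitingNormalCurvature {M : Type*} [TopologicalSpace M]
    [ChartedSpace Plane M] (f ν : M → Space) (p : M) : Prop :=
  IsNondegenerateSingularPoint f ν p ∧
    ∀ φ : OpenPartialHomeomorph M Plane, IsAdjustedCoord f φ p →
      limitingNormalCurvature f ν φ p ≠ 0

/-! ### Curves -/

/-- The velocity vector `γ'(t)` of a curve in a `2`-manifold. -/
def velocity {M : Type*} [TopologicalSpace M] [ChartedSpace Plane M] (γ : ℝ → M) (t : ℝ) :
    TangentSpace (𝓡 2) (γ t) :=
  mfderiv 𝓘(ℝ, ℝ) (𝓡 2) γ t (1 : ℝ)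

/-- The normal curvature function along the space curve `f ∘ γ`. -/
def normalCurvature {M : Type*} (f ν : M → Space) (γ : ℝ → M) (t : ℝ) : ℝ :=
  inner ℝ (iteratedDeriv 2 (f ∘ γ) t) (ν (γ t)) / ‖deriv (f ∘ γ) t‖ ^ 2

/-- The torsion function of a regular space curve (in an arbitrary parametrization). -/
def torsion (c : ℝ → Space) (t : ℝ) : ℝ :=
  det3 (deriv c t) (iteratedDeriv 2 c t) (iteratedDeriv 3 c t) /
    ‖cross (deriv c t) (iteratedDeriv 2 c t)‖ ^ 2

end Kossowski

end

/-! Choose coordinates (u, v) centred at p in which γ is the u-axis, and write ds² = θ₁² + θ₂² with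
θ₁ = α du + β dv, θ₂ = σ dv, where α = √E, β = F/√E, σ = λ/√E and λ² = EG − F². This coframe stays
analytic across the semi-definite points, and so does its connection form p du + q dv. Indeed pσ =
β_u − α_v can be solved for p: admissibility makes β_u − α_v vanish on {λ = 0}, and dλ ≠ 0 turns
vanishing into divisibility (`coeff_of_isSemidefinitePoint`, `exists_eq_mul_of_vanishing`,
`exists_coframe`). Then q comes from σ_u = αq − βp, dividing only by α.

A frontal with this first fundamental form is obtained from a moving frame e₁, e₂, ν along f with df
= θ₁e₁ + θ₂e₂, de₁ = (p du + q dv)e₂ + (a du + b dv)ν, de₂ = −(p du + q dv)e₁ + (c du + d dv)ν.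
Besides the two equations for p and q, this linear total system is integrable exactly under the
symmetry αb = βa + σc, the Gauss equation ad − bc = κ with κ = p_v − q_u, and the two Codazzi
equations. On the u-axis the normal curvature of the image curve is a/α and its torsion is (p a_u −
a p_u + c(p² + a²)) / (α(p² + a²)). Prescribing e^ω and μ therefore prescribes a and c on the axis,
with a ≠ 0. Symmetry and Gauss then give b and d, and Codazzi becomes a Cauchy problem for a, c in
the direction v, solved by Cauchy–Kovalevskaya (`exists_isSeriesSolution`). Nothing is ever divided
by σ, so singular points need no separate treatment.

Cauchy–Kovalevskaya is proved in formal power series by Picard iteration (`ck_exists`). In the ℓ¹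
norm whose weights are r^n divided by the binomial coefficient of the exponents of the two
variables, multiplication is continuous and the operator ∫ ∂_u dv is bounded, with norm as small as
desired (`wnorm_integ_pderiv_le`).

The family parameter is a third, passive variable of the series. Fixing the frame at p makes the
solution unique (`IsFrameSolution.unique`), so the slices of a solution with parameter near s₀ are
the solutions for the individual s, and the local families glue over the whole interval
(`exists_glued_family`).

Property (4) follows from (1) and (2). Brioschi's numerator equals Λ³Ψ with Λ = det(f_u, f_v, ν) and
Ψ = det(ν_u, ν_v, ν), also at singular points (`brioschi_eq`). Hence Ω² = Ψ² by density of regular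
points, and Ω(p) ≠ 0 makes ν an immersion. Non-degeneracy comes from Λ² = λ². The limiting normal
curvature is non-zero because the normal curvature e^ω of the image of γ is. -/

namespace FormalGerm

open MvPowerSeries
open scoped ENNReal NNReal

/-! ### Formal power series: weighted ℓ¹ norms, antiderivatives, X-adic congruences -/

section FormalSeries

variable {σ : Type*}

/-- The weighted `ℓ¹` norm of a formal power series. -/
noncomputable def wnorm (w : (σ →₀ ℕ) → ℝ≥0∞) (a : MvPowerSeries σ ℝ) : ℝ≥0∞ :=
  ∑' n, ‖coeff n a‖ₑ * w n

theorem wnorm_mono_weight {w w' : (σ →₀ ℕ) → ℝ≥0∞} (h : ∀ n, w n ≤ w' n)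
    (a : MvPowerSeries σ ℝ) : wnorm w a ≤ wnorm w' a :=
  ENNReal.tsum_le_tsum fun n => mul_le_mul_right (h n) _

theorem wnorm_zero (w : (σ →₀ ℕ) → ℝ≥0∞) : wnorm w 0 = 0 := by simp [wnorm]

theorem wnorm_add_le (w : (σ →₀ ℕ) → ℝ≥0∞) (a b : MvPowerSeries σ ℝ) :
    wnorm w (a + b) ≤ wnorm w a + wnorm w b := by
  unfold wnorm
  rw [← ENNReal.tsum_add]
  refine ENNReal.tsum_le_tsum fun n => ?_
  rw [← add_mul, map_add]
  exact mul_le_mul_left (enorm_add_le _ _) _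

theorem wnorm_sum_le {τ : Type*} (w : (σ →₀ ℕ) → ℝ≥0∞) (s : Finset τ)
    (f : τ → MvPowerSeries σ ℝ) : wnorm w (∑ t ∈ s, f t) ≤ ∑ t ∈ s, wnorm w (f t) := by
  classical
  induction s using Finset.induction_on with
  | empty => simp [wnorm_zero]
  | insert a s ha ih =>
    rw [Finset.sum_insert ha, Finset.sum_insert ha]
    exact (wnorm_add_le _ _ _).trans (by gcongr)

/-- This is the Cauchy product. With values in `ℝ≥0∞` the sums rearrange freely, so no convergence
is assumed; only submultiplicativity of the weight enters. -/
theorem wnorm_mul_le {w : (σ →₀ ℕ) → ℝ≥0∞} (hw : ∀ m n, w (m + n) ≤ w m * w n)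
    (a b : MvPowerSeries σ ℝ) : wnorm w (a * b) ≤ wnorm w a * wnorm w b := by
  classical
  have key : wnorm w a * wnorm w b
      = ∑' n, ∑ p ∈ Finset.HasAntidiagonal.antidiagonal n, (‖coeff p.1 a‖ₑ * w p.1) * (‖coeff p.2 b‖ₑ * w p.2) := by
    unfold wnorm
    rw [← ENNReal.tsum_mul_right]
    simp_rw [← ENNReal.tsum_mul_left]
    rw [← ENNReal.tsum_prod' (f := fun p : (σ →₀ ℕ) × (σ →₀ ℕ) =>
      ‖coeff p.1 a‖ₑ * w p.1 * (‖coeff p.2 b‖ₑ * w p.2)),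
      ← (Finset.HasAntidiagonal.sigmaAntidiagonalEquivProd (A := σ →₀ ℕ)).tsum_eq,
      ENNReal.tsum_sigma']
    refine tsum_congr fun n => ?_
    rw [tsum_fintype, Finset.univ_eq_attach]
    exact Finset.sum_attach (Finset.HasAntidiagonal.antidiagonal n)
      (fun p => ‖coeff p.1 a‖ₑ * w p.1 * (‖coeff p.2 b‖ₑ * w p.2))
  rw [key]
  refine ENNReal.tsum_le_tsum fun n => ?_
  rw [coeff_mul]
  refine (mul_le_mul_left (enorm_sum_le _ _) _).trans ?_
  rw [Finset.sum_mul]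
  refine Finset.sum_le_sum fun p hp => ?_
  rw [← Finset.HasAntidiagonal.mem_antidiagonal.1 hp, enorm_mul]
  calc _ ≤ ‖coeff p.1 a‖ₑ * ‖coeff p.2 b‖ₑ * (w p.1 * w p.2) := by gcongr; exact hw _ _
    _ = _ := by ring

theorem wnorm_one_le {w : (σ →₀ ℕ) → ℝ≥0∞} (hw : w 0 ≤ 1) :
    wnorm w (1 : MvPowerSeries σ ℝ) ≤ 1 := by
  classical
  unfold wnorm
  rw [tsum_eq_single 0]
  · simpa using hw
  · intro n hn
    simp [coeff_one, hn]

theorem wnorm_prod_pow_le {τ : Type*} [Fintype τ] {w : (σ →₀ ℕ) → ℝ≥0∞}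
    (hw : ∀ m n, w (m + n) ≤ w m * w n) (hw0 : w 0 ≤ 1) (y : τ → MvPowerSeries σ ℝ)
    (m : τ → ℕ) : wnorm w (∏ t, y t ^ m t) ≤ ∏ t, wnorm w (y t) ^ m t := by
  classical
  have hpow : ∀ (a : MvPowerSeries σ ℝ) (k : ℕ), wnorm w (a ^ k) ≤ wnorm w a ^ k := by
    intro a k
    induction k with
    | zero => simpa using wnorm_one_le hw0
    | succ k ih =>
      rw [pow_succ, pow_succ]
      exact (wnorm_mul_le hw _ _).trans (by gcongr)
  have : ∀ s : Finset τ, wnorm w (∏ t ∈ s, y t ^ m t) ≤ ∏ t ∈ s, wnorm w (y t) ^ m t := by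
    intro s
    induction s using Finset.induction_on with
    | empty => simpa using wnorm_one_le hw0
    | insert a s ha ih =>
      rw [Finset.prod_insert ha, Finset.prod_insert ha]
      exact (wnorm_mul_le hw _ _).trans (by gcongr; exact hpow _ _)
  exact this _

/-- A polynomial with coefficients of finite norm is bounded on balls, uniformly in the weight. -/
theorem exists_wnorm_aeval_le {τ : Type*} [Fintype τ]
    (P : MvPolynomial τ (MvPowerSeries σ ℝ)) (w₀ : (σ →₀ ℕ) → ℝ≥0∞)
    (hP : ∀ m, wnorm w₀ (P.coeff m) < ⊤) (A : ℝ≥0∞) (hA : A < ⊤) :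
    ∃ B < ⊤, ∀ w : (σ →₀ ℕ) → ℝ≥0∞, (∀ n, w n ≤ w₀ n) → (∀ m n, w (m + n) ≤ w m * w n) →
      w 0 ≤ 1 → ∀ y : τ → MvPowerSeries σ ℝ, (∀ t, wnorm w (y t) ≤ A) →
        wnorm w (MvPolynomial.aeval y P) ≤ B := by
  refine ⟨∑ m ∈ P.support, wnorm w₀ (P.coeff m) * ∏ t, A ^ m t, ?_, ?_⟩
  · refine ENNReal.sum_lt_top.2 fun m _ => ENNReal.mul_lt_top (hP m) ?_
    exact ENNReal.prod_lt_top fun t _ => ENNReal.pow_lt_top hA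
  · intro w hw hmul h0 y hy
    rw [MvPolynomial.aeval_def, MvPolynomial.eval₂_eq']
    refine (wnorm_sum_le _ _ _).trans (Finset.sum_le_sum fun m _ => ?_)
    refine (wnorm_mul_le hmul _ _).trans ?_
    refine mul_le_mul' (wnorm_mono_weight hw _) ?_
    refine (wnorm_prod_pow_le hmul h0 _ _).trans ?_
    exact Finset.prod_le_prod' fun t _ => pow_le_pow_left' (hy t) _

/-! ### Antiderivatives and restrictions -/

/-- The formal antiderivative with respect to the variable `i`, without constant term. -/
noncomputable def integ (i : σ) (a : MvPowerSeries σ ℝ) : MvPowerSeries σ ℝ :=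
  fun n => if n i = 0 then 0 else coeff (n - Finsupp.single i 1) a / n i

/-- The restriction of a power series to the hyperplane where the variable `i` vanishes. -/
noncomputable def restr (i : σ) (a : MvPowerSeries σ ℝ) : MvPowerSeries σ ℝ :=
  fun n => if n i = 0 then coeff n a else 0

theorem coeff_integ (i : σ) (a : MvPowerSeries σ ℝ) (n : σ →₀ ℕ) :
    coeff n (integ i a) = if n i = 0 then 0 else coeff (n - Finsupp.single i 1) a / n i := rfl

theorem coeff_restr (i : σ) (a : MvPowerSeries σ ℝ) (n : σ →₀ ℕ) :
    coeff n (restr i a) = if n i = 0 then coeff n a else 0 := rfl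

theorem coeff_add_single_integ (i : σ) (a : MvPowerSeries σ ℝ) (n : σ →₀ ℕ) :
    coeff (n + Finsupp.single i 1) (integ i a) = coeff n a / (n i + 1) := by
  classical
  rw [coeff_integ]
  simp

theorem pderiv_integ (i : σ) (a : MvPowerSeries σ ℝ) : pderiv ℝ i (integ i a) = a := by
  ext n
  rw [coeff_pderiv, coeff_add_single_integ]
  have : (n i : ℝ) + 1 ≠ 0 := by positivity
  field_simp

theorem exists_eq_add_single {i : σ} {n : σ →₀ ℕ} (h : n i ≠ 0) :
    ∃ m : σ →₀ ℕ, n = m + Finsupp.single i 1 := by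
  classical
  refine ⟨n - Finsupp.single i 1, ?_⟩
  ext k
  by_cases hk : k = i
  · subst hk; simp; omega
  · simp [Finsupp.single_apply, Ne.symm hk]

/-- The fundamental theorem of calculus, coefficient by coefficient; it converts a Cauchy problem
into an integral equation. -/
theorem restr_add_integ_pderiv (i : σ) (a : MvPowerSeries σ ℝ) :
    restr i a + integ i (pderiv ℝ i a) = a := by
  ext n
  rw [map_add, coeff_restr]
  by_cases h : n i = 0
  · simp [h, coeff_integ]
  · rw [if_neg h, zero_add]
    obtain ⟨m, rfl⟩ := exists_eq_add_single h
    rw [coeff_add_single_integ, coeff_pderiv]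
    have : (m i : ℝ) + 1 ≠ 0 := by positivity
    field_simp

theorem restr_integ (i : σ) (a : MvPowerSeries σ ℝ) : restr i (integ i a) = 0 := by
  ext n
  rw [coeff_restr, coeff_integ]
  split_ifs <;> simp

theorem restr_add (i : σ) (a b : MvPowerSeries σ ℝ) :
    restr i (a + b) = restr i a + restr i b := by
  ext n
  simp only [coeff_restr, map_add]
  split_ifs <;> simp

theorem restr_zero (i : σ) : restr i (0 : MvPowerSeries σ ℝ) = 0 := by
  ext n
  simp [coeff_restr]

theorem restr_restr (i : σ) (a : MvPowerSeries σ ℝ) : restr i (restr i a) = restr i a := by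
  ext n
  simp only [coeff_restr]
  split_ifs <;> simp_all

theorem restr_mul (i : σ) (a b : MvPowerSeries σ ℝ) :
    restr i (a * b) = restr i a * restr i b := by
  classical
  ext n
  rw [coeff_restr, coeff_mul, coeff_mul]
  split_ifs with h
  · refine Finset.sum_congr rfl fun p hp => ?_
    have h' : p.1 i + p.2 i = 0 := by
      rw [← Finsupp.add_apply, Finset.HasAntidiagonal.mem_antidiagonal.1 hp, h]
    rw [coeff_restr, coeff_restr, if_pos (by omega), if_pos (by omega)]
  · symm
    refine Finset.sum_eq_zero fun p hp => ?_
    have h' : p.1 i + p.2 i ≠ 0 := by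
      rw [← Finsupp.add_apply, Finset.HasAntidiagonal.mem_antidiagonal.1 hp]; exact h
    rw [coeff_restr, coeff_restr]
    by_cases h1 : p.1 i = 0
    · rw [if_neg (by omega : ¬ p.2 i = 0), mul_zero]
    · rw [if_neg h1, zero_mul]

theorem restr_pderiv {i j : σ} (hij : j ≠ i) (a : MvPowerSeries σ ℝ) :
    restr i (pderiv ℝ j a) = pderiv ℝ j (restr i a) := by
  classical
  ext n
  rw [coeff_restr, coeff_pderiv, coeff_pderiv, coeff_restr]
  simp [Finsupp.single_apply, hij]

theorem pderiv_restr_self (i : σ) (a : MvPowerSeries σ ℝ) : pderiv ℝ i (restr i a) = 0 := by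
  ext n
  rw [coeff_pderiv, coeff_restr]
  simp

theorem pderiv_integ_of_ne {i j : σ} (hij : j ≠ i) (a : MvPowerSeries σ ℝ) :
    pderiv ℝ j (integ i a) = integ i (pderiv ℝ j a) := by
  classical
  ext n
  by_cases h : n i = 0
  · rw [coeff_pderiv, coeff_integ, coeff_integ]
    simp [h, Finsupp.single_apply, hij]
  · obtain ⟨m, rfl⟩ := exists_eq_add_single h
    rw [coeff_pderiv, coeff_add_single_integ, coeff_pderiv, add_right_comm,
      coeff_add_single_integ]
    simp only [Finsupp.add_apply, Finsupp.single_apply, hij, Ne.symm hij, if_false, add_zero]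
    ring

theorem pderiv_comm (i j : σ) (a : MvPowerSeries σ ℝ) :
    pderiv ℝ i (pderiv ℝ j a) = pderiv ℝ j (pderiv ℝ i a) := by
  classical
  by_cases hij : i = j
  · rw [hij]
  ext n
  simp only [coeff_pderiv, add_right_comm n (Finsupp.single i 1) (Finsupp.single j 1)]
  simp only [Finsupp.add_apply, Finsupp.single_apply, hij, Ne.symm hij, if_false, add_zero]
  ring

theorem X_dvd_of_restr_eq_zero {i : σ} {a : MvPowerSeries σ ℝ} (h : restr i a = 0) :
    ∃ b, a = X i * b := by
  have : X i ^ 1 ∣ a := by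
    rw [X_pow_dvd_iff]
    intro m hm
    have := congrArg (coeff m) h
    rwa [coeff_restr, if_pos (by omega), map_zero] at this
  simpa [dvd_def] using this

/-! ### Congruences modulo powers of a variable -/

theorem X_pow_dvd_pderiv {i j : σ} (hij : j ≠ i) {N : ℕ} {a : MvPowerSeries σ ℝ}
    (h : X i ^ N ∣ a) : X i ^ N ∣ pderiv ℝ j a := by
  classical
  rw [X_pow_dvd_iff] at h ⊢
  intro m hm
  rw [coeff_pderiv, h _ (by simpa [Finsupp.single_apply, hij] using hm), zero_mul]

theorem X_pow_succ_dvd_integ {i : σ} {N : ℕ} {a : MvPowerSeries σ ℝ}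
    (h : X i ^ N ∣ a) : X i ^ (N + 1) ∣ integ i a := by
  classical
  rw [X_pow_dvd_iff] at h ⊢
  intro m hm
  by_cases h0 : m i = 0
  · rw [coeff_integ, if_pos h0]
  · obtain ⟨m, rfl⟩ := exists_eq_add_single h0
    rw [coeff_add_single_integ, h _ (by simpa using hm), zero_div]

theorem eq_zero_of_forall_X_pow_dvd {i : σ} {a : MvPowerSeries σ ℝ} (h : ∀ N, X i ^ N ∣ a) :
    a = 0 := by
  ext n
  exact X_pow_dvd_iff.1 (h (n i + 1)) n (by omega)

/-- Polynomials respect congruences. With `d` a power of `X i`, the right hand side of a Cauchy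
problem loses no order of agreement, so that integration gains one. -/
theorem dvd_aeval_sub {τ : Type*} {R : Type*} [CommRing R] (P : MvPolynomial τ R) (d : R)
    (y y' : τ → R) (h : ∀ t, d ∣ y t - y' t) :
    d ∣ MvPolynomial.aeval y P - MvPolynomial.aeval y' P := by
  induction P using MvPolynomial.induction_on with
  | C a => simp
  | add p q hp hq =>
    rw [map_add, map_add, add_sub_add_comm]
    exact dvd_add hp hq
  | mul_X p t hp =>
    rw [map_mul, map_mul, MvPolynomial.aeval_X, MvPolynomial.aeval_X]
    have : MvPolynomial.aeval y p * y t - MvPolynomial.aeval y' p * y' t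
      = (MvPolynomial.aeval y p - MvPolynomial.aeval y' p) * y t
        + MvPolynomial.aeval y' p * (y t - y' t) := by ring
    rw [this]
    exact dvd_add (hp.mul_right _) ((h t).mul_left _)

theorem integ_sub (i : σ) (a b : MvPowerSeries σ ℝ) :
    integ i (a - b) = integ i a - integ i b := by
  ext n
  simp only [coeff_integ, map_sub]
  split_ifs
  · simp
  · ring

end FormalSeries

end FormalGerm

namespace FormalGerm

open MvPowerSeries
open scoped ENNReal NNReal

/-! ### Weights adapted to the Cauchy problem, and convergent series -/

section Weights

variable {σ : Type*} [Fintype σ]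

/-- The monomial weight with radii `R`. -/
noncomputable def monoWeight (R : σ → ℝ≥0) (n : σ →₀ ℕ) : ℝ≥0 := ∏ k, R k ^ n k

theorem monoWeight_add (R : σ → ℝ≥0) (m n : σ →₀ ℕ) :
    monoWeight R (m + n) = monoWeight R m * monoWeight R n := by
  simp [monoWeight, pow_add, Finset.prod_mul_distrib]

theorem monoWeight_zero (R : σ → ℝ≥0) : monoWeight R 0 = 1 := by simp [monoWeight]

theorem monoWeight_single (R : σ → ℝ≥0) (i : σ) :
    monoWeight R (Finsupp.single i 1) = R i := by
  classical
  unfold monoWeight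
  rw [Finset.prod_eq_single i]
  · simp
  · intro k _ hk; simp [Finsupp.single_apply, hk.symm]
  · simp

theorem monoWeight_mono {R R' : σ → ℝ≥0} (h : ∀ k, R k ≤ R' k) (n : σ →₀ ℕ) :
    monoWeight R n ≤ monoWeight R' n :=
  Finset.prod_le_prod' fun k _ => pow_le_pow_left' (h k) _

/-- The monomial weight divided by a binomial coefficient in the exponents of two variables. With
respect to this weight the operator `∫ ∂ⱼ dxᵢ` is bounded. -/
noncomputable def ckWeight (i j : σ) (R : σ → ℝ≥0) (n : σ →₀ ℕ) : ℝ≥0 :=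
  monoWeight R n / ((n i + n j).choose (n i) : ℝ≥0)

theorem choose_pos' (a b : ℕ) : (0 : ℝ≥0) < ((a + b).choose a : ℝ≥0) := by
  exact_mod_cast Nat.choose_pos (Nat.le_add_right a b)

theorem ckWeight_le (i j : σ) (R : σ → ℝ≥0) (n : σ →₀ ℕ) :
    ckWeight i j R n ≤ monoWeight R n := by
  refine div_le_self (by positivity) ?_
  exact_mod_cast Nat.choose_pos (Nat.le_add_right (n i) (n j))

theorem ckWeight_zero (i j : σ) (R : σ → ℝ≥0) : ckWeight i j R 0 = 1 := by
  simp [ckWeight, monoWeight_zero]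

/-- The left side is a single term of Vandermonde's sum for the right side. It is what makes
`ckWeight` submultiplicative. -/
theorem choose_mul_choose_le (a b c d : ℕ) :
    (a + b).choose a * (c + d).choose c ≤ (a + c + (b + d)).choose (a + c) := by
  rw [show a + c + (b + d) = (a + b) + (c + d) by ring, Nat.add_choose_eq (a + b) (c + d)]
  exact Finset.single_le_sum (f := fun p : ℕ × ℕ => (a + b).choose p.1 * (c + d).choose p.2)
    (fun _ _ => Nat.zero_le _)
    (Finset.HasAntidiagonal.mem_antidiagonal.2 rfl : (a, c) ∈ _)

theorem ckWeight_add_le (i j : σ) (R : σ → ℝ≥0) (m n : σ →₀ ℕ) :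
    ckWeight i j R (m + n) ≤ ckWeight i j R m * ckWeight i j R n := by
  unfold ckWeight
  rw [monoWeight_add, div_mul_div_comm]
  refine div_le_div_of_nonneg_left (by positivity)
    (mul_pos (choose_pos' (m i) (m j)) (choose_pos' (n i) (n j))) ?_
  exact_mod_cast choose_mul_choose_le (m i) (m j) (n i) (n j)

theorem ckWeight_add_single_le {i j : σ} (hij : j ≠ i) (R : σ → ℝ≥0) (n : σ →₀ ℕ) :
    ckWeight i j R (n + Finsupp.single i 1) ≤ R i * ckWeight i j R n := by
  classical
  unfold ckWeight
  rw [monoWeight_add, monoWeight_single, mul_comm, mul_div_assoc]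
  refine mul_le_mul_right ?_ _
  refine div_le_div_of_nonneg_left (by positivity) (choose_pos' _ _) ?_
  have h : (n i + n j).choose (n i) ≤ (n i + 1 + n j).choose (n i + 1) := by
    rw [show n i + 1 + n j = (n i + n j) + 1 by ring, Nat.choose_succ_succ]
    omega
  simpa [Finsupp.single_apply, hij, Ne.symm hij] using (by exact_mod_cast h :
    ((n i + n j).choose (n i) : ℝ≥0) ≤ ((n i + 1 + n j).choose (n i + 1) : ℕ))

/-- The operator ∫ ∂ⱼ dxᵢ moves one exponent from `j` to `i` and creates the factor (nⱼ + 1)/(nᵢ +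
1). The binomial coefficients in the weight are chosen so that their ratio cancels exactly this
factor. -/
theorem ckWeight_exchange {i j : σ} (hij : j ≠ i) {R : σ → ℝ≥0} (hR : 0 < R j)
    (n : σ →₀ ℕ) : ((n j + 1) / (n i + 1) : ℝ≥0) * ckWeight i j R (n + Finsupp.single i 1)
      = R i / R j * ckWeight i j R (n + Finsupp.single j 1) := by
  classical
  unfold ckWeight
  rw [monoWeight_add, monoWeight_add, monoWeight_single, monoWeight_single]
  have h1 : ((n i + n j + 1).choose (n i + 1) : ℝ≥0) * (n i + 1)
      = ((n i + n j + 1).choose (n i) : ℝ≥0) * (n j + 1) := by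
    have := Nat.choose_succ_right_eq (n i + n j + 1) (n i)
    rw [show n i + n j + 1 - n i = n j + 1 by omega] at this
    exact_mod_cast this
  have e1 : (n + Finsupp.single i 1 : σ →₀ ℕ) i + (n + Finsupp.single i 1 : σ →₀ ℕ) j = n i + n j + 1 := by
    simp [Finsupp.single_apply, hij, Ne.symm hij]; ring
  have e2 : (n + Finsupp.single j 1 : σ →₀ ℕ) i + (n + Finsupp.single j 1 : σ →₀ ℕ) j = n i + n j + 1 := by
    simp [Finsupp.single_apply, hij, Ne.symm hij]; ring
  have e3 : (n + Finsupp.single i 1 : σ →₀ ℕ) i = n i + 1 := by simp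
  have e4 : (n + Finsupp.single j 1 : σ →₀ ℕ) i = n i := by simp [hij]
  rw [e1, e2, e3, e4]
  have c1 : ((n i + n j + 1).choose (n i + 1) : ℝ≥0) ≠ 0 := by
    exact_mod_cast (Nat.choose_pos (by omega)).ne'
  have c2 : ((n i + n j + 1).choose (n i) : ℝ≥0) ≠ 0 := by
    exact_mod_cast (Nat.choose_pos (by omega)).ne'
  have c3 := hR.ne'
  field_simp
  calc _ = monoWeight R n * R i * (((n i + n j + 1).choose (n i) : ℝ≥0) * (n j + 1)) := by ring
    _ = _ := by rw [← h1]; ring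

theorem tsum_eq_tsum_add_single {i : σ} (f : (σ →₀ ℕ) → ℝ≥0∞) (h : ∀ n, n i = 0 → f n = 0) :
    ∑' n, f n = ∑' n, f (n + Finsupp.single i 1) := by
  symm
  refine (add_left_injective (Finsupp.single i 1)).tsum_eq fun n hn => ?_
  obtain ⟨m, rfl⟩ := exists_eq_add_single (i := i) (n := n) fun h0 => hn (h n h0)
  exact ⟨m, rfl⟩

theorem wnorm_integ_le {i j : σ} (hij : j ≠ i) (R : σ → ℝ≥0) (a : MvPowerSeries σ ℝ) :
    wnorm (fun n => (ckWeight i j R n : ℝ≥0∞)) (integ i a)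
      ≤ R i * wnorm (fun n => (ckWeight i j R n : ℝ≥0∞)) a := by
  unfold wnorm
  rw [tsum_eq_tsum_add_single (i := i) _ (fun n hn => by simp [coeff_integ, hn]),
    ← ENNReal.tsum_mul_left]
  refine ENNReal.tsum_le_tsum fun n => ?_
  rw [coeff_add_single_integ]
  have h1 : ‖coeff n a / (n i + 1)‖ₑ ≤ ‖coeff n a‖ₑ := by
    rw [enorm_le_iff_norm_le, norm_div]
    refine div_le_self (norm_nonneg _) ?_
    rw [Real.norm_of_nonneg (by positivity)]
    linarith [(n i).cast_nonneg (α := ℝ)]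
  have h2 : (ckWeight i j R (n + Finsupp.single i 1) : ℝ≥0∞) ≤ R i * ckWeight i j R n := by
    exact_mod_cast ckWeight_add_single_le hij R n
  calc _ ≤ ‖coeff n a‖ₑ * (R i * ckWeight i j R n) := mul_le_mul' h1 h2
    _ = _ := by ring

/-- The decisive estimate: differentiation in `j` followed by integration in `i` costs no radius,
only the factor R i / R j, which is made small by shrinking R i alone. -/
theorem wnorm_integ_pderiv_le {i j : σ} (hij : j ≠ i) {R : σ → ℝ≥0} (hR : 0 < R j)
    (a : MvPowerSeries σ ℝ) :
    wnorm (fun n => (ckWeight i j R n : ℝ≥0∞)) (integ i (pderiv ℝ j a))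
      ≤ (R i / R j : ℝ≥0) * wnorm (fun n => (ckWeight i j R n : ℝ≥0∞)) a := by
  unfold wnorm
  rw [tsum_eq_tsum_add_single (i := i) _ (fun n hn => by simp [coeff_integ, hn]),
    ← ENNReal.tsum_mul_left]
  refine le_trans (ENNReal.tsum_le_tsum fun n => ?_)
    (ENNReal.tsum_comp_le_tsum_of_injective (add_left_injective (Finsupp.single j 1)) _)
  rw [coeff_add_single_integ, coeff_pderiv]
  have h1 : ‖coeff (n + Finsupp.single j 1) a * (n j + 1) / (n i + 1)‖ₑ
      = ‖coeff (n + Finsupp.single j 1) a‖ₑ * ((n j + 1) / (n i + 1) : ℝ≥0) := by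
    rw [mul_div_assoc, enorm_mul]
    congr 1
    rw [Real.enorm_of_nonneg (by positivity)]
    rw [ENNReal.ofReal, ENNReal.coe_inj]
    ext
    rw [Real.coe_toNNReal _ (by positivity)]
    push_cast
    rfl
  rw [h1, mul_assoc, ← ENNReal.coe_mul, ckWeight_exchange hij hR, ENNReal.coe_mul]
  exact le_of_eq (by ring)

/-- The power series `a` converges absolutely on some polydisc. -/
def Conv (a : MvPowerSeries σ ℝ) : Prop :=
  ∃ r : ℝ≥0, 0 < r ∧ wnorm (fun n => (monoWeight (fun _ => r) n : ℝ≥0∞)) a < ⊤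

theorem wnorm_monoWeight_mono {R R' : σ → ℝ≥0} (h : ∀ k, R k ≤ R' k) (a : MvPowerSeries σ ℝ) :
    wnorm (fun n => (monoWeight R n : ℝ≥0∞)) a ≤ wnorm (fun n => (monoWeight R' n : ℝ≥0∞)) a :=
  wnorm_mono_weight (fun n => by exact_mod_cast monoWeight_mono h n) a

theorem exists_common_radius {τ : Type*} (s : Finset τ) (a : τ → MvPowerSeries σ ℝ)
    (h : ∀ t ∈ s, Conv (a t)) : ∃ r : ℝ≥0, 0 < r ∧
      ∀ t ∈ s, wnorm (fun n => (monoWeight (fun _ => r) n : ℝ≥0∞)) (a t) < ⊤ := by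
  classical
  induction s using Finset.induction_on with
  | empty => exact ⟨1, one_pos, by simp⟩
  | insert t s _ ih =>
    obtain ⟨r, hr, h1⟩ := ih fun u hu => h u (Finset.mem_insert_of_mem hu)
    obtain ⟨r', hr', h2⟩ := h t (Finset.mem_insert_self _ _)
    refine ⟨min r r', lt_min hr hr', fun u hu => ?_⟩
    rcases Finset.mem_insert.1 hu with rfl | hu
    · exact (wnorm_monoWeight_mono (fun _ => min_le_right _ _) _).trans_lt h2
    · exact (wnorm_monoWeight_mono (fun _ => min_le_left _ _) _).trans_lt (h1 u hu)

theorem monoWeight_const (r : ℝ≥0) (n : σ →₀ ℕ) :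
    monoWeight (fun _ => r) n = r ^ n.degree := by
  rw [monoWeight, Finset.prod_pow_eq_pow_sum, Finsupp.degree_eq_sum]

/-- Halving the radius gains 2 to the power of the degree, which absorbs the factor nⱼ + 1 produced
by differentiation. -/
theorem Conv.pderiv {a : MvPowerSeries σ ℝ} (h : Conv a) (j : σ) :
    Conv (MvPowerSeries.pderiv ℝ j a) := by
  obtain ⟨r, hr, ha⟩ := h
  refine ⟨r / 2, by positivity, ?_⟩
  have key : ∀ n : σ →₀ ℕ, ((n j + 1 : ℝ≥0)) * monoWeight (fun _ => r / 2) n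
      ≤ r⁻¹ * monoWeight (fun _ => r) (n + Finsupp.single j 1) := by
    intro n
    rw [monoWeight_add, monoWeight_single, mul_left_comm, inv_mul_cancel₀ hr.ne', mul_one,
      monoWeight_const, monoWeight_const, div_pow, mul_div_assoc', div_le_iff₀ (by positivity),
      mul_comm]
    refine mul_le_mul_right ?_ _
    have h1 : n j + 1 ≤ 2 ^ n.degree := by
      refine le_trans ?_ (Nat.pow_le_pow_right (by norm_num) (Finsupp.le_degree j n))
      exact Nat.lt_two_pow_self
    exact_mod_cast h1
  refine lt_of_le_of_lt ?_ (ENNReal.mul_lt_top (a := ((r⁻¹ : ℝ≥0) : ℝ≥0∞)) ENNReal.coe_lt_top ha)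
  unfold wnorm
  rw [← ENNReal.tsum_mul_left]
  refine le_trans (ENNReal.tsum_le_tsum fun n => ?_)
    (ENNReal.tsum_comp_le_tsum_of_injective (add_left_injective (Finsupp.single j 1)) _)
  rw [coeff_pderiv, enorm_mul]
  have h1 : ‖(n j + 1 : ℝ)‖ₑ = ((n j + 1 : ℝ≥0) : ℝ≥0∞) := by
    rw [Real.enorm_of_nonneg (by positivity), ENNReal.ofReal, ENNReal.coe_inj]
    ext
    rw [Real.coe_toNNReal _ (by positivity)]
    push_cast
    rfl
  rw [h1, mul_assoc, ← ENNReal.coe_mul]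
  calc _ ≤ ‖coeff (n + Finsupp.single j 1) a‖ₑ *
        ((r⁻¹ * monoWeight (fun _ => r) (n + Finsupp.single j 1) : ℝ≥0) : ℝ≥0∞) := by
          exact mul_le_mul_right (by exact_mod_cast key n) _
    _ = _ := by rw [ENNReal.coe_mul]; ring

end Weights

/-! ### The Cauchy–Kovalevskaya theorem by Picard iteration -/

section CauchyKovalevskaya

variable {σ ι : Type*}

/-- The Picard iterates of a formal Cauchy problem. -/
noncomputable def picard (i j : σ) (P : ι → MvPolynomial (ι ⊕ ι) (MvPowerSeries σ ℝ))
    (y₀ : ι → MvPowerSeries σ ℝ) : ℕ → ι → MvPowerSeries σ ℝ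
  | 0 => y₀
  | n + 1 => fun k => y₀ k + integ i (MvPolynomial.aeval
      (Sum.elim (picard i j P y₀ n) fun l => pderiv ℝ j (picard i j P y₀ n l)) (P k))

/-- The derivative ∂ⱼ with j ≠ i and the polynomial preserve divisibility by powers of `X i`, and
the antiderivative gains one power. The Picard map is therefore a contraction in the X i-adic sense.
-/
theorem dvd_step {i j : σ} (hij : j ≠ i) (P : ι → MvPolynomial (ι ⊕ ι) (MvPowerSeries σ ℝ))
    {y y' : ι → MvPowerSeries σ ℝ} {N : ℕ} (h : ∀ k, X i ^ N ∣ y k - y' k) (k : ι) :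
    X i ^ (N + 1) ∣
      integ i (MvPolynomial.aeval (Sum.elim y fun l => pderiv ℝ j (y l)) (P k))
        - integ i (MvPolynomial.aeval (Sum.elim y' fun l => pderiv ℝ j (y' l)) (P k)) := by
  rw [← integ_sub]
  refine X_pow_succ_dvd_integ (dvd_aeval_sub _ _ _ _ ?_)
  rintro (t | t)
  · exact h t
  · simp only [Sum.elim_inr]
    rw [← map_sub]
    exact X_pow_dvd_pderiv hij (h t)

theorem picard_dvd {i j : σ} (hij : j ≠ i) (P : ι → MvPolynomial (ι ⊕ ι) (MvPowerSeries σ ℝ))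
    (y₀ : ι → MvPowerSeries σ ℝ) (N : ℕ) (k : ι) :
    X i ^ (N + 1) ∣ picard i j P y₀ (N + 1) k - picard i j P y₀ N k := by
  induction N generalizing k with
  | zero =>
    simp only [picard, add_sub_cancel_left]
    exact X_pow_succ_dvd_integ (by simp)
  | succ N ih =>
    rw [picard]
    conv => rhs; rhs; rw [picard]
    rw [add_sub_add_left_eq_sub]
    exact dvd_step hij P ih k

theorem picard_dvd_of_le {i j : σ} (hij : j ≠ i)
    (P : ι → MvPolynomial (ι ⊕ ι) (MvPowerSeries σ ℝ)) (y₀ : ι → MvPowerSeries σ ℝ)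
    {N M : ℕ} (h : N ≤ M) (k : ι) :
    X i ^ (N + 1) ∣ picard i j P y₀ M k - picard i j P y₀ N k := by
  induction M, h using Nat.le_induction with
  | base => simp
  | succ M hM ih =>
    have := (pow_dvd_pow (X i) (by omega : N + 1 ≤ M + 1)).trans (picard_dvd hij P y₀ M k)
    simpa using dvd_add this ih

/-- The formal solution of the Cauchy problem. -/
noncomputable def ckSol (i j : σ) (P : ι → MvPolynomial (ι ⊕ ι) (MvPowerSeries σ ℝ))
    (y₀ : ι → MvPowerSeries σ ℝ) (k : ι) : MvPowerSeries σ ℝ :=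
  fun n => coeff n (picard i j P y₀ (n i) k)

theorem coeff_ckSol {i j : σ} (hij : j ≠ i)
    (P : ι → MvPolynomial (ι ⊕ ι) (MvPowerSeries σ ℝ)) (y₀ : ι → MvPowerSeries σ ℝ) (k : ι)
    {n : σ →₀ ℕ} {N : ℕ} (h : n i ≤ N) :
    coeff n (ckSol i j P y₀ k) = coeff n (picard i j P y₀ N k) := by
  have := X_pow_dvd_iff.1 (picard_dvd_of_le hij P y₀ h k) n (by omega)
  rw [map_sub, sub_eq_zero] at this
  rw [this]
  rfl

/-- The iterates converge X i-adically and the integral operator is continuous for this topology, so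
the limit is a fixed point. -/
theorem ckSol_eq {i j : σ} (hij : j ≠ i) (P : ι → MvPolynomial (ι ⊕ ι) (MvPowerSeries σ ℝ))
    (y₀ : ι → MvPowerSeries σ ℝ) (k : ι) :
    ckSol i j P y₀ k = y₀ k + integ i (MvPolynomial.aeval
      (Sum.elim (ckSol i j P y₀) fun l => pderiv ℝ j (ckSol i j P y₀ l)) (P k)) := by
  rw [← sub_eq_zero]
  refine eq_zero_of_forall_X_pow_dvd (i := i) fun N => ?_
  have h1 : ∀ k, X i ^ (N + 1) ∣ ckSol i j P y₀ k - picard i j P y₀ N k := by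
    intro k
    rw [X_pow_dvd_iff]
    intro m hm
    rw [map_sub, coeff_ckSol hij P y₀ k (by omega : m i ≤ N), sub_self]
  have h2 : X i ^ (N + 1) ∣ ckSol i j P y₀ k - picard i j P y₀ (N + 1) k := by
    rw [X_pow_dvd_iff]
    intro m hm
    rw [map_sub, coeff_ckSol hij P y₀ k (by omega : m i ≤ N + 1), sub_self]
  have h3 := (pow_dvd_pow (X i) (by omega : N + 1 ≤ N + 2)).trans (dvd_step hij P h1 k)
  have h4 := dvd_sub h2 h3
  rw [picard] at h4
  refine (pow_dvd_pow (X i) (by omega : N ≤ N + 1)).trans ?_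
  convert h4 using 1
  ring

/-- Each application of the integral equation improves the X i-adic agreement of two solutions by
one order. -/
theorem eq_of_integral_eq {i j : σ} (hij : j ≠ i)
    (P : ι → MvPolynomial (ι ⊕ ι) (MvPowerSeries σ ℝ)) {y₀ y y' : ι → MvPowerSeries σ ℝ}
    (h : ∀ k, y k = y₀ k + integ i (MvPolynomial.aeval
      (Sum.elim y fun l => pderiv ℝ j (y l)) (P k)))
    (h' : ∀ k, y' k = y₀ k + integ i (MvPolynomial.aeval
      (Sum.elim y' fun l => pderiv ℝ j (y' l)) (P k))) : y = y' := by
  have key : ∀ N k, X i ^ N ∣ y k - y' k := by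
    intro N
    induction N with
    | zero => simp
    | succ N ih =>
      intro k
      rw [h k, h' k, add_sub_add_left_eq_sub]
      exact dvd_step hij P ih k
  funext k
  exact sub_eq_zero.1 (eq_zero_of_forall_X_pow_dvd fun N => key N k)

/-- Uniqueness in the formal Cauchy–Kovalevskaya theorem. -/
theorem ck_unique {i j : σ} (hij : j ≠ i)
    (P : ι → MvPolynomial (ι ⊕ ι) (MvPowerSeries σ ℝ)) {y y' : ι → MvPowerSeries σ ℝ}
    (h : ∀ k, pderiv ℝ i (y k) = MvPolynomial.aeval (Sum.elim y fun l => pderiv ℝ j (y l)) (P k))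
    (h' : ∀ k, pderiv ℝ i (y' k)
      = MvPolynomial.aeval (Sum.elim y' fun l => pderiv ℝ j (y' l)) (P k))
    (h0 : ∀ k, restr i (y k) = restr i (y' k)) : y = y' := by
  refine eq_of_integral_eq hij P (y₀ := fun k => restr i (y k)) (fun k => ?_) fun k => ?_
  · rw [← h k, restr_add_integ_pderiv]
  · rw [← h' k, h0 k, restr_add_integ_pderiv]

/-- The ball of radius A₀ + 1 is stable under iteration. Since the right hand sides involve ∂ⱼy,
this derivative is carried along in the induction; its increment is bounded through ∫ ∂ⱼ dxᵢ instead
of by differentiating an estimate. -/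
theorem picard_wnorm_le [Fintype σ] [Fintype ι] {i j : σ} (hij : j ≠ i)
    (P : ι → MvPolynomial (ι ⊕ ι) (MvPowerSeries σ ℝ)) (y₀ : ι → MvPowerSeries σ ℝ)
    (R : σ → ℝ≥0) (hR : 0 < R j) (A₀ : ℝ≥0∞) (B : ℝ≥0∞)
    (hy : ∀ k, wnorm (fun n => (ckWeight i j R n : ℝ≥0∞)) (y₀ k) ≤ A₀)
    (hy' : ∀ k, wnorm (fun n => (ckWeight i j R n : ℝ≥0∞)) (pderiv ℝ j (y₀ k)) ≤ A₀)
    (hB : ∀ y : ι ⊕ ι → MvPowerSeries σ ℝ,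
      (∀ t, wnorm (fun n => (ckWeight i j R n : ℝ≥0∞)) (y t) ≤ A₀ + 1) →
        ∀ k, wnorm (fun n => (ckWeight i j R n : ℝ≥0∞)) (MvPolynomial.aeval y (P k)) ≤ B)
    (h1 : (R i : ℝ≥0∞) * B ≤ 1) (h2 : ((R i / R j : ℝ≥0) : ℝ≥0∞) * B ≤ 1) (N : ℕ) (k : ι) :
    wnorm (fun n => (ckWeight i j R n : ℝ≥0∞)) (picard i j P y₀ N k) ≤ A₀ + 1 ∧
    wnorm (fun n => (ckWeight i j R n : ℝ≥0∞)) (pderiv ℝ j (picard i j P y₀ N k)) ≤ A₀ + 1 := by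
  induction N generalizing k with
  | zero => exact ⟨(hy k).trans le_self_add, (hy' k).trans le_self_add⟩
  | succ N ih =>
    have hz := hB (Sum.elim (picard i j P y₀ N) fun l => pderiv ℝ j (picard i j P y₀ N l))
      (by rintro (t | t); exacts [(ih t).1, (ih t).2]) k
    rw [picard]
    constructor
    · refine (wnorm_add_le _ _ _).trans (add_le_add (hy k) ?_)
      refine (wnorm_integ_le hij R _).trans (le_trans ?_ h1)
      gcongr
    · rw [map_add, pderiv_integ_of_ne hij]
      refine (wnorm_add_le _ _ _).trans (add_le_add (hy' k) ?_)
      refine (wnorm_integ_pderiv_le hij hR _).trans (le_trans ?_ h2)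
      gcongr

/-- A Fatou argument: a finite partial sum of the norm of the limit only sees the coefficients of
one sufficiently late iterate. -/
theorem wnorm_le_of_forall_picard {i j : σ} (hij : j ≠ i)
    (P : ι → MvPolynomial (ι ⊕ ι) (MvPowerSeries σ ℝ)) (y₀ : ι → MvPowerSeries σ ℝ)
    (w : (σ →₀ ℕ) → ℝ≥0∞) (A : ℝ≥0∞) (k : ι) (h : ∀ N, wnorm w (picard i j P y₀ N k) ≤ A) :
    wnorm w (ckSol i j P y₀ k) ≤ A := by
  unfold wnorm
  rw [ENNReal.tsum_eq_iSup_sum]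
  refine iSup_le fun s => ?_
  have hN : ∀ n ∈ s, n i ≤ s.sup fun n => n i := fun n hn => Finset.le_sup (f := fun n => n i) hn
  rw [Finset.sum_congr rfl fun n hn => by rw [coeff_ckSol hij P y₀ k (hN n hn)]]
  exact (ENNReal.sum_le_tsum s).trans (h _)

theorem ckSol_conv [Fintype σ] [Fintype ι] {i j : σ} (hij : j ≠ i)
    (P : ι → MvPolynomial (ι ⊕ ι) (MvPowerSeries σ ℝ)) (y₀ : ι → MvPowerSeries σ ℝ)
    (hP : ∀ k m, Conv ((P k).coeff m)) (hy₀ : ∀ k, Conv (y₀ k)) (k : ι) :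
    Conv (ckSol i j P y₀ k) := by
  classical
  obtain ⟨r₁, hr₁, H₁⟩ := exists_common_radius Finset.univ y₀ fun k _ => hy₀ k
  obtain ⟨r₂, hr₂, H₂⟩ := exists_common_radius Finset.univ (fun k => pderiv ℝ j (y₀ k))
    fun k _ => (hy₀ k).pderiv j
  obtain ⟨r₃, hr₃, H₃⟩ := exists_common_radius (Finset.univ.sigma fun k => (P k).support)
    (fun p => (P p.1).coeff p.2) fun p _ => hP p.1 p.2
  set r := min r₁ (min r₂ r₃) with hrdef
  have hr : 0 < r := lt_min hr₁ (lt_min hr₂ hr₃)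
  set w₀ : (σ →₀ ℕ) → ℝ≥0∞ := fun n => (monoWeight (fun _ => r) n : ℝ≥0∞) with hw₀
  have K₁ : ∀ k, wnorm w₀ (y₀ k) < ⊤ := fun k =>
    (wnorm_monoWeight_mono (fun _ => min_le_left _ _) _).trans_lt (H₁ k (Finset.mem_univ _))
  have K₂ : ∀ k, wnorm w₀ (pderiv ℝ j (y₀ k)) < ⊤ := fun k =>
    (wnorm_monoWeight_mono (fun _ => (min_le_right _ _).trans (min_le_left _ _)) _).trans_lt
      (H₂ k (Finset.mem_univ _))
  have K₃ : ∀ k m, wnorm w₀ ((P k).coeff m) < ⊤ := by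
    intro k m
    by_cases hm : m ∈ (P k).support
    · exact (wnorm_monoWeight_mono (fun _ => (min_le_right _ _).trans (min_le_right _ _)) _).trans_lt
        (H₃ ⟨k, m⟩ (by simpa using hm))
    · rw [MvPolynomial.notMem_support_iff.1 hm, wnorm_zero]; exact ENNReal.zero_lt_top
  set A₀ : ℝ≥0∞ := ∑ k, (wnorm w₀ (y₀ k) + wnorm w₀ (pderiv ℝ j (y₀ k))) with hA₀
  have hA : A₀ + 1 < ⊤ := by
    refine ENNReal.add_lt_top.2 ⟨ENNReal.sum_lt_top.2 fun k _ => ENNReal.add_lt_top.2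
      ⟨K₁ k, K₂ k⟩, ENNReal.one_lt_top⟩
  have hA1 : ∀ k, wnorm w₀ (y₀ k) + wnorm w₀ (pderiv ℝ j (y₀ k)) ≤ A₀ := fun k =>
    Finset.single_le_sum (f := fun k => wnorm w₀ (y₀ k) + wnorm w₀ (pderiv ℝ j (y₀ k)))
      (fun _ _ => zero_le) (Finset.mem_univ k)
  -- The bounds `B k` hold for all admissible weights below `w₀`, so they survive the later
  -- shrinking of the radius in the direction `i`.
  choose B hB HB using fun k => exists_wnorm_aeval_le (P k) w₀ (K₃ k) (A₀ + 1) hA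
  obtain ⟨b, hb1, hb⟩ : ∃ b : ℝ≥0, 1 ≤ b ∧ ∀ k, B k ≤ b := by
    refine ⟨(∑ k, B k).toNNReal + 1, le_add_self, fun k => ?_⟩
    rw [ENNReal.coe_add, ENNReal.coe_toNNReal (ENNReal.sum_lt_top.2 fun k _ => hB k).ne]
    exact (Finset.single_le_sum (f := B) (fun _ _ => zero_le) (Finset.mem_univ k)).trans
      le_self_add
  have hb0 : 0 < b := one_pos.trans_le hb1
  -- This choice gives both smallness conditions ρ b ≤ 1 and (ρ / r) b ≤ 1 of the stability lemma.
  -- Only the direction `i` receives the radius ρ.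
  set ρ : ℝ≥0 := min 1 r / b with hρdef
  have hρ : 0 < ρ := by positivity
  have hρr : ρ ≤ r := (div_le_self (by positivity) hb1).trans (min_le_right _ _)
  set R : σ → ℝ≥0 := fun k => if k = i then ρ else r with hR
  have hRr : ∀ k, R k ≤ r := by
    intro k; simp only [hR]; split_ifs; exacts [hρr, le_rfl]
  have hRi : R i = ρ := by simp [hR]
  have hRj : R j = r := by simp [hR, hij]
  have hw : ∀ n, (ckWeight i j R n : ℝ≥0∞) ≤ w₀ n := fun n => ENNReal.coe_le_coe.2 <|
    (ckWeight_le i j R n).trans (monoWeight_mono hRr n)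
  have main := fun N k => (picard_wnorm_le hij P y₀ R (by rw [hRj]; exact hr) A₀ b
    (fun k => (wnorm_mono_weight hw _).trans (le_self_add.trans (hA1 k)))
    (fun k => (wnorm_mono_weight hw _).trans (le_add_self.trans (hA1 k)))
    (fun y hy k => (HB k _ hw (fun m n => by exact_mod_cast ckWeight_add_le i j R m n)
      (by rw [ckWeight_zero]; simp) y hy).trans (hb k))
    (by
      rw [hRi]
      have : ρ * b ≤ 1 := by
        rw [hρdef, div_mul_cancel₀ _ hb0.ne']; exact min_le_left _ _
      exact_mod_cast this)
    (by
      rw [hRi, hRj]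
      have : ρ / r * b ≤ 1 := by
        rw [hρdef, div_div, mul_comm b r, ← div_div, div_mul_cancel₀ _ hb0.ne']
        exact div_le_one_of_le₀ (min_le_right _ _) (by positivity)
      exact_mod_cast this) N k).1
  have hfin := (wnorm_le_of_forall_picard hij P y₀ _ (A₀ + 1) k fun N => main N k).trans_lt hA
  -- Return from `ckWeight` to a monomial weight: the binomial coefficient is at most 2 to the power
  -- of the degree, so it is absorbed by halving the radius.
  refine ⟨ρ / 2, by positivity, lt_of_le_of_lt (wnorm_mono_weight (fun n => ?_) _) hfin⟩
  have h3 : monoWeight (fun _ => ρ / 2) n ≤ ckWeight i j R n := by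
    unfold ckWeight
    rw [le_div_iff₀ (choose_pos' _ _)]
    have h4 : ((n i + n j).choose (n i) : ℝ≥0) ≤ 2 ^ n.degree := by
      have h5 : (n i + n j).choose (n i) ≤ 2 ^ n.degree := by
        refine (Nat.choose_le_two_pow _ _).trans (Nat.pow_le_pow_right (by norm_num) ?_)
        rw [Finsupp.degree_eq_sum]
        have := Finset.sum_le_sum_of_subset (f := n) (Finset.subset_univ ({i, j} : Finset σ))
        rwa [Finset.sum_pair (Ne.symm hij)] at this
      exact_mod_cast h5
    calc _ ≤ monoWeight (fun _ => ρ / 2) n * 2 ^ n.degree := mul_le_mul_right h4 _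
      _ = monoWeight (fun _ => ρ) n := by
        rw [monoWeight_const, monoWeight_const, ← mul_pow, div_mul_cancel₀ _ two_ne_zero]
      _ ≤ _ := monoWeight_mono (fun k => by
        simp only [hR]; split_ifs; exacts [le_rfl, hρr]) n
  exact_mod_cast h3

/-- The formal Cauchy–Kovalevskaya theorem, with convergence of the solution. -/
theorem ck_exists [Fintype σ] [Fintype ι] {i j : σ} (hij : j ≠ i)
    (P : ι → MvPolynomial (ι ⊕ ι) (MvPowerSeries σ ℝ)) (y₀ : ι → MvPowerSeries σ ℝ)
    (hP : ∀ k m, Conv ((P k).coeff m)) (hy₀ : ∀ k, Conv (y₀ k))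
    (hr : ∀ k, restr i (y₀ k) = y₀ k) :
    ∃ y : ι → MvPowerSeries σ ℝ, (∀ k, Conv (y k)) ∧ (∀ k, restr i (y k) = y₀ k) ∧
      ∀ k, pderiv ℝ i (y k)
        = MvPolynomial.aeval (Sum.elim y fun l => pderiv ℝ j (y l)) (P k) := by
  refine ⟨ckSol i j P y₀, ckSol_conv hij P y₀ hP hy₀, fun k => ?_, fun k => ?_⟩
  · rw [ckSol_eq hij, restr_add, restr_integ, hr, add_zero]
  · conv_lhs => rw [ckSol_eq hij, ← hr k]
    rw [map_add, pderiv_restr_self, zero_add, pderiv_integ]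

end CauchyKovalevskaya

end FormalGerm

namespace FormalGerm

open MvPowerSeries
open scoped ENNReal NNReal

/-! ### Convergent series as analytic functions, and conversely -/

section Evaluation

variable {σ : Type*} [Fintype σ]

/-- The value of a monomial. -/
noncomputable def monom (x : σ → ℝ) (n : σ →₀ ℕ) : ℝ := ∏ k, x k ^ n k

theorem monom_add (x : σ → ℝ) (m n : σ →₀ ℕ) : monom x (m + n) = monom x m * monom x n := by
  simp [monom, pow_add, Finset.prod_mul_distrib]

theorem monom_single (x : σ → ℝ) (i : σ) : monom x (Finsupp.single i 1) = x i := by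
  classical
  unfold monom
  rw [Finset.prod_eq_single i]
  · simp
  · intro k _ hk; simp [hk.symm]
  · simp

/-- The sum of a power series. -/
noncomputable def evalS (a : MvPowerSeries σ ℝ) (x : σ → ℝ) : ℝ := ∑' n, coeff n a * monom x n

theorem summable_of_wnorm {r : ℝ≥0} {a : MvPowerSeries σ ℝ}
    (h : wnorm (fun n => (monoWeight (fun _ => r) n : ℝ≥0∞)) a < ⊤) :
    Summable fun n => ‖coeff n a‖ * (r : ℝ) ^ n.degree := by
  have := ENNReal.summable_toReal h.ne
  refine this.congr fun n => ?_
  rw [ENNReal.toReal_mul]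
  simp [monoWeight_const]

theorem norm_monom_le {r : ℝ} {x : σ → ℝ} (hx : ∀ k, |x k| ≤ r) (n : σ →₀ ℕ) :
    ‖monom x n‖ ≤ r ^ n.degree := by
  unfold monom
  rw [norm_prod, Finsupp.degree_eq_sum, ← Finset.prod_pow_eq_pow_sum]
  refine Finset.prod_le_prod (fun _ _ => norm_nonneg _) fun k _ => ?_
  rw [norm_pow]
  exact pow_le_pow_left₀ (norm_nonneg _) (hx k) _

theorem summable_norm_of_wnorm {r : ℝ≥0} {a : MvPowerSeries σ ℝ}
    (h : wnorm (fun n => (monoWeight (fun _ => r) n : ℝ≥0∞)) a < ⊤) {x : σ → ℝ}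
    (hx : ∀ k, |x k| ≤ r) : Summable fun n => ‖coeff n a * monom x n‖ := by
  refine Summable.of_nonneg_of_le (fun _ => norm_nonneg _) (fun n => ?_) (summable_of_wnorm h)
  rw [norm_mul]
  exact mul_le_mul_of_nonneg_left (norm_monom_le hx n) (norm_nonneg _)

theorem eventually_abs_lt {r : ℝ} (hr : 0 < r) : ∀ᶠ x : σ → ℝ in 𝓝 0, ∀ k, |x k| < r := by
  refine eventually_all.2 fun k => ?_
  have : Tendsto (fun x : σ → ℝ => |x k|) (𝓝 0) (𝓝 0) := by
    have h : Continuous fun x : σ → ℝ => |x k| := by fun_prop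
    simpa using h.tendsto 0
  exact this.eventually (gt_mem_nhds hr)

theorem Conv.eventually_summable {a : MvPowerSeries σ ℝ} (h : Conv a) :
    ∀ᶠ x : σ → ℝ in 𝓝 0, Summable fun n => ‖coeff n a * monom x n‖ := by
  obtain ⟨r, hr, ha⟩ := h
  filter_upwards [eventually_abs_lt (σ := σ) (NNReal.coe_pos.2 hr)] with x hx
  exact summable_norm_of_wnorm ha fun k => (hx k).le

theorem Conv.add {a b : MvPowerSeries σ ℝ} (ha : Conv a) (hb : Conv b) : Conv (a + b) := by
  obtain ⟨r, hr, h⟩ := exists_common_radius Finset.univ ![a, b] (by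
    intro t _; fin_cases t <;> assumption)
  exact ⟨r, hr, (wnorm_add_le _ _ _).trans_lt
    (ENNReal.add_lt_top.2 ⟨h 0 (Finset.mem_univ _), h 1 (Finset.mem_univ _)⟩)⟩

theorem Conv.mul {a b : MvPowerSeries σ ℝ} (ha : Conv a) (hb : Conv b) : Conv (a * b) := by
  obtain ⟨r, hr, h⟩ := exists_common_radius Finset.univ ![a, b] (by
    intro t _; fin_cases t <;> assumption)
  exact ⟨r, hr, (wnorm_mul_le (fun m n => by rw [monoWeight_add]; simp) _ _).trans_lt
    (ENNReal.mul_lt_top (h 0 (Finset.mem_univ _)) (h 1 (Finset.mem_univ _)))⟩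

theorem conv_C (c : ℝ) : Conv (C c : MvPowerSeries σ ℝ) := by
  classical
  refine ⟨1, one_pos, ?_⟩
  unfold wnorm
  rw [tsum_eq_single 0]
  · exact ENNReal.mul_lt_top (by simp) ENNReal.coe_lt_top
  · intro n hn
    simp [coeff_C, hn]

theorem conv_X (i : σ) : Conv (X i : MvPowerSeries σ ℝ) := by
  classical
  refine ⟨1, one_pos, ?_⟩
  unfold wnorm
  rw [tsum_eq_single (Finsupp.single i 1)]
  · exact ENNReal.mul_lt_top (by simp) ENNReal.coe_lt_top
  · intro n hn
    simp [coeff_X, hn]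

theorem conv_of_enorm_coeff_le {a b : MvPowerSeries σ ℝ} (hb : Conv b)
    (h : ∀ n, ‖coeff n a‖ ≤ ‖coeff n b‖) : Conv a := by
  obtain ⟨r, hr, hb⟩ := hb
  refine ⟨r, hr, lt_of_le_of_lt (ENNReal.tsum_le_tsum fun n => ?_) hb⟩
  exact mul_le_mul_left (enorm_le_iff_norm_le.2 (h n)) _

theorem Conv.restr {a : MvPowerSeries σ ℝ} (ha : Conv a) (i : σ) : Conv (restr i a) :=
  conv_of_enorm_coeff_le ha fun n => by
    rw [coeff_restr]
    split_ifs <;> simp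

theorem evalS_add {a b : MvPowerSeries σ ℝ} (ha : Conv a) (hb : Conv b) :
    evalS (a + b) =ᶠ[𝓝 0] fun x => evalS a x + evalS b x := by
  filter_upwards [ha.eventually_summable, hb.eventually_summable] with x h1 h2
  unfold evalS
  rw [← h1.of_norm.tsum_add h2.of_norm]
  exact tsum_congr fun n => by rw [map_add, add_mul]

theorem evalS_mul {a b : MvPowerSeries σ ℝ} (ha : Conv a) (hb : Conv b) :
    evalS (a * b) =ᶠ[𝓝 0] fun x => evalS a x * evalS b x := by
  classical
  filter_upwards [ha.eventually_summable, hb.eventually_summable] with x h1 h2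
  unfold evalS
  rw [h1.of_norm.tsum_mul_tsum_eq_tsum_sum_antidiagonal h2.of_norm
    (summable_mul_of_summable_norm h1 h2)]
  refine tsum_congr fun n => ?_
  rw [coeff_mul, Finset.sum_mul]
  refine Finset.sum_congr rfl fun p hp => ?_
  rw [← Finset.HasAntidiagonal.mem_antidiagonal.1 hp, monom_add]
  ring

theorem evalS_C (c : ℝ) (x : σ → ℝ) : evalS (C c) x = c := by
  classical
  unfold evalS
  rw [tsum_eq_single 0]
  · simp [monom]
  · intro n hn
    simp [coeff_C, hn]

theorem evalS_X (i : σ) (x : σ → ℝ) : evalS (X i) x = x i := by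
  classical
  unfold evalS
  rw [tsum_eq_single (Finsupp.single i 1)]
  · simp [monom_single]
  · intro n hn
    simp [coeff_X, hn]

theorem evalS_restr [DecidableEq σ] (i : σ) (a : MvPowerSeries σ ℝ) (x : σ → ℝ) :
    evalS (restr i a) x = evalS a (Function.update x i 0) := by
  unfold evalS
  refine tsum_congr fun n => ?_
  rw [coeff_restr]
  unfold monom
  split_ifs with h
  · congr 1
    refine Finset.prod_congr rfl fun k _ => ?_
    by_cases hk : k = i
    · subst hk; simp [h]
    · simp [hk]
  · rw [zero_mul, Finset.prod_eq_zero (Finset.mem_univ i), mul_zero]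
    simp [h]

theorem evalS_zero_point (a : MvPowerSeries σ ℝ) : evalS a 0 = constantCoeff a := by
  unfold evalS
  rw [tsum_eq_single 0]
  · simp [monom]
  · intro n hn
    obtain ⟨k, hk⟩ : ∃ k, n k ≠ 0 := by
      by_contra! h; exact hn (Finsupp.ext h)
    rw [monom, Finset.prod_eq_zero (Finset.mem_univ k), mul_zero]
    simp [hk]

/-! ### Derivatives -/

theorem monom_update [DecidableEq σ] (x : σ → ℝ) (i : σ) (t : ℝ) (n : σ →₀ ℕ) :
    monom (Function.update x i t) n = (∏ k ∈ Finset.univ.erase i, x k ^ n k) * t ^ n i := by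
  unfold monom
  rw [← Finset.prod_erase_mul _ _ (Finset.mem_univ i)]
  congr 1
  · refine Finset.prod_congr rfl fun k hk => ?_
    rw [Function.update_of_ne (Finset.ne_of_mem_erase hk)]
  · simp

/-- Termwise differentiation in one variable: the derived series converges absolutely on the
polydisc and, shifted by one index, majorises the derivatives of the terms. -/
theorem hasDerivAt_evalS_update [DecidableEq σ] {a : MvPowerSeries σ ℝ} (ha : Conv a) (i : σ) :
    ∀ᶠ x : σ → ℝ in 𝓝 0, HasDerivAt (fun t => evalS a (Function.update x i t))
      (evalS (pderiv ℝ i a) x) (x i) := by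
  obtain ⟨r, hr, h'⟩ := exists_common_radius Finset.univ ![a, pderiv ℝ i a] (by
    intro t _; fin_cases t; exacts [ha, ha.pderiv i])
  have h₁' := h' 0 (Finset.mem_univ _)
  have h₂' := h' 1 (Finset.mem_univ _)
  simp only [Matrix.cons_val_zero, Matrix.cons_val_one] at h₁' h₂'
  have hs := summable_of_wnorm h₂'
  filter_upwards [eventually_abs_lt (σ := σ) (NNReal.coe_pos.2 hr)] with x hx
  set g : (σ →₀ ℕ) → ℝ → ℝ := fun n t => coeff n a * monom (Function.update x i t) n with hg
  set g' : (σ →₀ ℕ) → ℝ → ℝ := fun n t =>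
    coeff n a * ((∏ k ∈ Finset.univ.erase i, x k ^ n k) * (n i * t ^ (n i - 1))) with hg'
  -- The majorant of the term with index n is the term of ∂ᵢa with index n − eᵢ; terms without the
  -- variable `i` have derivative zero.
  set u : (σ →₀ ℕ) → ℝ := fun n => if n i = 0 then 0 else
    ‖coeff (n - Finsupp.single i 1) (pderiv ℝ i a)‖ * (r : ℝ) ^ (n - Finsupp.single i 1).degree
    with hu
  have hinj : Function.Injective fun n : σ →₀ ℕ => n + Finsupp.single i 1 :=
    add_left_injective _
  have hrange : ∀ n ∉ Set.range (fun n : σ →₀ ℕ => n + Finsupp.single i 1), n i = 0 := by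
    intro n hn
    by_contra h0
    obtain ⟨m, rfl⟩ := exists_eq_add_single h0
    exact hn ⟨m, rfl⟩
  have hus : Summable u := by
    rw [← hinj.summable_iff (fun n hn => by simp [hu, hrange n hn])]
    refine hs.congr fun n => ?_
    simp [hu, Function.comp]
  have hg'm : ∀ m t, g' (m + Finsupp.single i 1) t
      = coeff m (pderiv ℝ i a) * monom (Function.update x i t) m := by
    intro m t
    simp only [hg']
    rw [coeff_pderiv, monom_update]
    have : ∏ k ∈ Finset.univ.erase i, x k ^ (m + Finsupp.single i 1 : σ →₀ ℕ) k
        = ∏ k ∈ Finset.univ.erase i, x k ^ m k := by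
      refine Finset.prod_congr rfl fun k hk => ?_
      simp [(Finset.ne_of_mem_erase hk).symm]
    rw [this]
    simp
    ring
  have hg'0 : ∀ n t, n i = 0 → g' n t = 0 := by
    intro n t hn; simp [hg', hn]
  have main := hasDerivAt_tsum_of_isPreconnected (g := g) (g' := g') (t := Metric.ball (0 : ℝ) r)
    (y₀ := x i) (y := x i) hus Metric.isOpen_ball (convex_ball _ _).isPreconnected
    (fun n t _ => by
      simp only [hg, monom_update]
      exact ((hasDerivAt_pow (n i) t).const_mul _).const_mul _)
    (fun n t ht => by
      by_cases hn : n i = 0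
      · rw [hg'0 n t hn]; simp [hu, hn]
      · obtain ⟨m, rfl⟩ := exists_eq_add_single hn
        rw [hg'm]
        have e : u (m + Finsupp.single i 1)
          = ‖coeff m (pderiv ℝ i a)‖ * (r : ℝ) ^ m.degree := by simp [hu]
        rw [e, norm_mul]
        refine mul_le_mul_of_nonneg_left (norm_monom_le (fun k => ?_) m) (norm_nonneg _)
        by_cases hk : k = i
        · subst hk
          rw [Function.update_self]
          simpa using (mem_ball_zero_iff.1 ht).le
        · rw [Function.update_of_ne hk]; exact (hx k).le)
    (by simpa using hx i)
    (by
      simp only [hg, Function.update_eq_self]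
      exact (summable_norm_of_wnorm h₁' fun k => (hx k).le).of_norm)
    (by simpa using hx i)
  have e : evalS (pderiv ℝ i a) x = ∑' n, g' n (x i) := by
    rw [← hinj.tsum_eq (f := fun n => g' n (x i)) fun n hn => by
      by_contra h
      exact hn (hg'0 n _ (hrange n h))]
    unfold evalS
    refine tsum_congr fun m => ?_
    rw [hg'm, Function.update_eq_self]
  rw [e]
  exact main

/-! ### Analyticity -/

/-- Writing a monomial as a product of coordinates along a word turns it into the diagonal of a
multilinear map, the form required by a `FormalMultilinearSeries`. The default letter is irrelevant:
it only fills words of the wrong length. -/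
theorem exists_word [Inhabited σ] (n : σ →₀ ℕ) : ∃ W : (k : ℕ) → Fin k → σ,
    ∀ x : σ → ℝ, ∏ j, x (W n.degree j) = monom x n := by
  classical
  set l := (Finsupp.toMultiset n).toList with hl
  refine ⟨fun k j => l.getD j default, fun x => ?_⟩
  have hlen : l.length = n.degree := by
    rw [hl, Multiset.length_toList, Finsupp.card_toMultiset, Finsupp.degree]
    rfl
  have hprod : (l.map x).prod = monom x n := by
    rw [← Multiset.prod_coe, ← Multiset.map_coe, hl, Multiset.coe_toList,
      Finsupp.toMultiset_map, Finsupp.prod_toMultiset, Finsupp.prod_mapDomain_index (by simp)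
        (fun _ _ _ => pow_add _ _ _), Finsupp.prod_fintype _ _ (by simp)]
    rfl
  rw [← hprod, ← Fin.prod_univ_fun_getElem]
  clear hprod
  generalize n.degree = d at hlen
  subst hlen
  refine Finset.prod_congr rfl fun j _ => ?_
  simp

/-- The multi-indices of degree `k`. -/
noncomputable def degSet [DecidableEq σ] (k : ℕ) : Finset (σ →₀ ℕ) :=
  Finset.finsuppAntidiag Finset.univ k

theorem mem_degSet [DecidableEq σ] {k : ℕ} {n : σ →₀ ℕ} : n ∈ degSet k ↔ n.degree = k := by
  simp [degSet, Finset.mem_finsuppAntidiag, Finsupp.degree_eq_sum]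

theorem coe_degSet [DecidableEq σ] (k : ℕ) :
    ((degSet k : Finset (σ →₀ ℕ)) : Set (σ →₀ ℕ)) = (fun n => n.degree) ⁻¹' {k} := by
  ext n; simp [mem_degSet]

theorem hasSum_degSet [DecidableEq σ] {f : (σ →₀ ℕ) → ℝ} {A : ℝ} (h : HasSum f A) :
    HasSum (fun k => ∑ n ∈ degSet k, f n) A := by
  refine (h.tsum_fiberwise fun n => n.degree).congr_fun fun k => ?_
  rw [← coe_degSet]
  exact (Finset.tsum_subtype' _ f).symm

theorem ennreal_tsum_degSet [DecidableEq σ] (f : (σ →₀ ℕ) → ℝ≥0∞) :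
    ∑' n, f n = ∑' k, ∑ n ∈ degSet k, f n := by
  rw [← ENNReal.tsum_fiberwise f fun n => n.degree]
  refine tsum_congr fun k => ?_
  rw [← coe_degSet]
  exact Finset.tsum_subtype' _ f

theorem analyticAt_evalS [Inhabited σ] {a : MvPowerSeries σ ℝ} (ha : Conv a) :
    AnalyticAt ℝ (evalS a) 0 := by
  classical
  obtain ⟨r, hr, ha⟩ := ha
  choose W hW using exists_word (σ := σ)
  set q : (n : σ →₀ ℕ) → (k : ℕ) → ContinuousMultilinearMap ℝ (fun _ : Fin k => σ → ℝ) ℝ :=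
    fun n k => (ContinuousMultilinearMap.mkPiAlgebraFin ℝ k ℝ).compContinuousLinearMap
      fun j => ContinuousLinearMap.proj (W n k j) with hq
  have hqn : ∀ n k, ‖q n k‖ ≤ 1 := by
    intro n k
    refine ContinuousMultilinearMap.opNorm_le_bound zero_le_one fun m => ?_
    simp only [hq, ContinuousMultilinearMap.compContinuousLinearMap_apply,
      ContinuousMultilinearMap.mkPiAlgebraFin_apply, ContinuousLinearMap.proj_apply, one_mul]
    rw [List.prod_ofFn, norm_prod]
    exact Finset.prod_le_prod (fun _ _ => norm_nonneg _) fun j _ => norm_le_pi_norm _ _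
  set p : FormalMultilinearSeries ℝ (σ → ℝ) ℝ := fun k => ∑ n ∈ degSet k, coeff n a • q n k
    with hp
  have hs := summable_of_wnorm ha
  refine ⟨p, r, ?_, by exact_mod_cast hr, ?_⟩
  · refine p.le_radius_of_bound (∑' n, ‖coeff n a‖ * (r : ℝ) ^ n.degree) fun k => ?_
    calc ‖p k‖ * (r : ℝ) ^ k ≤ (∑ n ∈ degSet k, ‖coeff n a‖) * (r : ℝ) ^ k := by
          gcongr
          refine (norm_sum_le _ _).trans (Finset.sum_le_sum fun n _ => ?_)
          rw [norm_smul]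
          exact mul_le_of_le_one_right (norm_nonneg _) (hqn n k)
      _ = ∑ n ∈ degSet k, ‖coeff n a‖ * (r : ℝ) ^ n.degree := by
          rw [Finset.sum_mul]
          exact Finset.sum_congr rfl fun n hn => by rw [mem_degSet.1 hn]
      _ ≤ _ := hs.sum_le_tsum _ fun n _ => by positivity
  · intro y hy
    rw [zero_add]
    have hy' : ∀ k, |y k| ≤ r := by
      intro k
      have h1 : ‖y‖ < r := by simpa using hy
      exact (norm_le_pi_norm y k).trans h1.le
    have h2 := hasSum_degSet (summable_norm_of_wnorm ha hy').of_norm.hasSum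
    refine h2.congr_fun fun k => ?_
    simp only [hp, sum_apply, smul_apply]
    refine Finset.sum_congr rfl fun n hn => ?_
    obtain rfl := mem_degSet.1 hn
    rw [smul_eq_mul, ← hW n y]
    simp [hq, List.prod_ofFn]

theorem eventually_fderiv_evalS [Inhabited σ] [DecidableEq σ] {a : MvPowerSeries σ ℝ}
    (ha : Conv a) (i : σ) :
    (fun x => fderiv ℝ (evalS a) x (Pi.single i 1)) =ᶠ[𝓝 0] evalS (pderiv ℝ i a) := by
  filter_upwards [hasDerivAt_evalS_update ha i,
    (analyticAt_evalS ha).eventually_analyticAt] with x h1 h2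
  have h3 : HasDerivAt (fun t => Function.update x i t) (Pi.single i 1) (x i) :=
    hasDerivAt_update x i (x i)
  have h4 : HasFDerivAt (evalS a) (fderiv ℝ (evalS a) x) (Function.update x i (x i)) := by
    rw [Function.update_eq_self]; exact h2.differentiableAt.hasFDerivAt
  exact (h4.comp_hasDerivAt (x i) h3).unique h1

/-! ### Expansion of analytic functions -/

/-- The multi-index of a word. -/
noncomputable def content {k : ℕ} (w : Fin k → σ) : σ →₀ ℕ := ∑ j, Finsupp.single (w j) 1

theorem degree_content {k : ℕ} (w : Fin k → σ) : (content w).degree = k := by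
  simp [content]

theorem monom_content {k : ℕ} (w : Fin k → σ) (x : σ → ℝ) :
    monom x (content w) = ∏ j, x (w j) := by
  classical
  unfold content
  have : ∀ s : Finset (Fin k), monom x (∑ j ∈ s, Finsupp.single (w j) 1) = ∏ j ∈ s, x (w j) := by
    intro s
    induction s using Finset.induction_on with
    | empty => simp [monom]
    | insert a s ha ih =>
      rw [Finset.sum_insert ha, Finset.prod_insert ha, monom_add, monom_single, ih]
  exact this _

/-- Expand each multilinear term on the standard basis and collect the words with the same content.
Since d variables have d^k words of length k, the passage to coefficients costs a factor d in the
radius. -/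
theorem exists_evalS_eq [DecidableEq σ] {h : (σ → ℝ) → ℝ} (hh : AnalyticAt ℝ h 0) :
    ∃ a : MvPowerSeries σ ℝ, Conv a ∧ h =ᶠ[𝓝 0] evalS a := by
  obtain ⟨p, R, hp⟩ := hh
  obtain ⟨ρ, hρ0, hρR⟩ : ∃ ρ : ℝ≥0, 0 < ρ ∧ (ρ : ℝ≥0∞) < R := by
    obtain ⟨ρ, h1, h2⟩ := ENNReal.lt_iff_exists_nnreal_btwn.1 hp.r_pos
    exact ⟨ρ, by exact_mod_cast h1, h2⟩
  obtain ⟨K, hK, hpK⟩ := p.norm_mul_pow_le_of_lt_radius (hρR.trans_le hp.r_le)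
  set E : (k : ℕ) → (Fin k → σ) → (Fin k → σ → ℝ) := fun _ w j => Pi.single (w j) 1 with hE
  set a : MvPowerSeries σ ℝ := fun n =>
    ∑ w : Fin n.degree → σ with content w = n, p n.degree (E _ w) with haa
  have hcoeff : ∀ k, ∀ n ∈ degSet k, coeff n a
      = ∑ w : Fin k → σ with content w = n, p k (E k w) := by
    intro k n hn
    obtain rfl := mem_degSet.1 hn
    rfl
  have hEn : ∀ k (w : Fin k → σ), ‖p k (E k w)‖ ≤ ‖p k‖ := by
    intro k w
    refine ((p k).le_opNorm _).trans (mul_le_of_le_one_right (norm_nonneg _) ?_)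
    refine Finset.prod_le_one (fun _ _ => norm_nonneg _) fun j _ => ?_
    refine (pi_norm_le_iff_of_nonneg zero_le_one).2 fun i => ?_
    by_cases hi : i = w j
    · subst hi; simp [hE]
    · simp [hE, hi]
  set d : ℝ := (Fintype.card σ : ℝ) with hd
  have hsum : ∀ k, ∑ n ∈ degSet k, ‖coeff n a‖ ≤ d ^ k * ‖p k‖ := by
    intro k
    calc ∑ n ∈ degSet k, ‖coeff n a‖
        ≤ ∑ n ∈ degSet k, ∑ w : Fin k → σ with content w = n, ‖p k (E k w)‖ := by
          refine Finset.sum_le_sum fun n hn => ?_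
          rw [hcoeff k n hn]
          exact norm_sum_le _ _
      _ = ∑ w : Fin k → σ, ‖p k (E k w)‖ := Finset.sum_fiberwise_of_maps_to
          (fun w _ => mem_degSet.2 (degree_content w)) _
      _ ≤ ∑ w : Fin k → σ, ‖p k‖ := Finset.sum_le_sum fun w _ => hEn k w
      _ = _ := by simp [hd]
  -- The denominator gives d r ≤ ρ / 2, hence geometric decay with ratio 1/2. The summand 1 keeps it
  -- positive when there are no variables.
  set r : ℝ≥0 := ρ / (2 * (Fintype.card σ + 1)) with hr
  have hr0 : 0 < r := by positivity
  have hdr : d * r ≤ ρ / 2 := by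
    rw [hr]; push_cast
    rw [← hd]
    have hd0 : 0 ≤ d := by positivity
    rw [mul_div_assoc', div_le_div_iff₀ (by positivity) (by positivity)]
    nlinarith [ρ.coe_nonneg]
  have hconv : wnorm (fun n => (monoWeight (fun _ => r) n : ℝ≥0∞)) a < ⊤ := by
    unfold wnorm
    rw [ennreal_tsum_degSet]
    have hb : ∀ k, ∑ n ∈ degSet k, ‖coeff n a‖ₑ * (monoWeight (fun _ => r) n : ℝ≥0∞)
        ≤ ENNReal.ofReal (K * (1 / 2) ^ k) := by
      intro k
      have e1 : ∀ n ∈ degSet (σ := σ) k, ‖coeff n a‖ₑ * (monoWeight (fun _ => r) n : ℝ≥0∞)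
          = ENNReal.ofReal (‖coeff n a‖ * (r : ℝ) ^ k) := by
        intro n hn
        rw [monoWeight_const, mem_degSet.1 hn, ENNReal.ofReal_mul (norm_nonneg _),
          ofReal_norm]
        congr 1
        rw [← NNReal.coe_pow, ENNReal.ofReal_coe_nnreal]
      rw [Finset.sum_congr rfl e1, ← ENNReal.ofReal_sum_of_nonneg fun n _ => by positivity]
      refine ENNReal.ofReal_le_ofReal ?_
      rw [← Finset.sum_mul]
      calc _ ≤ d ^ k * ‖p k‖ * (r : ℝ) ^ k := by gcongr; exact hsum k
        _ = (d * r) ^ k * ‖p k‖ := by rw [mul_pow]; ring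
        _ ≤ (ρ / 2) ^ k * ‖p k‖ := by gcongr
        _ = (‖p k‖ * ρ ^ k) * (1 / 2) ^ k := by rw [div_pow, div_pow]; ring
        _ ≤ _ := by gcongr; exact hpK k
    refine (ENNReal.tsum_le_tsum hb).trans_lt ?_
    rw [← ENNReal.ofReal_tsum_of_nonneg (fun k => by positivity)
      ((summable_geometric_of_lt_one (by norm_num) (by norm_num)).mul_left K)]
    exact ENNReal.ofReal_lt_top
  refine ⟨a, ⟨r, hr0, hconv⟩, ?_⟩
  have hball : ∀ᶠ x : σ → ℝ in 𝓝 0, x ∈ Metric.eball (0 : σ → ℝ) R :=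
    Metric.eball_mem_nhds _ hp.r_pos
  filter_upwards [eventually_abs_lt (σ := σ) (NNReal.coe_pos.2 hr0), hball] with x hx hxR
  have h1 := hp.hasSum hxR
  rw [zero_add] at h1
  have h2 := hasSum_degSet (summable_norm_of_wnorm hconv fun k => (hx k).le).of_norm.hasSum
  refine (h1.congr_fun fun k => ?_).unique h2
  have hx2 : (fun _ : Fin k => x) = fun _ => ∑ i, x i • (Pi.single i 1 : σ → ℝ) := by
    funext j; exact pi_eq_sum_univ' x
  rw [hx2, ContinuousMultilinearMap.map_sum]
  rw [← Finset.sum_fiberwise_of_maps_to (s := Finset.univ) (t := degSet k) (g := content)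
    (fun w _ => mem_degSet.2 (degree_content w))]
  refine Finset.sum_congr rfl fun n hn => ?_
  rw [hcoeff k n hn, Finset.sum_mul]
  refine Finset.sum_congr rfl fun w hw => ?_
  rw [ContinuousMultilinearMap.map_smul_univ, ← (Finset.mem_filter.1 hw).2, monom_content,
    smul_eq_mul, mul_comm]

/-- The constant coefficient is the value at 0, and a coefficient of higher degree is, up to a
positive factor, a coefficient of lower degree of a partial derivative, which also sums to zero. -/
theorem eq_zero_of_evalS_eq_zero [Inhabited σ] {a : MvPowerSeries σ ℝ} (ha : Conv a)
    (h : evalS a =ᶠ[𝓝 0] 0) : a = 0 := by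
  classical
  have key : ∀ N, ∀ a : MvPowerSeries σ ℝ, Conv a → evalS a =ᶠ[𝓝 0] 0 →
      ∀ n : σ →₀ ℕ, n.degree = N → coeff n a = 0 := by
    intro N
    induction N with
    | zero =>
      intro a _ h0 n hn
      rw [Finsupp.degree_eq_zero_iff] at hn
      rw [hn, coeff_zero_eq_constantCoeff_apply, ← evalS_zero_point, h0.self_of_nhds]
      rfl
    | succ N ih =>
      intro a ha h0 n hn
      obtain ⟨i, hi⟩ : ∃ i, n i ≠ 0 := by
        by_contra! hc
        rw [Finsupp.ext (g := 0) hc] at hn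
        simp at hn
      obtain ⟨m, rfl⟩ := exists_eq_add_single hi
      have h1 : evalS (MvPowerSeries.pderiv ℝ i a) =ᶠ[𝓝 0] 0 := by
        refine (eventually_fderiv_evalS ha i).symm.trans ?_
        filter_upwards [h0.eventually_nhds] with x hx
        rw [Filter.EventuallyEq.fderiv_eq (f₁ := evalS a) (f := fun _ => 0) hx]
        simp
      have h2 := ih _ (ha.pderiv i) h1 m (by simpa using hn)
      rw [coeff_pderiv] at h2
      have : (m i : ℝ) + 1 ≠ 0 := by positivity
      exact (mul_eq_zero.1 h2).resolve_right this
  ext n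
  exact key _ a ha h n rfl

end Evaluation

end FormalGerm

namespace FormalGerm

open MvPowerSeries
open scoped ENNReal NNReal

/-! ### The differential algebra of convergent series, and its slices -/

section ConvergentSeries

variable (σ : Type*) [Fintype σ]

/-- The algebra of convergent power series. -/
noncomputable def convSubalgebra : Subalgebra ℝ (MvPowerSeries σ ℝ) where
  carrier := {a | Conv a}
  mul_mem' := Conv.mul
  add_mem' := Conv.add
  algebraMap_mem' c := conv_C c

/-- Convergent power series. -/
abbrev ConvSeries : Type _ := convSubalgebra σ

variable {σ}

theorem conv_coe (a : ConvSeries σ) : Conv (a : MvPowerSeries σ ℝ) := a.2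

/-- The partial derivative of a convergent power series. -/
noncomputable def D (i : σ) : Derivation ℝ (ConvSeries σ) (ConvSeries σ) :=
  Derivation.mk'
    { toFun := fun a => ⟨pderiv ℝ i a, (conv_coe a).pderiv i⟩
      map_add' := fun a b => Subtype.ext (map_add (pderiv ℝ i) (a : MvPowerSeries σ ℝ) b)
      map_smul' := fun c a =>
        Subtype.ext (Derivation.map_smul (pderiv ℝ i) c (a : MvPowerSeries σ ℝ)) }
    fun a b => Subtype.ext ((pderiv ℝ i).leibniz (a : MvPowerSeries σ ℝ) b)

theorem coe_D (i : σ) (a : ConvSeries σ) :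
    ((D i a : ConvSeries σ) : MvPowerSeries σ ℝ) = pderiv ℝ i a := rfl

theorem D_mul (i : σ) (a b : ConvSeries σ) : D i (a * b) = a * D i b + D i a * b := by
  rw [(D i).leibniz, smul_eq_mul, smul_eq_mul, mul_comm b]

theorem D_comm (i j : σ) (a : ConvSeries σ) : D i (D j a) = D j (D i a) :=
  Subtype.ext (pderiv_comm i j _)

theorem restr_one (i : σ) : restr i (1 : MvPowerSeries σ ℝ) = 1 := by
  classical
  ext n
  rw [coeff_restr, coeff_one]
  split_ifs with h1 h2 h3
  · rfl
  · rfl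
  · subst h3; simp at h1
  · rfl

/-- Restriction of convergent power series to a coordinate hyperplane. -/
noncomputable def rs (i : σ) : ConvSeries σ →+* ConvSeries σ where
  toFun a := ⟨restr i a, (conv_coe a).restr i⟩
  map_one' := Subtype.ext (restr_one i)
  map_mul' a b := Subtype.ext (restr_mul i _ _)
  map_zero' := Subtype.ext (restr_zero i)
  map_add' a b := Subtype.ext (restr_add i _ _)

theorem coe_rs (i : σ) (a : ConvSeries σ) :
    ((rs i a : ConvSeries σ) : MvPowerSeries σ ℝ) = restr i a := rfl

theorem rs_rs (i : σ) (a : ConvSeries σ) : rs i (rs i a) = rs i a :=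
  Subtype.ext (restr_restr i _)

theorem rs_comm (i j : σ) (a : ConvSeries σ) : rs i (rs j a) = rs j (rs i a) := by
  refine Subtype.ext ?_
  ext n
  simp only [coe_rs, coeff_restr]
  split_ifs <;> rfl

theorem rs_D {i j : σ} (hij : j ≠ i) (a : ConvSeries σ) : rs i (D j a) = D j (rs i a) :=
  Subtype.ext (restr_pderiv hij _)

theorem rs_eq_self_of_D_eq_zero {i : σ} {a : ConvSeries σ} (h : D i a = 0) : rs i a = a := by
  have h1 : pderiv ℝ i (a : MvPowerSeries σ ℝ) = 0 := congrArg Subtype.val h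
  refine Subtype.ext ?_
  have h2 := restr_add_integ_pderiv i (a : MvPowerSeries σ ℝ)
  rw [h1] at h2
  have h3 : integ i (0 : MvPowerSeries σ ℝ) = 0 := by
    ext n; rw [coeff_integ]; simp
  rwa [h3, add_zero] at h2

theorem rs_algebraMap (i : σ) (c : ℝ) :
    rs i (algebraMap ℝ (ConvSeries σ) c) = algebraMap ℝ (ConvSeries σ) c := by
  classical
  refine Subtype.ext ?_
  ext n
  rw [coe_rs, coeff_restr]
  have : ((algebraMap ℝ (ConvSeries σ) c : ConvSeries σ) : MvPowerSeries σ ℝ) = C c := rfl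
  rw [this, coeff_C]
  split_ifs with h1 h2 h3
  · rfl
  · rfl
  · subst h3; simp at h1
  · rfl

/-! ### Functions and convergent series -/

/-- The sum of a convergent power series. -/
noncomputable def ev (a : ConvSeries σ) : (σ → ℝ) → ℝ := evalS (a : MvPowerSeries σ ℝ)

theorem ev_add (a b : ConvSeries σ) : ev (a + b) =ᶠ[𝓝 0] fun x => ev a x + ev b x :=
  evalS_add (conv_coe a) (conv_coe b)

theorem ev_mul (a b : ConvSeries σ) : ev (a * b) =ᶠ[𝓝 0] fun x => ev a x * ev b x :=
  evalS_mul (conv_coe a) (conv_coe b)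

theorem ev_one (x : σ → ℝ) : ev (1 : ConvSeries σ) x = 1 := evalS_C 1 x

theorem ev_zero (x : σ → ℝ) : ev (0 : ConvSeries σ) x = 0 := by
  simp [ev, evalS]

theorem ev_rs [DecidableEq σ] (i : σ) (a : ConvSeries σ) (x : σ → ℝ) :
    ev (rs i a) x = ev a (Function.update x i 0) := evalS_restr i _ x

theorem ev_zero_point (a : ConvSeries σ) : ev a 0 = constantCoeff (a : MvPowerSeries σ ℝ) :=
  evalS_zero_point _

variable [Inhabited σ]

theorem analyticAt_ev (a : ConvSeries σ) : AnalyticAt ℝ (ev a) 0 := analyticAt_evalS (conv_coe a)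

theorem ev_injective {a b : ConvSeries σ} (h : ev a =ᶠ[𝓝 0] ev b) : a = b := by
  have h1 : ev (a - b) =ᶠ[𝓝 0] 0 := by
    have h2 := ev_add (a - b) b
    rw [sub_add_cancel] at h2
    filter_upwards [h, h2] with x h3 h4
    rw [h3] at h4
    simpa using h4.symm
  exact sub_eq_zero.1 (Subtype.ext (eq_zero_of_evalS_eq_zero (conv_coe (a - b)) h1))

variable [DecidableEq σ]

theorem ev_D (i : σ) (a : ConvSeries σ) :
    (fun x => fderiv ℝ (ev a) x (Pi.single i 1)) =ᶠ[𝓝 0] ev (D i a) :=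
  eventually_fderiv_evalS (conv_coe a) i

open Classical in
/-- The convergent power series of a function which is analytic at the origin. -/
noncomputable def ofFun (h : (σ → ℝ) → ℝ) : ConvSeries σ :=
  if hh : AnalyticAt ℝ h 0 then ⟨_, (exists_evalS_eq hh).choose_spec.1⟩ else 0

theorem ev_ofFun {h : (σ → ℝ) → ℝ} (hh : AnalyticAt ℝ h 0) : ev (ofFun h) =ᶠ[𝓝 0] h := by
  unfold ofFun
  rw [dif_pos hh]
  exact (exists_evalS_eq hh).choose_spec.2.symm

theorem ofFun_eq {h : (σ → ℝ) → ℝ} {a : ConvSeries σ} (ha : ev a =ᶠ[𝓝 0] h) : ofFun h = a :=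
  ev_injective ((ev_ofFun ((analyticAt_ev a).congr ha)).trans ha.symm)

theorem ofFun_congr {h h' : (σ → ℝ) → ℝ} (hh : AnalyticAt ℝ h 0) (e : h =ᶠ[𝓝 0] h') :
    ofFun h = ofFun h' :=
  (ofFun_eq ((ev_ofFun hh).trans e)).symm

theorem ofFun_mul {h h' : (σ → ℝ) → ℝ} (hh : AnalyticAt ℝ h 0) (hh' : AnalyticAt ℝ h' 0) :
    ofFun (fun x => h x * h' x) = ofFun h * ofFun h' :=
  ofFun_eq ((ev_mul _ _).trans ((ev_ofFun hh).mul (ev_ofFun hh')))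

theorem ofFun_add {h h' : (σ → ℝ) → ℝ} (hh : AnalyticAt ℝ h 0) (hh' : AnalyticAt ℝ h' 0) :
    ofFun (fun x => h x + h' x) = ofFun h + ofFun h' :=
  ofFun_eq ((ev_add _ _).trans ((ev_ofFun hh).add (ev_ofFun hh')))

theorem ofFun_sub {h h' : (σ → ℝ) → ℝ} (hh : AnalyticAt ℝ h 0) (hh' : AnalyticAt ℝ h' 0) :
    ofFun (fun x => h x - h' x) = ofFun h - ofFun h' := by
  have h1 := ofFun_add (h := fun x => h x - h' x) (hh.sub hh') hh'
  rw [eq_sub_iff_add_eq, ← h1]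
  simp

theorem ofFun_fderiv {h : (σ → ℝ) → ℝ} (hh : AnalyticAt ℝ h 0) (i : σ) :
    ofFun (fun x => fderiv ℝ h x (Pi.single i 1)) = D i (ofFun h) := by
  refine ofFun_eq ((ev_D i _).symm.trans ?_)
  filter_upwards [(ev_ofFun hh).eventually_nhds] with x hx
  rw [Filter.EventuallyEq.fderiv_eq hx]

/-! ### Slices -/

/-- For small δ the slice through δ still meets the neighbourhood where the property holds. The size
of the neighbourhood inside the slice may depend on δ. -/
theorem eventually_slice (l : σ) {p : (σ → ℝ) → Prop} (h : ∀ᶠ x in 𝓝 0, p x) :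
    ∀ᶠ δ in 𝓝 (0 : ℝ), ∀ᶠ x in 𝓝 (0 : σ → ℝ), p (Function.update x l δ) := by
  have hc : Continuous fun z : ℝ × (σ → ℝ) => Function.update z.2 l z.1 :=
    continuous_snd.update l continuous_fst
  have h0 : Function.update (0 : σ → ℝ) l 0 = 0 := Function.update_eq_self l (0 : σ → ℝ)
  have : ∀ᶠ z : ℝ × (σ → ℝ) in 𝓝 (0, 0), p (Function.update z.2 l z.1) := by
    refine hc.continuousAt.eventually (p := p) ?_
    simpa [h0] using h
  exact this.curry_nhds

/-- The slice of a convergent power series where the variable `l` has the value `δ`. -/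
noncomputable def slice (l : σ) (δ : ℝ) (a : ConvSeries σ) : ConvSeries σ :=
  ofFun fun x => ev a (Function.update x l δ)

theorem analyticAt_update (l : σ) (δ : ℝ) (x : σ → ℝ) :
    AnalyticAt ℝ (fun x : σ → ℝ => Function.update x l δ) x := by
  refine analyticAt_pi_iff.2 fun k => ?_
  by_cases hk : k = l
  · subst hk; simpa using analyticAt_const
  · simp only [Function.update_of_ne hk]
    exact (ContinuousLinearMap.proj (R := ℝ) (φ := fun _ : σ => ℝ) k).analyticAt x

theorem ev_slice (l : σ) (a : ConvSeries σ) : ∀ᶠ δ in 𝓝 (0 : ℝ),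
    ev (slice l δ a) =ᶠ[𝓝 0] fun x => ev a (Function.update x l δ) := by
  filter_upwards [eventually_slice l (analyticAt_ev a).eventually_analyticAt] with δ h
  have h1 : AnalyticAt ℝ (ev a) (Function.update 0 l δ) := h.self_of_nhds
  exact ev_ofFun (AnalyticAt.comp (g := ev a) h1 (analyticAt_update l δ 0))

/-- The slicing homomorphism. -/
noncomputable def sliceGerm (l : σ) : ConvSeries σ →+* Germ (𝓝 (0 : ℝ)) (ConvSeries σ) where
  toFun a := ((fun δ => slice l δ a : ℝ → ConvSeries σ) : Germ (𝓝 (0 : ℝ)) (ConvSeries σ))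
  map_one' := by
    refine Germ.coe_eq.2 (Eventually.of_forall fun δ => ?_)
    exact ofFun_eq (Eventually.of_forall fun x => by simp only [ev_one])
  -- Sums of series multiply only near the origin, so slices multiply only for δ close to 0; this is
  -- why the target consists of germs in δ.
  map_mul' a b := by
    refine Germ.coe_eq.2 ?_
    filter_upwards [ev_slice l a, ev_slice l b, eventually_slice l (ev_mul a b)] with δ h1 h2 h3
    refine ofFun_eq ((ev_mul _ _).trans ((h1.mul h2).trans ?_))
    filter_upwards [h3] with x hx using hx.symm
  map_zero' := by
    refine Germ.coe_eq.2 (Eventually.of_forall fun δ => ?_)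
    exact ofFun_eq (Eventually.of_forall fun x => by simp only [ev_zero])
  map_add' a b := by
    refine Germ.coe_eq.2 ?_
    filter_upwards [ev_slice l a, ev_slice l b, eventually_slice l (ev_add a b)] with δ h1 h2 h3
    refine ofFun_eq ((ev_add _ _).trans ((h1.add h2).trans ?_))
    filter_upwards [h3] with x hx using hx.symm

theorem slice_D {i l : σ} (hil : i ≠ l) (a : ConvSeries σ) :
    ∀ᶠ δ in 𝓝 (0 : ℝ), slice l δ (D i a) = D i (slice l δ a) := by
  filter_upwards [ev_slice l a, eventually_slice l (ev_D i a),
    eventually_slice l (analyticAt_ev a).eventually_analyticAt] with δ h1 h2 h3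
  refine ofFun_eq ((ev_D i _).symm.trans ?_)
  filter_upwards [h1.eventually_nhds, h2, h3] with x h4 h5 h6
  rw [← h5, Filter.EventuallyEq.fderiv_eq h4]
  have h7 : DifferentiableAt ℝ (fun x => ev a (Function.update x l δ)) x :=
    (AnalyticAt.comp (g := ev a) (f := fun x => Function.update x l δ) h6
      (analyticAt_update l δ x)).differentiableAt
  rw [← h7.lineDeriv_eq_fderiv, ← h6.differentiableAt.lineDeriv_eq_fderiv]
  unfold lineDeriv
  congr 1
  funext t
  refine congrArg (ev a) ?_
  funext k
  by_cases hk : k = l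
  · subst hk; simp [hil.symm]
  · simp [hk]

theorem slice_rs {i l : σ} (hil : i ≠ l) (a : ConvSeries σ) :
    ∀ᶠ δ in 𝓝 (0 : ℝ), slice l δ (rs i a) = rs i (slice l δ a) := by
  filter_upwards [ev_slice l a] with δ h1
  refine ofFun_eq ?_
  have hc : Continuous fun x : σ → ℝ => Function.update x i 0 :=
    continuous_id.update i continuous_const
  have h0 : Function.update (0 : σ → ℝ) i 0 = 0 := Function.update_eq_self i (0 : σ → ℝ)
  have h2 : ∀ᶠ x : σ → ℝ in 𝓝 0, ev (slice l δ a) (Function.update x i 0)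
      = ev a (Function.update (Function.update x i 0) l δ) := by
    refine hc.continuousAt.eventually (p := fun x => ev (slice l δ a) x
      = ev a (Function.update x l δ)) ?_
    simp only [h0]
    exact h1
  filter_upwards [h2] with x hx
  rw [ev_rs, ev_rs, hx, Function.update_comm hil]

end ConvergentSeries

end FormalGerm

namespace FormalGerm

open MvPowerSeries

/-! ### Cauchy problems and total differential systems -/

section Systems

variable {σ : Type*} [Fintype σ] {ι : Type*}

theorem coe_aeval {τ : Type*} (P : MvPolynomial τ (ConvSeries σ)) (y : τ → ConvSeries σ) :
    ((MvPolynomial.aeval y P : ConvSeries σ) : MvPowerSeries σ ℝ)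
      = MvPolynomial.aeval (fun t => (y t : MvPowerSeries σ ℝ))
        (MvPolynomial.map (convSubalgebra σ).val.toRingHom P) := by
  rw [MvPolynomial.aeval_def, MvPolynomial.aeval_def, MvPolynomial.eval₂_map]
  exact MvPolynomial.hom_eval₂ P _ (convSubalgebra σ).val.toRingHom y

theorem coe_sum_elim (j : σ) (y : ι → ConvSeries σ) :
    (fun t => ((Sum.elim y (fun l => D j (y l)) t : ConvSeries σ) : MvPowerSeries σ ℝ))
      = Sum.elim (fun k => (y k : MvPowerSeries σ ℝ))
        fun l => pderiv ℝ j (y l : MvPowerSeries σ ℝ) := by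
  funext t; cases t <;> rfl

/-- The Cauchy–Kovalevskaya theorem in the algebra of convergent power series. -/
theorem exists_cauchy_solution [Fintype ι] {i j : σ} (hij : j ≠ i)
    (P : ι → MvPolynomial (ι ⊕ ι) (ConvSeries σ)) (y₀ : ι → ConvSeries σ)
    (hr : ∀ k, rs i (y₀ k) = y₀ k) :
    ∃ y : ι → ConvSeries σ, (∀ k, rs i (y k) = y₀ k) ∧
      ∀ k, D i (y k) = MvPolynomial.aeval (Sum.elim y fun l => D j (y l)) (P k) := by
  obtain ⟨y, hc, h0, h1⟩ := ck_exists hij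
    (fun k => MvPolynomial.map (convSubalgebra σ).val.toRingHom (P k))
    (fun k => (y₀ k : MvPowerSeries σ ℝ))
    (fun k m => by rw [MvPolynomial.coeff_map]; exact conv_coe _) (fun k => conv_coe _)
    (fun k => congrArg Subtype.val (hr k))
  refine ⟨fun k => ⟨y k, hc k⟩, fun k => Subtype.ext (h0 k), fun k => Subtype.ext ?_⟩
  rw [coe_D, coe_aeval, coe_sum_elim]
  exact h1 k

theorem cauchy_solution_unique {i j : σ} (hij : j ≠ i)
    (P : ι → MvPolynomial (ι ⊕ ι) (ConvSeries σ)) {y y' : ι → ConvSeries σ}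
    (h : ∀ k, D i (y k) = MvPolynomial.aeval (Sum.elim y fun l => D j (y l)) (P k))
    (h' : ∀ k, D i (y' k) = MvPolynomial.aeval (Sum.elim y' fun l => D j (y' l)) (P k))
    (h0 : ∀ k, rs i (y k) = rs i (y' k)) : y = y' := by
  have key : ∀ z : ι → ConvSeries σ,
      (∀ k, D i (z k) = MvPolynomial.aeval (Sum.elim z fun l => D j (z l)) (P k)) →
      ∀ k, pderiv ℝ i (z k : MvPowerSeries σ ℝ) = MvPolynomial.aeval
        (Sum.elim (fun k => (z k : MvPowerSeries σ ℝ)) fun l => pderiv ℝ j (z l : MvPowerSeries σ ℝ))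
        (MvPolynomial.map (convSubalgebra σ).val.toRingHom (P k)) := by
    intro z hz k
    rw [← coe_sum_elim, ← coe_aeval, ← hz k, coe_D]
  have := ck_unique hij _ (key y h) (key y' h') fun k => congrArg Subtype.val (h0 k)
  funext k
  exact Subtype.ext (congrFun this k)

/-- Linear systems of differential equations. -/
theorem exists_linear_solution [Fintype ι] {i j : σ} (hij : j ≠ i)
    (M : ι → ι → ConvSeries σ) (y₀ : ι → ConvSeries σ) (hr : ∀ k, rs i (y₀ k) = y₀ k) :
    ∃ y : ι → ConvSeries σ, (∀ k, rs i (y k) = y₀ k) ∧ ∀ k, D i (y k) = ∑ l, M k l * y l := by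
  obtain ⟨y, h0, h1⟩ := exists_cauchy_solution hij
    (fun k => ∑ l, MvPolynomial.C (M k l) * MvPolynomial.X (Sum.inl l)) y₀ hr
  refine ⟨y, h0, fun k => ?_⟩
  rw [h1 k]
  simp

theorem linear_solution_unique [Fintype ι] {i j : σ} (hij : j ≠ i)
    (M : ι → ι → ConvSeries σ) {y y' : ι → ConvSeries σ}
    (h : ∀ k, D i (y k) = ∑ l, M k l * y l) (h' : ∀ k, D i (y' k) = ∑ l, M k l * y' l)
    (h0 : ∀ k, rs i (y k) = rs i (y' k)) : y = y' := by
  refine cauchy_solution_unique hij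
    (fun k => ∑ l, MvPolynomial.C (M k l) * MvPolynomial.X (Sum.inl l)) (fun k => ?_)
    (fun k => ?_) h0
  · rw [h k]; simp
  · rw [h' k]; simp

/-- A linear homogeneous equation propagates zero initial data; it is used to show that algebraic
relations between unknowns persist. -/
theorem scalar_solution_eq_zero {i j : σ} (hij : j ≠ i) (m : ConvSeries σ) {y : ConvSeries σ}
    (h : D i y = m * y) (h0 : rs i y = 0) : y = 0 := by
  have := linear_solution_unique (ι := Unit) hij (fun _ _ => m) (y := fun _ => y)
    (y' := fun _ => 0) (by simpa using h) (by simp) (by simpa using h0)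
  exact congrFun this ()

/-- The Frobenius theorem for linear total differential equations. -/
theorem exists_total_solution [Fintype ι] {i j : σ} (hij : j ≠ i)
    (U V : ι → ι → ConvSeries σ)
    (hUV : ∀ k l, D i (U k l) + ∑ m, U k m * V m l = D j (V k l) + ∑ m, V k m * U m l)
    (c : ι → ℝ) :
    ∃ X : ι → ConvSeries σ, (∀ k, D j (X k) = ∑ l, U k l * X l) ∧
      (∀ k, D i (X k) = ∑ l, V k l * X l) ∧
      ∀ k, rs j (rs i (X k)) = algebraMap ℝ (ConvSeries σ) (c k) := by
  -- Integrate along the `j` direction inside the hyperplane where the variable `i` vanishes, then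
  -- leave this hyperplane in the direction `i`.
  obtain ⟨Y, hY0, hY⟩ := exists_linear_solution (i := j) (j := i) hij.symm
    (fun k l => rs i (U k l)) (fun k => algebraMap ℝ (ConvSeries σ) (c k))
    (fun k => rs_algebraMap j (c k))
  obtain ⟨X, hX0, hX⟩ := exists_linear_solution hij V (fun k => rs i (Y k)) fun k => rs_rs i _
  refine ⟨X, ?_, hX, fun k => ?_⟩
  -- The defect ∂ⱼX − UX vanishes on the hyperplane by the choice of Y, and the compatibility
  -- condition says that it satisfies the linear equation ∂ᵢW = VW.
  · have hW : (fun k => D j (X k) - ∑ l, U k l * X l) = fun _ => 0 := by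
      refine linear_solution_unique hij V (fun k => ?_) (fun k => by simp) fun k => ?_
      · rw [map_sub, D_comm, hX k, map_sum, map_sum]
        simp_rw [D_mul, mul_sub, Finset.sum_sub_distrib, Finset.sum_add_distrib, hX,
          Finset.mul_sum, ← mul_assoc]
        rw [Finset.sum_comm (f := fun l m => U k l * V l m * X m),
          Finset.sum_comm (f := fun l m => V k l * U l m * X m)]
        simp_rw [← Finset.sum_mul]
        have h1 : ∑ m, (∑ l, U k l * V l m) * X m + ∑ m, D i (U k m) * X m
            = ∑ m, (∑ l, V k l * U l m) * X m + ∑ m, D j (V k m) * X m := by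
          rw [← Finset.sum_add_distrib, ← Finset.sum_add_distrib]
          refine Finset.sum_congr rfl fun m _ => ?_
          linear_combination (X m) * hUV k m
        linear_combination -h1
      · rw [map_sub, rs_D hij, hX0, ← rs_D hij, hY, map_sum, map_sum, map_zero, sub_eq_zero]
        refine Finset.sum_congr rfl fun l _ => ?_
        rw [map_mul, map_mul, rs_rs, hX0]
    intro k
    exact sub_eq_zero.1 (congrFun hW k)
  · rw [hX0, rs_comm, hY0, rs_algebraMap]

theorem eq_algebraMap_of_D_eq_zero {i j : σ} {a : ConvSeries σ} {c : ℝ}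
    (hi : D i a = 0) (hj : D j a = 0) (h : rs j (rs i a) = algebraMap ℝ (ConvSeries σ) c) :
    a = algebraMap ℝ (ConvSeries σ) c := by
  rw [← h, rs_eq_self_of_D_eq_zero hi, rs_eq_self_of_D_eq_zero hj]

/-- The value at the origin. -/
noncomputable def ev₀ : ConvSeries σ →+* ℝ :=
  (constantCoeff (σ := σ) (R := ℝ)).comp (convSubalgebra σ).val.toRingHom

theorem ev₀_eq (a : ConvSeries σ) : ev₀ a = ev a 0 := (ev_zero_point a).symm

theorem ev₀_rs (i : σ) (a : ConvSeries σ) : ev₀ (rs i a) = ev₀ a := by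
  have : ev₀ (rs i a) = coeff 0 (restr i (a : MvPowerSeries σ ℝ)) := rfl
  rw [this, coeff_restr]
  simp [ev₀]

theorem exists_mul_eq_one [Inhabited σ] [DecidableEq σ] {a : ConvSeries σ} (h : ev₀ a ≠ 0) :
    ∃ b : ConvSeries σ, a * b = 1 := by
  rw [ev₀_eq] at h
  have h1 : AnalyticAt ℝ (fun x => (ev a x)⁻¹) 0 := (analyticAt_ev a).inv h
  refine ⟨ofFun fun x => (ev a x)⁻¹, ev_injective ?_⟩
  filter_upwards [ev_mul a (ofFun fun x => (ev a x)⁻¹), ev_ofFun h1,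
    (analyticAt_ev a).continuousAt.eventually_ne h] with x h2 h3 h4
  rw [h2, h3, ev_one, mul_inv_cancel₀ h4]

end Systems

end FormalGerm

/-! ### The structure equations: existence and uniqueness -/

namespace FormalGerm

/-- The structure equations of an adapted orthonormal frame `X k 0, X k 1, X k 2` along the map
`X k 3` (`k` numbers the coordinates of space), with the initial conditions that prescribe the
normal curvature and the torsion of the image of the first coordinate line. The coframe is
`α du + β dv, σ dv` and its connection form is `p du + q dv`. -/
structure IsFrameSolution {A : Type*} [CommRing A] (D₀ D₁ r₀ r₁ : A → A)
    (α β σ p q κ e m a b c d i : A) (X : Fin 3 → Fin 4 → A) : Prop where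
  a_init : r₁ a = r₁ α * e
  c_init : r₁ c * (r₁ p ^ 2 + r₁ a ^ 2) = r₁ α * m * (r₁ p ^ 2 + r₁ a ^ 2)
    - (r₁ p * D₀ (r₁ a) - r₁ a * D₀ (r₁ p))
  inv : a * i = 1
  sym : α * b = β * a + σ * c
  gauss : a * d = κ + b * c
  cod₁ : D₁ a = D₀ b - p * d + q * c
  cod₂ : D₁ c = D₀ d + p * b - q * a
  u0 : ∀ k, D₀ (X k 0) = p * X k 1 + a * X k 2
  u1 : ∀ k, D₀ (X k 1) = -(p * X k 0) + c * X k 2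
  u2 : ∀ k, D₀ (X k 2) = -(a * X k 0) - c * X k 1
  u3 : ∀ k, D₀ (X k 3) = α * X k 0
  v0 : ∀ k, D₁ (X k 0) = q * X k 1 + b * X k 2
  v1 : ∀ k, D₁ (X k 1) = -(q * X k 0) + d * X k 2
  v2 : ∀ k, D₁ (X k 2) = -(b * X k 0) - d * X k 1
  v3 : ∀ k, D₁ (X k 3) = β * X k 0 + σ * X k 1
  init : ∀ (k : Fin 3) (l : Fin 4), r₀ (r₁ (X k l)) = if l.val = k.val then 1 else 0

/-- All conditions are polynomial identities in the data, the derivations and the restrictions, with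
denominators cleared, so they pass through ring homomorphisms. This is applied to the slicing
homomorphism into germs. -/
theorem IsFrameSolution.map {A B : Type*} [CommRing A] [CommRing B] {D₀ D₁ r₀ r₁ : A → A}
    {E₀ E₁ s₀ s₁ : B → B} {α β σ p q κ e m a b c d i : A} {X : Fin 3 → Fin 4 → A}
    (h : IsFrameSolution D₀ D₁ r₀ r₁ α β σ p q κ e m a b c d i X) (φ : A →+* B)
    (hD₀ : ∀ x, φ (D₀ x) = E₀ (φ x)) (hD₁ : ∀ x, φ (D₁ x) = E₁ (φ x))
    (hr₀ : ∀ x, φ (r₀ x) = s₀ (φ x)) (hr₁ : ∀ x, φ (r₁ x) = s₁ (φ x)) :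
    IsFrameSolution E₀ E₁ s₀ s₁ (φ α) (φ β) (φ σ) (φ p) (φ q) (φ κ) (φ e) (φ m) (φ a) (φ b)
      (φ c) (φ d) (φ i) fun k l => φ (X k l) where
  a_init := by simpa [hD₀, hD₁, hr₀, hr₁] using congrArg φ h.a_init
  c_init := by simpa [hD₀, hD₁, hr₀, hr₁] using congrArg φ h.c_init
  inv := by simpa [hD₀, hD₁, hr₀, hr₁] using congrArg φ h.inv
  sym := by simpa [hD₀, hD₁, hr₀, hr₁] using congrArg φ h.sym
  gauss := by simpa [hD₀, hD₁, hr₀, hr₁] using congrArg φ h.gauss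
  cod₁ := by simpa [hD₀, hD₁, hr₀, hr₁] using congrArg φ h.cod₁
  cod₂ := by simpa [hD₀, hD₁, hr₀, hr₁] using congrArg φ h.cod₂
  u0 k := by simpa [hD₀, hD₁, hr₀, hr₁] using congrArg φ (h.u0 k)
  u1 k := by simpa [hD₀, hD₁, hr₀, hr₁] using congrArg φ (h.u1 k)
  u2 k := by simpa [hD₀, hD₁, hr₀, hr₁] using congrArg φ (h.u2 k)
  u3 k := by simpa [hD₀, hD₁, hr₀, hr₁] using congrArg φ (h.u3 k)
  v0 k := by simpa [hD₀, hD₁, hr₀, hr₁] using congrArg φ (h.v0 k)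
  v1 k := by simpa [hD₀, hD₁, hr₀, hr₁] using congrArg φ (h.v1 k)
  v2 k := by simpa [hD₀, hD₁, hr₀, hr₁] using congrArg φ (h.v2 k)
  v3 k := by simpa [hD₀, hD₁, hr₀, hr₁] using congrArg φ (h.v3 k)
  init k l := by
    have := congrArg φ (h.init k l)
    rw [hr₀, hr₁] at this
    rw [this]
    split_ifs <;> simp

/-- Convergent power series in the two coordinates and a parameter. -/
abbrev Series3 : Type := ConvSeries (Fin 3)

/-- Solutions of the structure equations in convergent power series. -/
abbrev IsSeriesSolution (α β σ p q κ e m a b c d i : Series3) (X : Fin 3 → Fin 4 → Series3) :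
    Prop :=
  IsFrameSolution (D 0) (D 1) (rs 0) (rs 1) α β σ p q κ e m a b c d i X

section

variable {α αi β σ p q κ e m : Series3}

/-- The right hand sides of the Cauchy problem for the coefficients of the second fundamental
form. -/
noncomputable def codazziSystem (b₁ b₂ p q κ : Series3) :
    Fin 3 → MvPolynomial (Fin 3 ⊕ Fin 3) Series3 :=
  let a := MvPolynomial.X (Sum.inl 0)
  let c := MvPolynomial.X (Sum.inl 1)
  let i := MvPolynomial.X (Sum.inl 2)
  let au := MvPolynomial.X (Sum.inr 0)
  let cu := MvPolynomial.X (Sum.inr 1)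
  let iu := MvPolynomial.X (Sum.inr 2)
  let C := MvPolynomial.C
  let b := C b₁ * a + C b₂ * c
  let bu := C (D 0 b₁) * a + C b₁ * au + C (D 0 b₂) * c + C b₂ * cu
  let d := (C κ + b * c) * i
  let du := (C (D 0 κ) + bu * c + b * cu) * i + (C κ + b * c) * iu
  let av := bu - C p * d + C q * c
  -- The third unknown stands for 1/a, which keeps the system polynomial; its equation is the
  -- differentiated form (1/a)' = −(1/a)² a'.
  ![av, du + C p * b - C q * a, -i ^ 2 * av]

/-- The system is Codazzi's, with b eliminated by symmetry and d by the Gauss equation. Expanding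
the u-derivatives by Leibniz exhibits it as polynomial in the unknowns and their u-derivatives. -/
theorem codazziSystem_iff (b₁ b₂ p q κ : Series3) (y : Fin 3 → Series3) :
    (∀ k, D 1 (y k) = MvPolynomial.aeval (Sum.elim y fun l => D 0 (y l))
      (codazziSystem b₁ b₂ p q κ k)) ↔
    D 1 (y 0) = D 0 (b₁ * y 0 + b₂ * y 1) - p * ((κ + (b₁ * y 0 + b₂ * y 1) * y 1) * y 2)
        + q * y 1 ∧
      D 1 (y 1) = D 0 ((κ + (b₁ * y 0 + b₂ * y 1) * y 1) * y 2) + p * (b₁ * y 0 + b₂ * y 1)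
        - q * y 0 ∧
      D 1 (y 2) = -y 2 ^ 2 * (D 0 (b₁ * y 0 + b₂ * y 1)
        - p * ((κ + (b₁ * y 0 + b₂ * y 1) * y 1) * y 2) + q * y 1) := by
  have e0 : D 0 (b₁ * y 0 + b₂ * y 1)
      = D 0 b₁ * y 0 + b₁ * D 0 (y 0) + D 0 b₂ * y 1 + b₂ * D 0 (y 1) := by
    rw [map_add, D_mul, D_mul]; ring
  have e1 : D 0 ((κ + (b₁ * y 0 + b₂ * y 1) * y 1) * y 2)
      = (D 0 κ + (D 0 b₁ * y 0 + b₁ * D 0 (y 0) + D 0 b₂ * y 1 + b₂ * D 0 (y 1)) * y 1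
        + (b₁ * y 0 + b₂ * y 1) * D 0 (y 1)) * y 2
        + (κ + (b₁ * y 0 + b₂ * y 1) * y 1) * D 0 (y 2) := by
    rw [D_mul, map_add, D_mul, e0]; ring
  rw [e1, e0, Fin.forall_fin_succ, Fin.forall_fin_two]
  simp [codazziSystem]

/-- Existence of solutions of the structure equations. -/
theorem exists_isSeriesSolution (hα : ev₀ α ≠ 0) (he : ev₀ e ≠ 0)
    (T₁ : p * σ = D 0 β - D 1 α) (T₂ : D 0 σ = α * q - β * p) (hκ : κ = D 1 p - D 0 q)
    (hre : rs 1 e = e) (hrm : rs 1 m = m) :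
    ∃ a b c d i X, IsSeriesSolution α β σ p q κ e m a b c d i X := by
  obtain ⟨αi, hαi⟩ := exists_mul_eq_one hα
  -- Along the axis the normal curvature is a/α, and it has to equal e.
  set a₀ := rs 1 α * e with ha₀
  have hra₀ : rs 1 a₀ = a₀ := by rw [ha₀, map_mul, rs_rs, hre]
  have ha₀' : ev₀ a₀ ≠ 0 := by
    rw [ha₀, map_mul, ev₀_rs]; exact mul_ne_zero hα he
  obtain ⟨i₀, hi₀⟩ := exists_mul_eq_one ha₀'
  have hN : ev₀ (rs 1 p ^ 2 + a₀ ^ 2) ≠ 0 := by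
    rw [map_add, map_pow, map_pow]
    have := sq_nonneg (ev₀ (rs 1 p))
    have := pow_pos (abs_pos.2 ha₀') 2
    rw [sq_abs] at this
    positivity
  obtain ⟨w, hw⟩ := exists_mul_eq_one hN
  set b₁ := αi * β with hb₁
  set b₂ := αi * σ with hb₂
  -- The torsion equation on the axis solved for c, which is possible because p² + a² is a unit
  -- there. The inverse w is restricted to make the initial value independent of v.
  set c₀ := (rs 1 α * m * (rs 1 p ^ 2 + a₀ ^ 2) - (rs 1 p * D 0 a₀ - a₀ * D 0 (rs 1 p))) * rs 1 w
    with hc₀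
  have hw' : (rs 1 p ^ 2 + a₀ ^ 2) * rs 1 w = 1 := by
    have := congrArg (rs 1) hw
    rwa [map_mul, map_add, map_pow, map_pow, rs_rs, hra₀, map_one] at this
  have hi₀' : a₀ * rs 1 i₀ = 1 := by
    have := congrArg (rs 1) hi₀
    rwa [map_mul, hra₀, map_one] at this
  have h01 : (0 : Fin 3) ≠ 1 := by decide
  have hrc₀ : rs 1 c₀ = c₀ := by
    rw [hc₀]
    simp only [map_mul, map_sub, map_add, map_pow, rs_rs, hra₀, hrm, rs_D h01]
  obtain ⟨y, hy0, hy⟩ := exists_cauchy_solution (i := 1) (j := 0) h01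
    (codazziSystem b₁ b₂ p q κ) ![a₀, c₀, rs 1 i₀] (by
      intro k; fin_cases k
      · exact hra₀
      · exact hrc₀
      · exact rs_rs _ _)
  obtain ⟨hya, hyc, hyi⟩ := (codazziSystem_iff b₁ b₂ p q κ y).1 hy
  have hya0 : rs 1 (y 0) = a₀ := hy0 0
  have hyc0 : rs 1 (y 1) = c₀ := hy0 1
  have hyi0 : rs 1 (y 2) = rs 1 i₀ := hy0 2
  -- The third unknown really is 1/a: with i for this unknown, 1 − a i vanishes on the axis and its
  -- v-derivative is −i a_v (1 − a i).
  have hinv : y 0 * y 2 = 1 := by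
    have h1 : 1 - y 0 * y 2 = 0 := by
      refine scalar_solution_eq_zero h01 (-(y 2 * D 1 (y 0))) ?_ ?_
      · rw [map_sub, D_mul, hyi, ← hya, Derivation.map_one_eq_zero]
        ring
      · rw [map_sub, map_one, map_mul, hya0, hyi0, hi₀', sub_self]
    linear_combination -h1
  set b := b₁ * y 0 + b₂ * y 1 with hb
  set d := (κ + b * y 1) * y 2 with hd
  have hsym : α * b = β * y 0 + σ * y 1 := by
    rw [hb, hb₁, hb₂]; linear_combination (β * y 0 + σ * y 1) * hαi
  have hgauss : y 0 * d = κ + b * y 1 := by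
    rw [hd]; linear_combination (κ + b * y 1) * hinv
  set U : Fin 4 → Fin 4 → Series3 :=
    ![![0, p, y 0, 0], ![-p, 0, y 1, 0], ![-y 0, -y 1, 0, 0], ![α, 0, 0, 0]] with hU
  set V : Fin 4 → Fin 4 → Series3 :=
    ![![0, q, b, 0], ![-q, 0, d, 0], ![-b, -d, 0, 0], ![β, σ, 0, 0]] with hV
  -- The upper three rows of the compatibility condition contain Gauss and the two Codazzi
  -- equations; the last row contains the two equations for the connection form and the symmetry of
  -- the second fundamental form.
  have hUV : ∀ k l, D 1 (U k l) + ∑ m, U k m * V m l = D 0 (V k l) + ∑ m, V k m * U m l := by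
    intro k l
    fin_cases k <;> fin_cases l <;>
      simp [hU, hV, Fin.sum_univ_four]
    · ring
    · linear_combination -hκ - hgauss
    · linear_combination hya
    · linear_combination hκ + hgauss
    · ring
    · linear_combination hyc
    · linear_combination -hya
    · linear_combination -hyc
    · ring
    · linear_combination T₁
    · linear_combination -T₂
    · linear_combination hsym
  choose X hXu hXv hX0 using fun k : Fin 3 => exists_total_solution (i := 1) (j := 0) h01 U V hUV
    fun l => if l.val = k.val then 1 else 0
  refine ⟨y 0, b, y 1, d, y 2, X, ?_⟩
  exact
  { a_init := hya0
    c_init := by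
      rw [hyc0, hya0, hc₀]
      linear_combination (rs 1 α * m * (rs 1 p ^ 2 + a₀ ^ 2)
        - (rs 1 p * D 0 a₀ - a₀ * D 0 (rs 1 p))) * hw'
    inv := hinv
    sym := hsym
    gauss := hgauss
    cod₁ := hya
    cod₂ := hyc
    u0 := fun k => by rw [hXu]; simp [hU, Fin.sum_univ_four]
    u1 := fun k => by rw [hXu]; simp [hU, Fin.sum_univ_four]; ring
    u2 := fun k => by rw [hXu]; simp [hU, Fin.sum_univ_four]; ring
    u3 := fun k => by rw [hXu]; simp [hU, Fin.sum_univ_four]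
    v0 := fun k => by rw [hXv]; simp [hV, Fin.sum_univ_four]
    v1 := fun k => by rw [hXv]; simp [hV, Fin.sum_univ_four]; ring
    v2 := fun k => by rw [hXv]; simp [hV, Fin.sum_univ_four]; ring
    v3 := fun k => by rw [hXv]; simp [hV, Fin.sum_univ_four]
    init := fun k l => by
      rw [hX0]
      split_ifs <;> simp }

/-- Uniqueness of solutions of the structure equations. -/
theorem IsFrameSolution.unique {a b c d i a' b' c' d' i' : Series3}
    {X X' : Fin 3 → Fin 4 → Series3} (hα : ev₀ α ≠ 0) (he : ev₀ e ≠ 0)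
    (h : IsSeriesSolution α β σ p q κ e m a b c d i X)
    (h' : IsSeriesSolution α β σ p q κ e m a' b' c' d' i' X') : X = X' := by
  have h01 : (0 : Fin 3) ≠ 1 := by decide
  obtain ⟨αi, hαi⟩ := exists_mul_eq_one hα
  -- Every solution of the structure equations yields a solution of the Codazzi system: b and d are
  -- forced, and differentiating a i = 1 gives the equation for i.
  have key : ∀ {a b c d i : Series3} {X : Fin 3 → Fin 4 → Series3},
      IsSeriesSolution α β σ p q κ e m a b c d i X →
      b = (αi * β) * a + (αi * σ) * c ∧ d = (κ + b * c) * i ∧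
      ∀ k, D 1 (![a, c, i] k) = MvPolynomial.aeval (Sum.elim ![a, c, i] fun l => D 0 (![a, c, i] l))
        (codazziSystem (αi * β) (αi * σ) p q κ k) := by
    intro a b c d i X h
    have hb : b = (αi * β) * a + (αi * σ) * c := by linear_combination αi * h.sym - b * hαi
    have hd : d = (κ + b * c) * i := by linear_combination i * h.gauss - d * h.inv
    refine ⟨hb, hd, (codazziSystem_iff _ _ _ _ _ _).2 ?_⟩
    have h3 : D 1 i = -i ^ 2 * D 1 a := by
      have h4 := congrArg (D 1) h.inv
      rw [D_mul, Derivation.map_one_eq_zero] at h4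
      linear_combination i * h4 - D 1 i * h.inv
    simp only [Matrix.cons_val_zero, Matrix.cons_val_one, Matrix.cons_val]
    rw [← hb, ← hd]
    exact ⟨h.cod₁, h.cod₂, by rw [h3, h.cod₁]⟩
  obtain ⟨hb, hd, hy⟩ := key h
  obtain ⟨hb', hd', hy'⟩ := key h'
  have ha : rs 1 a = rs 1 a' := by rw [h.a_init, h'.a_init]
  -- Its value at the origin is positive. Since the series have no zero divisors, the condition
  -- `c_init` then determines c on the axis.
  have hN : rs 1 p ^ 2 + rs 1 a ^ 2 ≠ 0 := by
    intro h0
    have h1 := congrArg ev₀ h0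
    rw [map_add, map_pow, map_pow, h.a_init, map_mul, ev₀_rs 1 α, map_zero] at h1
    have h2 : ev₀ α * ev₀ e ≠ 0 := mul_ne_zero hα he
    have := pow_pos (abs_pos.2 h2) 2
    rw [sq_abs] at this
    have := sq_nonneg (ev₀ (rs 1 p))
    linarith
  have hc : rs 1 c = rs 1 c' := by
    have h1 := h.c_init
    have h2 := h'.c_init
    rw [← ha, ← h1] at h2
    exact (mul_right_cancel₀ hN h2).symm
  have hi : rs 1 i = rs 1 i' := by
    have h1 := congrArg (rs 1) h.inv
    have h2 := congrArg (rs 1) h'.inv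
    rw [map_mul, map_one] at h1 h2
    rw [← ha] at h2
    linear_combination rs 1 i' * h1 - rs 1 i * h2
  have hy2 := cauchy_solution_unique h01 _ hy hy' (by
    intro k; fin_cases k
    exacts [ha, hc, hi])
  have ea : a = a' := congrFun hy2 0
  have ec : c = c' := congrFun hy2 1
  have ei : i = i' := congrFun hy2 2
  subst ea ec ei
  rw [← hb] at hb'
  subst hb'
  rw [← hd] at hd'
  subst hd'
  have h10 : (1 : Fin 3) ≠ 0 := by decide
  funext k
  set U : Fin 4 → Fin 4 → Series3 :=
    ![![0, p, a, 0], ![-p, 0, c, 0], ![-a, -c, 0, 0], ![α, 0, 0, 0]] with hU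
  set V : Fin 4 → Fin 4 → Series3 :=
    ![![0, q, b', 0], ![-q, 0, d', 0], ![-b', -d', 0, 0], ![β, σ, 0, 0]] with hV
  have hXV : ∀ {X : Fin 3 → Fin 4 → Series3},
      IsSeriesSolution α β σ p q κ e m a b' c d' i X → ∀ l, D 1 (X k l) = ∑ m, V l m * X k m := by
    intro X h l
    fin_cases l
    · simp [hV, Fin.sum_univ_four, h.v0 k]
    · simp [hV, Fin.sum_univ_four, h.v1 k]; ring
    · simp [hV, Fin.sum_univ_four, h.v2 k]; ring
    · simp [hV, Fin.sum_univ_four, h.v3 k]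
  have hXU : ∀ {X : Fin 3 → Fin 4 → Series3},
      IsSeriesSolution α β σ p q κ e m a b' c d' i X →
      ∀ l, D 0 (rs 1 (X k l)) = ∑ m, rs 1 (U l m) * rs 1 (X k m) := by
    intro X h l
    have : D 0 (X k l) = ∑ m, U l m * X k m := by
      fin_cases l
      · simp [hU, Fin.sum_univ_four, h.u0 k]
      · simp [hU, Fin.sum_univ_four, h.u1 k]; ring
      · simp [hU, Fin.sum_univ_four, h.u2 k]; ring
      · simp [hU, Fin.sum_univ_four, h.u3 k]
    rw [← rs_D h01, this, map_sum]
    simp_rw [map_mul]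
  refine linear_solution_unique h01 V (hXV h) (hXV h') fun l => ?_
  have := linear_solution_unique h10 (fun l m => rs 1 (U l m)) (hXU h) (hXU h') fun l => by
    rw [h.init, h'.init]
  exact congrFun this l

end

end FormalGerm

/-! ### Geometry of a solution of the structure equations -/

namespace FormalGerm

section

variable {α β σ p q κ e m a b c d i : Series3} {X : Fin 3 → Fin 4 → Series3}

/-- The matrix of the frame satisfies X' = XΩ with Ω skew, so (XXᵀ)' = X(Ω + Ωᵀ)Xᵀ = 0. This Gram
matrix of the rows is constant, whereas that of the frame vectors would only satisfy a linear
equation. -/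
theorem IsFrameSolution.gram (h : IsSeriesSolution α β σ p q κ e m a b c d i X) (k l : Fin 3) :
    X k 0 * X l 0 + X k 1 * X l 1 + X k 2 * X l 2 = if k = l then 1 else 0 := by
  have h1 : X k 0 * X l 0 + X k 1 * X l 1 + X k 2 * X l 2
      = algebraMap ℝ Series3 (if k = l then 1 else 0) := by
    refine eq_algebraMap_of_D_eq_zero (i := 1) (j := 0) ?_ ?_ ?_
    · simp only [map_add, D_mul, h.v0, h.v1, h.v2]; ring
    · simp only [map_add, D_mul, h.u0, h.u1, h.u2]; ring
    · simp only [map_add, map_mul, h.init]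
      fin_cases k <;> fin_cases l <;> simp
  rw [h1]
  split_ifs <;> simp

/-- For square matrices over a commutative ring, XXᵀ = 1 implies XᵀX = 1. -/
theorem IsFrameSolution.orthonormal (h : IsSeriesSolution α β σ p q κ e m a b c d i X) :
    (X 0 0 * X 0 0 + X 1 0 * X 1 0 + X 2 0 * X 2 0 = 1 ∧
      X 0 1 * X 0 1 + X 1 1 * X 1 1 + X 2 1 * X 2 1 = 1 ∧
      X 0 2 * X 0 2 + X 1 2 * X 1 2 + X 2 2 * X 2 2 = 1) ∧
    (X 0 0 * X 0 1 + X 1 0 * X 1 1 + X 2 0 * X 2 1 = 0 ∧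
      X 0 0 * X 0 2 + X 1 0 * X 1 2 + X 2 0 * X 2 2 = 0 ∧
      X 0 1 * X 0 2 + X 1 1 * X 1 2 + X 2 1 * X 2 2 = 0) := by
  set A : Matrix (Fin 3) (Fin 3) Series3 :=
    !![X 0 0, X 0 1, X 0 2; X 1 0, X 1 1, X 1 2; X 2 0, X 2 1, X 2 2] with hA
  have h1 : A * A.transpose = 1 := by
    ext k l
    rw [Matrix.one_apply, ← h.gram k l, Matrix.mul_apply, Fin.sum_univ_three]
    fin_cases k <;> fin_cases l <;> rfl
  have h2 : A.transpose * A = 1 := mul_eq_one_comm.1 h1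
  have h3 : ∀ k l, A 0 k * A 0 l + A 1 k * A 1 l + A 2 k * A 2 l
      = (1 : Matrix (Fin 3) (Fin 3) Series3) k l := by
    intro k l
    rw [← h2, Matrix.mul_apply, Fin.sum_univ_three]
    rfl
  exact ⟨⟨h3 0 0, h3 1 1, h3 2 2⟩, ⟨h3 0 1, h3 0 2, h3 1 2⟩⟩

/-- The determinant is constant because the connection matrix has trace zero. It fixes the
orientation of the frame, on which the sign of the torsion depends. -/
theorem IsFrameSolution.det_eq_one (h : IsSeriesSolution α β σ p q κ e m a b c d i X) :
    X 0 0 * (X 1 1 * X 2 2 - X 1 2 * X 2 1) - X 0 1 * (X 1 0 * X 2 2 - X 1 2 * X 2 0)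
      + X 0 2 * (X 1 0 * X 2 1 - X 1 1 * X 2 0) = 1 := by
  have h1 : X 0 0 * (X 1 1 * X 2 2 - X 1 2 * X 2 1) - X 0 1 * (X 1 0 * X 2 2 - X 1 2 * X 2 0)
      + X 0 2 * (X 1 0 * X 2 1 - X 1 1 * X 2 0) = algebraMap ℝ Series3 1 := by
    refine eq_algebraMap_of_D_eq_zero (i := 1) (j := 0) ?_ ?_ ?_
    · simp only [map_add, map_sub, D_mul, h.v0, h.v1, h.v2]; ring
    · simp only [map_add, map_sub, D_mul, h.u0, h.u1, h.u2]; ring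
    · simp only [map_add, map_sub, map_mul, h.init]
      simp
  rw [h1, map_one]

/-- The first fundamental form and the unit normal of a solution of the structure equations. -/
theorem IsFrameSolution.fundamental (h : IsSeriesSolution α β σ p q κ e m a b c d i X) :
    (D 0 (X 0 3) * D 0 (X 0 3) + D 0 (X 1 3) * D 0 (X 1 3) + D 0 (X 2 3) * D 0 (X 2 3) = α * α ∧
      D 0 (X 0 3) * D 1 (X 0 3) + D 0 (X 1 3) * D 1 (X 1 3) + D 0 (X 2 3) * D 1 (X 2 3) = α * β ∧
      D 1 (X 0 3) * D 1 (X 0 3) + D 1 (X 1 3) * D 1 (X 1 3) + D 1 (X 2 3) * D 1 (X 2 3)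
        = β * β + σ * σ) ∧
    (D 0 (X 0 3) * X 0 2 + D 0 (X 1 3) * X 1 2 + D 0 (X 2 3) * X 2 2 = 0 ∧
      D 1 (X 0 3) * X 0 2 + D 1 (X 1 3) * X 1 2 + D 1 (X 2 3) * X 2 2 = 0) := by
  obtain ⟨⟨h00, h11, h22⟩, h01, h02, h12⟩ := h.orthonormal
  simp only [h.u3, h.v3]
  refine ⟨⟨?_, ?_, ?_⟩, ?_, ?_⟩
  · linear_combination α * α * h00
  · linear_combination α * β * h00 + α * σ * h01
  · linear_combination β * β * h00 + 2 * β * σ * h01 + σ * σ * h11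
  · linear_combination α * h02
  · linear_combination β * h02 + σ * h12

theorem IsFrameSolution.second_derivative (h : IsSeriesSolution α β σ p q κ e m a b c d i X)
    (k : Fin 3) : D 0 (D 0 (X k 3)) = D 0 α * X k 0 + α * p * X k 1 + α * a * X k 2 := by
  rw [h.u3, D_mul, h.u0]; ring

theorem IsFrameSolution.third_derivative (h : IsSeriesSolution α β σ p q κ e m a b c d i X)
    (k : Fin 3) : D 0 (D 0 (D 0 (X k 3)))
      = (D 0 (D 0 α) - α * p * p - α * a * a) * X k 0
        + (D 0 α * p + D 0 (α * p) - α * a * c) * X k 1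
        + (D 0 α * a + D 0 (α * a) + α * p * c) * X k 2 := by
  rw [h.second_derivative]
  simp only [map_add, D_mul, h.u0, h.u1, h.u2]
  ring

/-- The normal curvature along the first coordinate line. -/
theorem IsFrameSolution.normal_curvature (h : IsSeriesSolution α β σ p q κ e m a b c d i X) :
    rs 1 (D 0 (D 0 (X 0 3)) * X 0 2 + D 0 (D 0 (X 1 3)) * X 1 2 + D 0 (D 0 (X 2 3)) * X 2 2)
      = rs 1 α * rs 1 α * e := by
  obtain ⟨⟨h00, h11, h22⟩, h01, h02, h12⟩ := h.orthonormal
  rw [show D 0 (D 0 (X 0 3)) * X 0 2 + D 0 (D 0 (X 1 3)) * X 1 2 + D 0 (D 0 (X 2 3)) * X 2 2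
    = α * a by
      simp only [h.second_derivative]
      linear_combination D 0 α * h02 + α * p * h12 + α * a * h22, map_mul, h.a_init]
  ring

/-- The torsion of the image of the first coordinate line. -/
theorem IsFrameSolution.torsion (h : IsSeriesSolution α β σ p q κ e m a b c d i X)
    (f : Fin 3 → Series3) (hf : f = fun k => D 0 (X k 3)) :
    rs 1 (f 0 * (D 0 (f 1) * D 0 (D 0 (f 2)) - D 0 (f 2) * D 0 (D 0 (f 1)))
      - f 1 * (D 0 (f 0) * D 0 (D 0 (f 2)) - D 0 (f 2) * D 0 (D 0 (f 0)))
      + f 2 * (D 0 (f 0) * D 0 (D 0 (f 1)) - D 0 (f 1) * D 0 (D 0 (f 0))))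
      = m * (rs 1 α ^ 4 * (rs 1 p ^ 2 + rs 1 a ^ 2)) ∧
    rs 1 ((f 0 * f 0 + f 1 * f 1 + f 2 * f 2)
        * (D 0 (f 0) * D 0 (f 0) + D 0 (f 1) * D 0 (f 1) + D 0 (f 2) * D 0 (f 2))
      - (f 0 * D 0 (f 0) + f 1 * D 0 (f 1) + f 2 * D 0 (f 2)) ^ 2)
      = rs 1 α ^ 4 * (rs 1 p ^ 2 + rs 1 a ^ 2) := by
  obtain ⟨⟨h00, h11, h22⟩, h01, h02, h12⟩ := h.orthonormal
  subst hf
  have h0 : (0 : Fin 3) ≠ 1 := by decide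
  constructor
  · simp only [h.third_derivative]
    simp only [h.second_derivative]
    simp only [h.u3]
    -- A determinant of vectors expanded in the frame is the determinant of their components, as the
    -- frame has determinant 1; the first vector is a multiple of e₁.
    have e1 : ∀ x₀ y₀ y₁ y₂ z₀ z₁ z₂ : Series3,
        (x₀ * X 0 0 * ((y₀ * X 1 0 + y₁ * X 1 1 + y₂ * X 1 2)
            * (z₀ * X 2 0 + z₁ * X 2 1 + z₂ * X 2 2)
          - (y₀ * X 2 0 + y₁ * X 2 1 + y₂ * X 2 2) * (z₀ * X 1 0 + z₁ * X 1 1 + z₂ * X 1 2))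
        - x₀ * X 1 0 * ((y₀ * X 0 0 + y₁ * X 0 1 + y₂ * X 0 2)
            * (z₀ * X 2 0 + z₁ * X 2 1 + z₂ * X 2 2)
          - (y₀ * X 2 0 + y₁ * X 2 1 + y₂ * X 2 2) * (z₀ * X 0 0 + z₁ * X 0 1 + z₂ * X 0 2))
        + x₀ * X 2 0 * ((y₀ * X 0 0 + y₁ * X 0 1 + y₂ * X 0 2)
            * (z₀ * X 1 0 + z₁ * X 1 1 + z₂ * X 1 2)
          - (y₀ * X 1 0 + y₁ * X 1 1 + y₂ * X 1 2) * (z₀ * X 0 0 + z₁ * X 0 1 + z₂ * X 0 2)))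
        = x₀ * (y₁ * z₂ - y₂ * z₁) := by
      intro x₀ y₀ y₁ y₂ z₀ z₁ z₂
      linear_combination x₀ * (y₁ * z₂ - y₂ * z₁) * h.det_eq_one
    rw [e1]
    rw [show α * (α * p * (D 0 α * a + D 0 (α * a) + α * p * c)
        - α * a * (D 0 α * p + D 0 (α * p) - α * a * c))
      = α ^ 3 * (p * D 0 a - a * D 0 p + c * (p ^ 2 + a ^ 2)) by
        rw [D_mul, D_mul]; ring]
    simp only [map_mul, map_add, map_sub, map_pow, rs_D h0]
    linear_combination rs 1 α ^ 3 * h.c_init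
  · rw [show (D 0 (X 0 3) * D 0 (X 0 3) + D 0 (X 1 3) * D 0 (X 1 3) + D 0 (X 2 3) * D 0 (X 2 3))
        * (D 0 (D 0 (X 0 3)) * D 0 (D 0 (X 0 3)) + D 0 (D 0 (X 1 3)) * D 0 (D 0 (X 1 3))
          + D 0 (D 0 (X 2 3)) * D 0 (D 0 (X 2 3)))
      - (D 0 (X 0 3) * D 0 (D 0 (X 0 3)) + D 0 (X 1 3) * D 0 (D 0 (X 1 3))
          + D 0 (X 2 3) * D 0 (D 0 (X 2 3))) ^ 2 = α ^ 4 * (p ^ 2 + a ^ 2) by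
        have e1 : D 0 (X 0 3) * D 0 (X 0 3) + D 0 (X 1 3) * D 0 (X 1 3)
            + D 0 (X 2 3) * D 0 (X 2 3) = α * α := h.fundamental.1.1
        have e2 : D 0 (X 0 3) * D 0 (D 0 (X 0 3)) + D 0 (X 1 3) * D 0 (D 0 (X 1 3))
            + D 0 (X 2 3) * D 0 (D 0 (X 2 3)) = α * D 0 α := by
          simp only [h.second_derivative]
          simp only [h.u3]
          linear_combination α * D 0 α * h00 + α * (α * p) * h01 + α * (α * a) * h02
        have e3 : D 0 (D 0 (X 0 3)) * D 0 (D 0 (X 0 3)) + D 0 (D 0 (X 1 3)) * D 0 (D 0 (X 1 3))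
            + D 0 (D 0 (X 2 3)) * D 0 (D 0 (X 2 3))
              = D 0 α * D 0 α + (α * p) * (α * p) + (α * a) * (α * a) := by
          simp only [h.second_derivative]
          linear_combination D 0 α * D 0 α * h00 + (α * p) * (α * p) * h11
            + (α * a) * (α * a) * h22 + 2 * D 0 α * (α * p) * h01 + 2 * D 0 α * (α * a) * h02
            + 2 * (α * p) * (α * a) * h12
        rw [e1, e2, e3]; ring]
    simp only [map_mul, map_add, map_pow]

theorem rs_two_slice {x : Series3} (hx : rs 2 x = x) (δ : ℝ) : slice 2 δ x = x := by
  refine ofFun_eq (Eventually.of_forall fun y => ?_)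
  have : ∀ z, ev x z = ev x (Function.update z 2 0) := by
    intro z
    conv_lhs => rw [← hx]
    exact ev_rs 2 x z
  show ev x y = ev x (Function.update y 2 δ)
  rw [this y, this (Function.update y 2 δ), Function.update_idem]

/-- Slices of solutions of the structure equations are solutions. -/
theorem IsFrameSolution.slice (h : IsSeriesSolution α β σ p q κ e m a b c d i X) :
    ∀ᶠ δ in 𝓝 (0 : ℝ), IsSeriesSolution (slice 2 δ α) (slice 2 δ β) (slice 2 δ σ) (slice 2 δ p)
      (slice 2 δ q) (slice 2 δ κ) (slice 2 δ e) (slice 2 δ m) (slice 2 δ a) (slice 2 δ b)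
      (slice 2 δ c) (slice 2 δ d) (slice 2 δ i) fun k l => slice 2 δ (X k l) := by
  -- Transport to germs in the parameter replaces a separate verification for each equation;
  -- afterwards finitely many germ identities are read off for all small δ.
  have H := IsFrameSolution.map h (sliceGerm 2) (E₀ := Germ.map (D 0)) (E₁ := Germ.map (D 1))
    (s₀ := Germ.map (rs 0)) (s₁ := Germ.map (rs 1))
    (fun x => Germ.coe_eq.2 (slice_D (by decide) x))
    (fun x => Germ.coe_eq.2 (slice_D (by decide) x))
    (fun x => Germ.coe_eq.2 (slice_rs (by decide) x))
    (fun x => Germ.coe_eq.2 (slice_rs (by decide) x))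
  have Hinit : ∀ k l, ∀ᶠ δ in 𝓝 (0 : ℝ), rs 0 (rs 1 (FormalGerm.slice 2 δ (X k l)))
      = if l.val = k.val then 1 else 0 := by
    intro k l
    have := H.init k l
    split_ifs at this ⊢ with hkl
    · exact Germ.coe_eq.1 this
    · exact Germ.coe_eq.1 this
  filter_upwards [Germ.coe_eq.1 H.a_init, Germ.coe_eq.1 H.c_init, Germ.coe_eq.1 H.inv,
    Germ.coe_eq.1 H.sym, Germ.coe_eq.1 H.gauss, Germ.coe_eq.1 H.cod₁, Germ.coe_eq.1 H.cod₂,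
    eventually_all.2 fun k => Germ.coe_eq.1 (H.u0 k),
    eventually_all.2 fun k => Germ.coe_eq.1 (H.u1 k),
    eventually_all.2 fun k => Germ.coe_eq.1 (H.u2 k),
    eventually_all.2 fun k => Germ.coe_eq.1 (H.u3 k),
    eventually_all.2 fun k => Germ.coe_eq.1 (H.v0 k),
    eventually_all.2 fun k => Germ.coe_eq.1 (H.v1 k),
    eventually_all.2 fun k => Germ.coe_eq.1 (H.v2 k),
    eventually_all.2 fun k => Germ.coe_eq.1 (H.v3 k),
    eventually_all.2 fun k => eventually_all.2 fun l => Hinit k l]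
    with δ h1 h2 h3 h4 h5 h6 h7 h8 h9 h10 h11 h12 h13 h14 h15 h16
  exact ⟨h1, h2, h3, h4, h5, h6, h7, h8, h9, h10, h11, h12, h13, h14, h15, h16⟩

end

end FormalGerm

namespace FormalGerm

open Kossowski (Plane Space pd)

/-! ### Passage between series and functions on the coordinate plane -/

section PlaneFunctions

/-- The projection of the parameter space onto the coordinate plane. -/
noncomputable def toPlane : (Fin 3 → ℝ) →L[ℝ] Plane :=
  (EuclideanSpace.equiv (Fin 2) ℝ).symm.toContinuousLinearMap.comp
    (ContinuousLinearMap.pi ![ContinuousLinearMap.proj 0, ContinuousLinearMap.proj 1])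

/-- The embedding of the coordinate plane into the parameter space. -/
noncomputable def ofPlane : Plane →L[ℝ] (Fin 3 → ℝ) :=
  (ContinuousLinearMap.pi ![ContinuousLinearMap.proj 0, ContinuousLinearMap.proj 1, 0]).comp
    (EuclideanSpace.equiv (Fin 2) ℝ).toContinuousLinearMap

theorem toPlane_apply (x : Fin 3 → ℝ) : toPlane x = !₂[x 0, x 1] := by
  ext k; fin_cases k <;> rfl

theorem ofPlane_apply (y : Plane) : ofPlane y = ![y 0, y 1, 0] := by
  ext k; fin_cases k <;> rfl

theorem toPlane_ofPlane (y : Plane) : toPlane (ofPlane y) = y := by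
  ext k; fin_cases k <;> rfl

theorem toPlane_single_zero : toPlane (Pi.single 0 1) = EuclideanSpace.single 0 1 := by
  ext k; fin_cases k <;> simp [toPlane_apply]

theorem toPlane_single_one : toPlane (Pi.single 1 1) = EuclideanSpace.single 1 1 := by
  ext k; fin_cases k <;> simp [toPlane_apply]

theorem ofPlane_single_zero : ofPlane (EuclideanSpace.single 0 1) = Pi.single 0 1 := by
  ext k; fin_cases k <;> simp [ofPlane_apply]

theorem ofPlane_single_one : ofPlane (EuclideanSpace.single 1 1) = Pi.single 1 1 := by
  ext k; fin_cases k <;> simp [ofPlane_apply]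

/-- The restriction of the sum of a convergent power series to the coordinate plane. -/
noncomputable def fn (a : Series3) (y : Plane) : ℝ := ev a (ofPlane y)

/-- The convergent power series of an analytic function on the coordinate plane. -/
noncomputable def hat (h : Plane → ℝ) : Series3 := ofFun fun x => h (toPlane x)

theorem tendsto_ofPlane : Tendsto ofPlane (𝓝 0) (𝓝 0) := by
  simpa using ofPlane.continuous.tendsto 0

theorem tendsto_toPlane : Tendsto toPlane (𝓝 0) (𝓝 0) := by
  simpa using toPlane.continuous.tendsto 0

theorem analyticAt_comp_toPlane {h : Plane → ℝ} (hh : AnalyticAt ℝ h 0) :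
    AnalyticAt ℝ (fun x => h (toPlane x)) 0 :=
  AnalyticAt.comp (g := h) (by simpa using hh) (toPlane.analyticAt 0)

theorem ev_hat {h : Plane → ℝ} (hh : AnalyticAt ℝ h 0) :
    ev (hat h) =ᶠ[𝓝 0] fun x => h (toPlane x) :=
  ev_ofFun (analyticAt_comp_toPlane hh)

theorem fn_hat {h : Plane → ℝ} (hh : AnalyticAt ℝ h 0) : fn (hat h) =ᶠ[𝓝 0] h := by
  filter_upwards [tendsto_ofPlane.eventually (ev_hat hh)] with y hy
  rw [fn, hy, toPlane_ofPlane]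

theorem analyticAt_fn (a : Series3) : AnalyticAt ℝ (fn a) 0 :=
  AnalyticAt.comp (g := ev a) (by simpa using analyticAt_ev a) (ofPlane.analyticAt 0)

theorem rs_two_hat {h : Plane → ℝ} (hh : AnalyticAt ℝ h 0) : rs 2 (hat h) = hat h := by
  have hu : Tendsto (fun x : Fin 3 → ℝ => Function.update x 2 0) (𝓝 0) (𝓝 0) := by
    have hc : Continuous fun x : Fin 3 → ℝ => Function.update x 2 0 :=
      continuous_id.update 2 continuous_const
    have := hc.tendsto 0
    rwa [show Function.update (0 : Fin 3 → ℝ) 2 0 = 0 from Function.update_eq_self 2 _] at this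
  refine ev_injective ?_
  filter_upwards [hu.eventually (ev_hat hh), ev_hat hh] with x h1 h2
  rw [ev_rs, h1, h2]
  simp [toPlane_apply]

theorem hat_congr {h h' : Plane → ℝ} (hh : AnalyticAt ℝ h 0) (e : h =ᶠ[𝓝 0] h') :
    hat h = hat h' :=
  ofFun_congr (analyticAt_comp_toPlane hh) (tendsto_toPlane.eventually e)

theorem hat_mul {h h' : Plane → ℝ} (hh : AnalyticAt ℝ h 0) (hh' : AnalyticAt ℝ h' 0) :
    hat (fun y => h y * h' y) = hat h * hat h' :=
  ofFun_mul (analyticAt_comp_toPlane hh) (analyticAt_comp_toPlane hh')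

theorem hat_sub {h h' : Plane → ℝ} (hh : AnalyticAt ℝ h 0) (hh' : AnalyticAt ℝ h' 0) :
    hat (fun y => h y - h' y) = hat h - hat h' :=
  ofFun_sub (analyticAt_comp_toPlane hh) (analyticAt_comp_toPlane hh')

theorem ev₀_hat {h : Plane → ℝ} (hh : AnalyticAt ℝ h 0) : ev₀ (hat h) = h 0 := by
  rw [ev₀_eq, (ev_hat hh).self_of_nhds]
  simp

theorem analyticAt_pd {E : Type*} [NormedAddCommGroup E] [NormedSpace ℝ E] [CompleteSpace E]
    (i : Fin 2) {h : Plane → E} {x : Plane} (hh : AnalyticAt ℝ h x) : AnalyticAt ℝ (pd i h) x :=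
  AnalyticAt.comp (g := ContinuousLinearMap.apply ℝ E (EuclideanSpace.single i 1))
    (ContinuousLinearMap.analyticAt _ _) hh.fderiv

theorem pd_congr {E : Type*} [NormedAddCommGroup E] [NormedSpace ℝ E] (i : Fin 2)
    {h h' : Plane → E} {x : Plane} (e : h =ᶠ[𝓝 x] h') : pd i h =ᶠ[𝓝 x] pd i h' := by
  filter_upwards [e.eventually_nhds] with y hy
  rw [pd, pd, Filter.EventuallyEq.fderiv_eq hy]

theorem D_hat_aux {h : Plane → ℝ} (hh : AnalyticAt ℝ h 0) (j : Fin 3) (i : Fin 2)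
    (hij : toPlane (Pi.single j 1) = EuclideanSpace.single i 1) :
    D j (hat h) = hat (pd i h) := by
  rw [hat, ← ofFun_fderiv (analyticAt_comp_toPlane hh)]
  refine (ofFun_congr (analyticAt_comp_toPlane (analyticAt_pd i hh)) ?_).symm
  filter_upwards [tendsto_toPlane.eventually hh.eventually_analyticAt] with x hx
  have h1 : HasFDerivAt (fun x => h (toPlane x)) ((fderiv ℝ h (toPlane x)).comp toPlane) x :=
    hx.differentiableAt.hasFDerivAt.comp x toPlane.hasFDerivAt
  rw [h1.fderiv, ContinuousLinearMap.comp_apply, hij, pd]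

theorem D_zero_hat {h : Plane → ℝ} (hh : AnalyticAt ℝ h 0) : D 0 (hat h) = hat (pd 0 h) :=
  D_hat_aux hh 0 0 toPlane_single_zero

theorem D_one_hat {h : Plane → ℝ} (hh : AnalyticAt ℝ h 0) : D 1 (hat h) = hat (pd 1 h) :=
  D_hat_aux hh 1 1 toPlane_single_one

theorem pd_fn_aux (a : Series3) (j : Fin 3) (i : Fin 2)
    (hij : ofPlane (EuclideanSpace.single i 1) = Pi.single j 1) :
    pd i (fn a) =ᶠ[𝓝 0] fn (D j a) := by
  filter_upwards [tendsto_ofPlane.eventually (ev_D j a),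
    tendsto_ofPlane.eventually (analyticAt_ev a).eventually_analyticAt] with y h1 h2
  have h3 : HasFDerivAt (fn a) ((fderiv ℝ (ev a) (ofPlane y)).comp ofPlane) y :=
    h2.differentiableAt.hasFDerivAt.comp y ofPlane.hasFDerivAt
  rw [pd, h3.fderiv, ContinuousLinearMap.comp_apply, hij, h1, fn]

theorem pd_zero_fn (a : Series3) : pd 0 (fn a) =ᶠ[𝓝 0] fn (D 0 a) :=
  pd_fn_aux a 0 0 ofPlane_single_zero

theorem pd_one_fn (a : Series3) : pd 1 (fn a) =ᶠ[𝓝 0] fn (D 1 a) :=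
  pd_fn_aux a 1 1 ofPlane_single_one

/-- The germ at the origin of the restriction to the coordinate plane. -/
noncomputable def fnGerm : Series3 →+* Germ (𝓝 (0 : Plane)) ℝ where
  toFun a := ((fn a : Plane → ℝ) : Germ (𝓝 (0 : Plane)) ℝ)
  map_one' := Germ.coe_eq.2 (Eventually.of_forall fun y => ev_one _)
  map_mul' a b := Germ.coe_eq.2 (tendsto_ofPlane.eventually (ev_mul a b))
  map_zero' := Germ.coe_eq.2 (Eventually.of_forall fun y => ev_zero _)
  map_add' a b := Germ.coe_eq.2 (tendsto_ofPlane.eventually (ev_add a b))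

theorem fn_mul (a b : Series3) : fn (a * b) =ᶠ[𝓝 0] fun y => fn a y * fn b y :=
  Germ.coe_eq.1 (map_mul fnGerm a b)

theorem fn_add (a b : Series3) : fn (a + b) =ᶠ[𝓝 0] fun y => fn a y + fn b y :=
  Germ.coe_eq.1 (map_add fnGerm a b)

theorem fn_sub (a b : Series3) : fn (a - b) =ᶠ[𝓝 0] fun y => fn a y - fn b y :=
  Germ.coe_eq.1 (map_sub fnGerm a b)

theorem fn_one (y : Plane) : fn 1 y = 1 := ev_one _

theorem fn_zero (y : Plane) : fn 0 y = 0 := ev_zero _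

/-- The map to space whose coordinates are the restrictions of given power series. -/
noncomputable def vec (Y : Fin 3 → Series3) (y : Plane) : Space := WithLp.toLp 2 fun k => fn (Y k) y

theorem vec_apply (Y : Fin 3 → Series3) (y : Plane) (k : Fin 3) : vec Y y k = fn (Y k) y := rfl

theorem analyticAt_space {E : Type*} [NormedAddCommGroup E] [NormedSpace ℝ E] {h : E → Space}
    {x : E} (hh : ∀ k, AnalyticAt ℝ (fun y => h y k) x) : AnalyticAt ℝ h x :=
  AnalyticAt.comp (g := (EuclideanSpace.equiv (Fin 3) ℝ).symm) (f := fun y k => h y k)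
    ((EuclideanSpace.equiv (Fin 3) ℝ).symm.toContinuousLinearMap.analyticAt _)
    (analyticAt_pi_iff.2 hh)

theorem analyticAt_coord {E : Type*} [NormedAddCommGroup E] [NormedSpace ℝ E] {h : E → Space}
    {x : E} (hh : AnalyticAt ℝ h x) (k : Fin 3) : AnalyticAt ℝ (fun y => h y k) x :=
  AnalyticAt.comp (g := EuclideanSpace.proj (𝕜 := ℝ) k)
    (ContinuousLinearMap.analyticAt _ _) hh

theorem analyticAt_vec (Y : Fin 3 → Series3) : AnalyticAt ℝ (vec Y) 0 :=
  analyticAt_space fun k => analyticAt_fn (Y k)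

theorem pd_coord {n : ℕ} (i : Fin 2) {h : Plane → EuclideanSpace ℝ (Fin n)} {x : Plane}
    (hh : DifferentiableAt ℝ h x) (k : Fin n) : (pd i h x) k = pd i (fun y => h y k) x := by
  have h1 : HasFDerivAt (fun y => h y k)
      ((EuclideanSpace.proj (𝕜 := ℝ) k).comp (fderiv ℝ h x)) x :=
    (EuclideanSpace.proj (𝕜 := ℝ) k).hasFDerivAt.comp x hh.hasFDerivAt
  rw [pd, pd, h1.fderiv]
  rfl

theorem pd_zero_vec (Y : Fin 3 → Series3) : pd 0 (vec Y) =ᶠ[𝓝 0] vec fun k => D 0 (Y k) := by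
  filter_upwards [(analyticAt_vec Y).eventually_analyticAt,
    eventually_all.2 fun k => pd_zero_fn (Y k)] with y h1 h2
  ext k
  rw [pd_coord 0 h1.differentiableAt, vec_apply, ← h2]
  rfl

theorem pd_one_vec (Y : Fin 3 → Series3) : pd 1 (vec Y) =ᶠ[𝓝 0] vec fun k => D 1 (Y k) := by
  filter_upwards [(analyticAt_vec Y).eventually_analyticAt,
    eventually_all.2 fun k => pd_one_fn (Y k)] with y h1 h2
  ext k
  rw [pd_coord 1 h1.differentiableAt, vec_apply, ← h2]
  rfl

theorem inner_space (a b : Space) : inner ℝ a b = a 0 * b 0 + a 1 * b 1 + a 2 * b 2 := by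
  simp [PiLp.inner_apply, Fin.sum_univ_three, mul_comm]

/-- The scalar product of vectors of power series. -/
noncomputable def dot (Y Z : Fin 3 → Series3) : Series3 := Y 0 * Z 0 + Y 1 * Z 1 + Y 2 * Z 2

/-- The determinant of three vectors of power series. -/
noncomputable def triple (Y Z W : Fin 3 → Series3) : Series3 :=
  Y 0 * (Z 1 * W 2 - Z 2 * W 1) - Y 1 * (Z 0 * W 2 - Z 2 * W 0) + Y 2 * (Z 0 * W 1 - Z 1 * W 0)

theorem det3_eq (a b c : Space) : Kossowski.det3 a b c =
    a 0 * (b 1 * c 2 - b 2 * c 1) - a 1 * (b 0 * c 2 - b 2 * c 0)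
      + a 2 * (b 0 * c 1 - b 1 * c 0) := by
  rw [Kossowski.det3, Matrix.det_fin_three]
  simp
  ring

theorem fn_dot (Y Z : Fin 3 → Series3) :
    fn (dot Y Z) =ᶠ[𝓝 0] fun y => inner ℝ (vec Y y) (vec Z y) := by
  have : fnGerm (dot Y Z) = fnGerm (Y 0) * fnGerm (Z 0) + fnGerm (Y 1) * fnGerm (Z 1)
      + fnGerm (Y 2) * fnGerm (Z 2) := by simp only [dot, map_add, map_mul]
  filter_upwards [Germ.coe_eq.1 this] with y hy
  rw [inner_space, hy]
  rfl

theorem fn_triple (Y Z W : Fin 3 → Series3) :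
    fn (triple Y Z W) =ᶠ[𝓝 0] fun y => Kossowski.det3 (vec Y y) (vec Z y) (vec W y) := by
  have : fnGerm (triple Y Z W)
      = fnGerm (Y 0) * (fnGerm (Z 1) * fnGerm (W 2) - fnGerm (Z 2) * fnGerm (W 1))
      - fnGerm (Y 1) * (fnGerm (Z 0) * fnGerm (W 2) - fnGerm (Z 2) * fnGerm (W 0))
      + fnGerm (Y 2) * (fnGerm (Z 0) * fnGerm (W 1) - fnGerm (Z 1) * fnGerm (W 0)) := by
    simp only [triple, map_add, map_sub, map_mul]
  filter_upwards [Germ.coe_eq.1 this] with y hy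
  rw [det3_eq, hy]
  rfl

/-- Lagrange's identity. It gives the denominator of the torsion the polynomial form in which
`IsFrameSolution.torsion` computes it. -/
theorem norm_cross_sq (a b : Space) : ‖Kossowski.cross a b‖ ^ 2
    = inner ℝ a a * inner ℝ b b - inner ℝ a b ^ 2 := by
  rw [EuclideanSpace.norm_sq_eq, Fin.sum_univ_three, inner_space, inner_space, inner_space]
  simp only [Kossowski.cross, Real.norm_eq_abs, sq_abs]
  simp
  ring

/-- The first coordinate axis. -/
noncomputable def axis : ℝ →L[ℝ] Plane :=
  ContinuousLinearMap.toSpanSingleton ℝ (EuclideanSpace.single 0 1)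

theorem axis_zero_coord (t : ℝ) : axis t 0 = t := by simp [axis]

theorem axis_one_coord (t : ℝ) : axis t 1 = 0 := by simp [axis]

theorem tendsto_axis : Tendsto axis (𝓝 0) (𝓝 0) := by
  simpa using axis.continuous.tendsto 0

theorem fn_rs_one_axis (a : Series3) (t : ℝ) : fn (rs 1 a) (axis t) = fn a (axis t) := by
  rw [fn, ev_rs, fn]
  congr 1
  ext k; fin_cases k <;> simp [ofPlane_apply, axis_one_coord]

theorem deriv_comp_axis {E : Type*} [NormedAddCommGroup E] [NormedSpace ℝ E]
    [CompleteSpace E] {h : Plane → E} (hh : AnalyticAt ℝ h 0) :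
    deriv (fun t => h (axis t)) =ᶠ[𝓝 0] fun t => pd 0 h (axis t) := by
  filter_upwards [tendsto_axis.eventually hh.eventually_analyticAt] with t ht
  have h1 : HasDerivAt (fun t => h (axis t)) (fderiv ℝ h (axis t) (axis 1)) t :=
    ht.differentiableAt.hasFDerivAt.comp_hasDerivAt t axis.hasDerivAt
  rw [h1.deriv, pd]
  congr 1
  simp [axis]

end PlaneFunctions

end FormalGerm

namespace FormalGerm

open Kossowski (Plane Space pd det3 cross)

/-! ### Gluing local analytic families -/

section Gluing

variable {V W : Type*} [NormedAddCommGroup V] [NormedSpace ℝ V] [NormedAddCommGroup W]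
  [NormedSpace ℝ W] [CompleteSpace W]

/-- Families of germs which locally come from analytic functions in the parameter and the
variable are the germs of one function. -/
theorem exists_glued_family {I : Set ℝ} (G : ℝ → V → W) (F : ℝ → ℝ × V → W)
    (hF : ∀ s₀ ∈ I, AnalyticAt ℝ (F s₀) (s₀, 0))
    (hG : ∀ s₀ ∈ I, ∀ᶠ s in 𝓝[I] s₀, ∀ᶠ x in 𝓝 0, F s₀ (s, x) = G s x) :
    ∃ f : ℝ → V → W,
      (∀ s ∈ I, AnalyticWithinAt ℝ (fun z : ℝ × V => f z.1 z.2) (I ×ˢ univ) (s, 0)) ∧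
      ∀ s ∈ I, f s =ᶠ[𝓝 0] G s := by
  -- The radius ε s₀ controls the analyticity of F s₀ uniformly in s. The equality with G s is only
  -- one of germs in x, on a neighbourhood that may depend on s.
  have key : ∀ s₀ : ℝ, ∃ ε > 0, s₀ ∈ I →
      (∀ s x, |s - s₀| < ε → ‖x‖ < ε → AnalyticAt ℝ (F s₀) (s, x)) ∧
      ∀ s ∈ I, |s - s₀| < ε → ∀ᶠ x in 𝓝 0, F s₀ (s, x) = G s x := by
    intro s₀
    by_cases hs : s₀ ∈ I
    · obtain ⟨ε₁, hε₁, h1⟩ := Metric.eventually_nhds_iff.1 (hF s₀ hs).eventually_analyticAt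
      obtain ⟨ε₂, hε₂, h2⟩ := Metric.eventually_nhds_iff.1 (eventually_nhdsWithin_iff.1 (hG s₀ hs))
      refine ⟨min ε₁ ε₂, lt_min hε₁ hε₂, fun _ => ⟨fun s x hsx hx => h1 ?_, fun s hs' hsx => ?_⟩⟩
      · rw [Prod.dist_eq, max_lt_iff, Real.dist_eq, dist_zero_right]
        exact ⟨hsx.trans_le (min_le_left _ _), hx.trans_le (min_le_left _ _)⟩
      · exact h2 (by rw [Real.dist_eq]; exact hsx.trans_le (min_le_right _ _)) hs'
    · exact ⟨1, one_pos, fun h => absurd h hs⟩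
  choose ε hε key using key
  -- For fixed s two local functions have the same germ at 0, so by the identity theorem they agree
  -- on the whole smaller ball. This makes the choice in the definition of f immaterial.
  have agree : ∀ s₀ ∈ I, ∀ s₁ ∈ I, ∀ s ∈ I, |s - s₀| < ε s₀ → |s - s₁| < ε s₁ → ∀ x,
      ‖x‖ < ε s₀ → ‖x‖ < ε s₁ → F s₀ (s, x) = F s₁ (s, x) := by
    intro s₀ hs₀ s₁ hs₁ s hs h0 h1 x hx0 hx1
    have han : ∀ s₀ ∈ I, |s - s₀| < ε s₀ → ∀ r ≤ ε s₀,
        AnalyticOnNhd ℝ (fun x => F s₀ (s, x)) (Metric.ball (0 : V) r) := by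
      intro s₀ hs₀ h0 r hr y hy
      rw [mem_ball_zero_iff] at hy
      exact AnalyticAt.comp (g := F s₀) (f := fun x => (s, x))
        ((key s₀ hs₀).1 s y h0 (hy.trans_le hr)) (analyticAt_const.prod analyticAt_id)
    have := (han s₀ hs₀ h0 (min (ε s₀) (ε s₁))
      (min_le_left _ _)).eqOn_of_preconnected_of_eventuallyEq
      (han s₁ hs₁ h1 (min (ε s₀) (ε s₁)) (min_le_right _ _))
      (convex_ball (0 : V) _).isPreconnected (Metric.mem_ball_self (lt_min (hε _) (hε _)))
      (by
        filter_upwards [(key s₀ hs₀).2 s hs h0, (key s₁ hs₁).2 s hs h1] with y h2 h3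
        rw [h2, h3])
    exact this (mem_ball_zero_iff.2 (lt_min hx0 hx1))
  classical
  let f : ℝ → V → W := fun s x =>
    if h : ∃ s₀ ∈ I, |s - s₀| < ε s₀ ∧ ‖x‖ < ε s₀ then F h.choose (s, x) else 0
  have hf : ∀ s₀ ∈ I, ∀ s ∈ I, |s - s₀| < ε s₀ → ∀ x, ‖x‖ < ε s₀ → f s x = F s₀ (s, x) := by
    intro s₀ hs₀ s hs h0 x hx
    have h : ∃ s₀ ∈ I, |s - s₀| < ε s₀ ∧ ‖x‖ < ε s₀ := ⟨s₀, hs₀, h0, hx⟩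
    have h' := h.choose_spec
    rw [show f s x = F h.choose (s, x) from dif_pos h]
    exact agree _ h'.1 _ hs₀ s hs h'.2.1 h0 x h'.2.2 hx
  refine ⟨f, fun s₀ hs₀ => ?_, fun s hs => ?_⟩
  · refine (hF s₀ hs₀).analyticWithinAt.congr_of_eventuallyEq ?_
      (hf s₀ hs₀ s₀ hs₀ (by simpa using hε s₀) 0 (by simpa using hε s₀))
    have h1 : ∀ᶠ z : ℝ × V in 𝓝 (s₀, 0), dist z (s₀, 0) < ε s₀ :=
      Metric.eventually_nhds_iff.2 ⟨ε s₀, hε s₀, fun _ h => h⟩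
    filter_upwards [h1.filter_mono nhdsWithin_le_nhds, self_mem_nhdsWithin] with z hz hz'
    rw [Prod.dist_eq, max_lt_iff, Real.dist_eq, dist_zero_right] at hz
    exact hf s₀ hs₀ z.1 hz'.1 hz.1 z.2 hz.2
  · have h1 : ∀ᶠ x : V in 𝓝 0, dist x 0 < ε s :=
      Metric.eventually_nhds_iff.2 ⟨ε s, hε s, fun _ h => h⟩
    have h0 : |s - s| < ε s := by simpa using hε s
    filter_upwards [h1, (key s hs).2 s hs h0] with x hx hx'
    rw [hf s hs s hs h0 x (by simpa using hx), hx']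

end Gluing

/-! ### From a coframe to a surface -/

/-- Analytic coefficients of a coframe `α du + β dv, σ dv`, with `p du + q dv` as connection
form. -/
structure IsCoframe (α β σ p : Plane → ℝ) : Prop where
  analytic_α : AnalyticAt ℝ α 0
  analytic_β : AnalyticAt ℝ β 0
  analytic_σ : AnalyticAt ℝ σ 0
  analytic_p : AnalyticAt ℝ p 0
  pos : 0 < α 0
  eq : (fun y => pd 0 β y - pd 1 α y) =ᶠ[𝓝 0] fun y => p y * σ y

/-- `f` is a frontal with unit normal `ν`, whose first fundamental form is given by a coframe, and
the image of the first coordinate axis has given normal curvature and torsion. -/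
structure IsSurface (α β σ : Plane → ℝ) (w μ : ℝ → ℝ) (f ν : Plane → Space) : Prop where
  analytic : AnalyticAt ℝ f 0
  analytic_normal : AnalyticAt ℝ ν 0
  form₀₀ : ∀ᶠ y in 𝓝 0, inner ℝ (pd 0 f y) (pd 0 f y) = α y * α y
  form₀₁ : ∀ᶠ y in 𝓝 0, inner ℝ (pd 0 f y) (pd 1 f y) = α y * β y
  form₁₁ : ∀ᶠ y in 𝓝 0, inner ℝ (pd 1 f y) (pd 1 f y) = β y * β y + σ y * σ y
  unit : ∀ᶠ y in 𝓝 0, inner ℝ (ν y) (ν y) = (1 : ℝ)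
  normal₀ : ∀ᶠ y in 𝓝 0, inner ℝ (pd 0 f y) (ν y) = (0 : ℝ)
  normal₁ : ∀ᶠ y in 𝓝 0, inner ℝ (pd 1 f y) (ν y) = (0 : ℝ)
  curvature : ∀ᶠ t in 𝓝 0, inner ℝ (pd 0 (pd 0 f) (axis t)) (ν (axis t))
    = α (axis t) * α (axis t) * Real.exp (w t)
  cross_pos : ∀ᶠ t in 𝓝 0, 0 < ‖cross (pd 0 f (axis t)) (pd 0 (pd 0 f) (axis t))‖ ^ 2
  torsion : ∀ᶠ t in 𝓝 0, det3 (pd 0 f (axis t)) (pd 0 (pd 0 f) (axis t))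
      (pd 0 (pd 0 (pd 0 f)) (axis t))
    = μ t * ‖cross (pd 0 f (axis t)) (pd 0 (pd 0 f) (axis t))‖ ^ 2

variable {α β σ p : Plane → ℝ}

/-- The remaining connection coefficient is q = (σ_u + βp)/α and the curvature term is p_v − q_u.
Both are free of the parameter, so the same pair serves the parametrised problem and each of its
slices. -/
theorem IsCoframe.exists_solution (C : IsCoframe α β σ p) : ∃ q κ : Series3,
    rs 2 q = q ∧ rs 2 κ = κ ∧ ∀ e m : Series3, ev₀ e ≠ 0 → rs 1 e = e → rs 1 m = m →
      ∃ a b c d i X, IsSeriesSolution (hat α) (hat β) (hat σ) (hat p) q κ e m a b c d i X := by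
  have hα : ev₀ (hat α) ≠ 0 := by rw [ev₀_hat C.analytic_α]; exact C.pos.ne'
  obtain ⟨αi, hαi⟩ := exists_mul_eq_one hα
  have rα := rs_two_hat C.analytic_α
  have rβ := rs_two_hat C.analytic_β
  have rσ := rs_two_hat C.analytic_σ
  have rp := rs_two_hat C.analytic_p
  have h02 : (0 : Fin 3) ≠ 2 := by decide
  have h12 : (1 : Fin 3) ≠ 2 := by decide
  have ri : rs 2 αi = αi := by
    have h1 := congrArg (rs 2) hαi
    rw [map_mul, map_one, rα] at h1
    linear_combination αi * h1 - rs 2 αi * hαi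
  have rq : rs 2 (αi * (D 0 (hat σ) + hat β * hat p)) = αi * (D 0 (hat σ) + hat β * hat p) := by
    simp only [map_mul, map_add, ri, rs_D h02, rσ, rβ, rp]
  refine ⟨αi * (D 0 (hat σ) + hat β * hat p), _, rq, ?_,
    fun e m he hre hrm => exists_isSeriesSolution hα he ?_ ?_ rfl hre hrm⟩
  · rw [map_sub, rs_D h12, rs_D h02, rp, rq]
  · rw [D_zero_hat C.analytic_β, D_one_hat C.analytic_α, ← hat_sub (analyticAt_pd 0 C.analytic_β)
      (analyticAt_pd 1 C.analytic_α), ← hat_mul C.analytic_p C.analytic_σ]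
    exact hat_congr (C.analytic_p.mul C.analytic_σ) C.eq.symm
  · linear_combination -(D 0 (hat σ) + hat β * hat p) * hαi

theorem pd_zero_zero_vec (Y : Fin 3 → Series3) :
    pd 0 (pd 0 (vec Y)) =ᶠ[𝓝 0] vec fun k => D 0 (D 0 (Y k)) :=
  (pd_congr 0 (pd_zero_vec Y)).trans (pd_zero_vec _)

theorem pd_zero_zero_zero_vec (Y : Fin 3 → Series3) :
    pd 0 (pd 0 (pd 0 (vec Y))) =ᶠ[𝓝 0] vec fun k => D 0 (D 0 (D 0 (Y k))) :=
  (pd_congr 0 (pd_zero_zero_vec Y)).trans (pd_zero_vec _)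

theorem IsFrameSolution.isSurface (C : IsCoframe α β σ p) {q κ e m a b c d i : Series3}
    {X : Fin 3 → Fin 4 → Series3}
    (h : IsSeriesSolution (hat α) (hat β) (hat σ) (hat p) q κ e m a b c d i X) {w μ : ℝ → ℝ}
    (he : ∀ᶠ t in 𝓝 0, fn e (axis t) = Real.exp (w t))
    (hm : ∀ᶠ t in 𝓝 0, fn m (axis t) = μ t) :
    IsSurface α β σ w μ (vec fun k => X k 3) (vec fun k => X k 2) := by
  obtain ⟨⟨f00, f01, f11⟩, n0, n1⟩ := h.fundamental
  have key : ∀ x : Series3, ∀ (Y Z : Fin 3 → Series3), dot Y Z = x →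
      ∀ᶠ y in 𝓝 0, inner ℝ (vec Y y) (vec Z y) = fn x y := by
    intro x Y Z hx
    rw [← hx]
    exact (fn_dot Y Z).symm
  have hα := fn_hat C.analytic_α
  have hβ := fn_hat C.analytic_β
  have hσ := fn_hat C.analytic_σ
  have p0 := pd_zero_vec fun k => X k 3
  have p1 := pd_one_vec fun k => X k 3
  have p00 := pd_zero_zero_vec fun k => X k 3
  have p000 := pd_zero_zero_zero_vec fun k => X k 3
  obtain ⟨ht1, ht2⟩ := h.torsion _ rfl
  have hcross : ∀ᶠ t in 𝓝 0, ‖cross (pd 0 (vec fun k => X k 3) (axis t))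
      (pd 0 (pd 0 (vec fun k => X k 3)) (axis t))‖ ^ 2
      = fn (rs 1 (dot (fun k => D 0 (X k 3)) (fun k => D 0 (X k 3))
          * dot (fun k => D 0 (D 0 (X k 3))) (fun k => D 0 (D 0 (X k 3)))
        - dot (fun k => D 0 (X k 3)) (fun k => D 0 (D 0 (X k 3))) ^ 2)) (axis t) := by
    simp only [pow_two (dot _ _)]
    filter_upwards [tendsto_axis.eventually p0, tendsto_axis.eventually p00,
      tendsto_axis.eventually (fn_dot (fun k => D 0 (X k 3)) (fun k => D 0 (X k 3))),
      tendsto_axis.eventually (fn_dot (fun k => D 0 (D 0 (X k 3))) (fun k => D 0 (D 0 (X k 3)))),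
      tendsto_axis.eventually (fn_dot (fun k => D 0 (X k 3)) (fun k => D 0 (D 0 (X k 3)))),
      tendsto_axis.eventually (fn_sub _ _), tendsto_axis.eventually (fn_mul _ _),
      tendsto_axis.eventually (fn_mul _ _)] with t h1 h2 h3 h4 h5 h6 h7 h8
    rw [norm_cross_sq, fn_rs_one_axis, h1, h2, ← h3, ← h4, ← h5, h6, h7, h8, pow_two]
  refine
    { analytic := analyticAt_vec _
      analytic_normal := analyticAt_vec _
      form₀₀ := ?_
      form₀₁ := ?_
      form₁₁ := ?_
      unit := ?_
      normal₀ := ?_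
      normal₁ := ?_
      curvature := ?_
      cross_pos := ?_
      torsion := ?_ }
  · filter_upwards [p0, key _ (fun k => D 0 (X k 3)) (fun k => D 0 (X k 3)) f00, fn_mul (hat α) (hat α), hα] with y h1 h2 h3 h4
    rw [h1, h2, h3, h4]
  · filter_upwards [p0, p1, key _ (fun k => D 0 (X k 3)) (fun k => D 1 (X k 3)) f01, fn_mul (hat α) (hat β), hα, hβ] with y h1 h1' h2 h3 h4 h5
    rw [h1, h1', h2, h3, h4, h5]
  · filter_upwards [p1, key _ (fun k => D 1 (X k 3)) (fun k => D 1 (X k 3)) f11, fn_add _ _, fn_mul (hat β) (hat β),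
      fn_mul (hat σ) (hat σ), hβ, hσ] with y h1 h2 h3 h4 h5 h6 h7
    rw [h1, h2, h3, h4, h5, h6, h7]
  · filter_upwards [key _ (fun k => X k 2) (fun k => X k 2) h.orthonormal.1.2.2] with y h1
    rw [h1, fn_one]
  · filter_upwards [p0, key _ (fun k => D 0 (X k 3)) (fun k => X k 2) n0] with y h1 h2
    rw [h1, h2, fn_zero]
  · filter_upwards [p1, key _ (fun k => D 1 (X k 3)) (fun k => X k 2) n1] with y h1 h2
    rw [h1, h2, fn_zero]
  · have h3 : rs 1 (dot (fun k => D 0 (D 0 (X k 3))) (fun k => X k 2))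
      = rs 1 (hat α) * rs 1 (hat α) * e := h.normal_curvature
    have h4 : fnGerm (rs 1 (hat α) * rs 1 (hat α) * e)
        = fnGerm (rs 1 (hat α)) * fnGerm (rs 1 (hat α)) * fnGerm e := by simp only [map_mul]
    have h5 := fn_dot (fun k => D 0 (D 0 (X k 3))) fun k => X k 2
    filter_upwards [tendsto_axis.eventually p00, tendsto_axis.eventually h5,
      tendsto_axis.eventually (Germ.coe_eq.1 h4),
      tendsto_axis.eventually hα, he] with t h1 h2 h4 h6 h7
    rw [h1, ← h2, ← fn_rs_one_axis, h3, h4]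
    show fn (rs 1 (hat α)) (axis t) * fn (rs 1 (hat α)) (axis t) * fn e (axis t) = _
    rw [fn_rs_one_axis, h6, h7]
  -- On the axis |f_u × f_uu|² = α⁴(p² + (αe)²), which is positive because α and e are: the image
  -- curve has non-vanishing curvature and its torsion is defined.
  · have h3 : rs 1 (dot (fun k => D 0 (X k 3)) (fun k => D 0 (X k 3))
          * dot (fun k => D 0 (D 0 (X k 3))) (fun k => D 0 (D 0 (X k 3)))
        - dot (fun k => D 0 (X k 3)) (fun k => D 0 (D 0 (X k 3))) ^ 2)
      = rs 1 (hat α * hat α * hat α * hat α) * (rs 1 (hat p) * rs 1 (hat p)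
        + (rs 1 (hat α) * e) * (rs 1 (hat α) * e)) := by
      rw [← h.a_init]
      refine Eq.trans ht2 ?_
      simp only [map_mul]
      ring
    have h8 : ∀ᶠ t in 𝓝 0, 0 < α (axis t) :=
      tendsto_axis.eventually (C.analytic_α.continuousAt.eventually (lt_mem_nhds C.pos))
    have h4 : fnGerm (rs 1 (hat α * hat α * hat α * hat α) * (rs 1 (hat p) * rs 1 (hat p)
        + (rs 1 (hat α) * e) * (rs 1 (hat α) * e)))
      = fnGerm (rs 1 (hat α)) * fnGerm (rs 1 (hat α)) * fnGerm (rs 1 (hat α))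
        * fnGerm (rs 1 (hat α)) * (fnGerm (rs 1 (hat p)) * fnGerm (rs 1 (hat p))
        + (fnGerm (rs 1 (hat α)) * fnGerm e) * (fnGerm (rs 1 (hat α)) * fnGerm e)) := by
      simp only [map_mul, map_add]
    filter_upwards [hcross, tendsto_axis.eventually (Germ.coe_eq.1 h4),
      tendsto_axis.eventually hα, he, h8] with t h1 h2 h12 h13 h14
    rw [h1, h3, h2]
    show 0 < fn (rs 1 (hat α)) (axis t) * fn (rs 1 (hat α)) (axis t) * fn (rs 1 (hat α)) (axis t)
      * fn (rs 1 (hat α)) (axis t) * (fn (rs 1 (hat p)) (axis t) * fn (rs 1 (hat p)) (axis t)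
        + (fn (rs 1 (hat α)) (axis t) * fn e (axis t))
          * (fn (rs 1 (hat α)) (axis t) * fn e (axis t)))
    rw [fn_rs_one_axis, fn_rs_one_axis, h12, h13]
    have := Real.exp_pos (w t)
    have h15 := mul_self_nonneg (fn (hat p) (axis t))
    positivity
  · have h3 : rs 1 (triple (fun k => D 0 (X k 3)) (fun k => D 0 (D 0 (X k 3)))
        (fun k => D 0 (D 0 (D 0 (X k 3)))))
      = m * rs 1 (dot (fun k => D 0 (X k 3)) (fun k => D 0 (X k 3))
          * dot (fun k => D 0 (D 0 (X k 3))) (fun k => D 0 (D 0 (X k 3)))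
        - dot (fun k => D 0 (X k 3)) (fun k => D 0 (D 0 (X k 3))) ^ 2) :=
      Eq.trans ht1 (congrArg (m * ·) ht2).symm
    filter_upwards [hcross, tendsto_axis.eventually p0, tendsto_axis.eventually p00,
      tendsto_axis.eventually p000, tendsto_axis.eventually (fn_triple _ _ _),
      tendsto_axis.eventually (fn_mul _ _), hm] with t h1 h2 h4 h5 h6 h7 h8
    rw [h1, h2, h4, h5, ← h6, ← fn_rs_one_axis, h3, h7, h8]

end FormalGerm

/-! ### Families of surfaces depending on a parameter -/

namespace FormalGerm

open Kossowski (Plane Space pd det3 cross)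

variable {α β σ p : Plane → ℝ}

theorem IsSurface.congr {w μ : ℝ → ℝ} {f f' ν : Plane → Space} (h : IsSurface α β σ w μ f ν)
    (e : f' =ᶠ[𝓝 0] f) : IsSurface α β σ w μ f' ν := by
  have e0 := pd_congr 0 e
  have e1 := pd_congr 1 e
  have e00 := tendsto_axis.eventually (pd_congr 0 e0)
  have e000 := tendsto_axis.eventually (pd_congr 0 (pd_congr 0 e0))
  have a0 := tendsto_axis.eventually e0
  exact
    { analytic := h.analytic.congr e.symm
      analytic_normal := h.analytic_normal
      form₀₀ := by filter_upwards [e0, h.form₀₀] with y h0 h1 using by rw [h0, h1]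
      form₀₁ := by filter_upwards [e0, e1, h.form₀₁] with y h0 h2 h1 using by rw [h0, h2, h1]
      form₁₁ := by filter_upwards [e1, h.form₁₁] with y h0 h1 using by rw [h0, h1]
      unit := h.unit
      normal₀ := by filter_upwards [e0, h.normal₀] with y h0 h1 using by rw [h0, h1]
      normal₁ := by filter_upwards [e1, h.normal₁] with y h0 h1 using by rw [h0, h1]
      curvature := by filter_upwards [e00, h.curvature] with t h0 h1 using by rw [h0, h1]
      cross_pos := by filter_upwards [a0, e00, h.cross_pos] with t h0 h2 h1 using by rwa [h0, h2]
      torsion := by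
        filter_upwards [a0, e00, e000, h.torsion] with t h0 h2 h3 h1 using by rw [h0, h2, h3, h1] }

theorem rs_ofFun {i : Fin 3} {h : (Fin 3 → ℝ) → ℝ} (hh : AnalyticAt ℝ h 0)
    (hi : ∀ x, h (Function.update x i 0) = h x) : rs i (ofFun h) = ofFun h := by
  have hu : Tendsto (fun x : Fin 3 → ℝ => Function.update x i 0) (𝓝 0) (𝓝 0) := by
    have hc : Continuous fun x : Fin 3 → ℝ => Function.update x i 0 :=
      continuous_id.update i continuous_const
    have := hc.tendsto 0
    rwa [show Function.update (0 : Fin 3 → ℝ) i 0 = 0 from Function.update_eq_self i _] at this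
  refine ev_injective ?_
  filter_upwards [hu.eventually (ev_ofFun hh), ev_ofFun hh] with x h1 h2
  rw [ev_rs, h1, h2, hi]

/-- The power series of a function of the parameter and the first coordinate. -/
noncomputable def paramSeries (H : ℝ → ℝ → ℝ) (s₀ : ℝ) : Series3 :=
  ofFun fun x => H (s₀ + x 2) (x 0)

/-- The power series of a function of the first coordinate. -/
noncomputable def curveSeries (h : ℝ → ℝ) : Series3 := ofFun fun x => h (x 0)

theorem analyticAt_proj (k : Fin 3) (x : Fin 3 → ℝ) : AnalyticAt ℝ (fun x : Fin 3 → ℝ => x k) x :=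
  (ContinuousLinearMap.proj (R := ℝ) (φ := fun _ : Fin 3 => ℝ) k).analyticAt x

theorem analyticAt_param {H : ℝ → ℝ → ℝ} {s₀ : ℝ}
    (hH : AnalyticAt ℝ (fun z : ℝ × ℝ => H z.1 z.2) (s₀, 0)) :
    AnalyticAt ℝ (fun x : Fin 3 → ℝ => H (s₀ + x 2) (x 0)) 0 :=
  AnalyticAt.comp (g := fun z : ℝ × ℝ => H z.1 z.2) (f := fun x : Fin 3 → ℝ => (s₀ + x 2, x 0))
    (by simpa using hH) ((analyticAt_const.add (analyticAt_proj 2 0)).prod (analyticAt_proj 0 0))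

theorem analyticAt_curve {h : ℝ → ℝ} (hh : AnalyticAt ℝ h 0) :
    AnalyticAt ℝ (fun x : Fin 3 → ℝ => h (x 0)) 0 :=
  AnalyticAt.comp (g := h) (f := fun x : Fin 3 → ℝ => x 0) (by simpa using hh)
    (analyticAt_proj 0 0)

theorem rs_one_paramSeries {H : ℝ → ℝ → ℝ} {s₀ : ℝ}
    (hH : AnalyticAt ℝ (fun z : ℝ × ℝ => H z.1 z.2) (s₀, 0)) :
    rs 1 (paramSeries H s₀) = paramSeries H s₀ :=
  rs_ofFun (analyticAt_param hH) fun x => by simp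

theorem rs_one_curveSeries {h : ℝ → ℝ} (hh : AnalyticAt ℝ h 0) :
    rs 1 (curveSeries h) = curveSeries h :=
  rs_ofFun (analyticAt_curve hh) fun x => by simp

theorem ev₀_paramSeries {H : ℝ → ℝ → ℝ} {s₀ : ℝ}
    (hH : AnalyticAt ℝ (fun z : ℝ × ℝ => H z.1 z.2) (s₀, 0)) :
    ev₀ (paramSeries H s₀) = H s₀ 0 := by
  rw [ev₀_eq, paramSeries, (ev_ofFun (analyticAt_param hH)).self_of_nhds]
  simp

theorem ev₀_curveSeries {h : ℝ → ℝ} (hh : AnalyticAt ℝ h 0) : ev₀ (curveSeries h) = h 0 := by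
  rw [ev₀_eq, curveSeries, (ev_ofFun (analyticAt_curve hh)).self_of_nhds]
  simp

theorem fn_curveSeries {h : ℝ → ℝ} (hh : AnalyticAt ℝ h 0) :
    ∀ᶠ t in 𝓝 0, fn (curveSeries h) (axis t) = h t := by
  filter_upwards [tendsto_axis.eventually
    (tendsto_ofPlane.eventually (ev_ofFun (analyticAt_curve hh)))] with t ht
  rw [fn, curveSeries, ht]
  simp [ofPlane_apply, axis_zero_coord]

theorem slice_paramSeries {H : ℝ → ℝ → ℝ} {s₀ : ℝ}
    (hH : AnalyticAt ℝ (fun z : ℝ × ℝ => H z.1 z.2) (s₀, 0)) :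
    ∀ᶠ δ in 𝓝 0, slice 2 δ (paramSeries H s₀) = curveSeries fun t => H (s₀ + δ) t := by
  filter_upwards [ev_slice 2 (paramSeries H s₀),
    eventually_slice 2 (ev_ofFun (analyticAt_param hH))] with δ h1 h2
  refine (ofFun_eq (h1.trans ?_)).symm
  filter_upwards [h2] with x hx
  rw [paramSeries, hx]
  simp

/-- A family of surfaces with a given first fundamental form, such that the normal curvature and
the torsion of the image of the first coordinate axis are given families of functions. -/
theorem IsCoframe.exists_surface_family (C : IsCoframe α β σ p) {I : Set ℝ} (w μ : ℝ → ℝ → ℝ)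
    (hw : ∀ s ∈ I, AnalyticWithinAt ℝ (fun z : ℝ × ℝ => w z.1 z.2) (I ×ˢ univ) (s, 0))
    (hμ : ∀ s ∈ I, AnalyticWithinAt ℝ (fun z : ℝ × ℝ => μ z.1 z.2) (I ×ˢ univ) (s, 0)) :
    ∃ f : ℝ → Plane → Space,
      (∀ s ∈ I, AnalyticWithinAt ℝ (fun z : ℝ × Plane => f z.1 z.2) (I ×ˢ univ) (s, 0)) ∧
      ∀ s ∈ I, ∃ ν, IsSurface α β σ (w s) (μ s) (f s) ν := by
  -- Relative analyticity yields an ordinary analytic extension across an end point of I, agreeing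
  -- with the data for all s in I. Outside I its values do not matter.
  have ext : ∀ v : ℝ → ℝ → ℝ,
      (∀ s ∈ I, AnalyticWithinAt ℝ (fun z : ℝ × ℝ => v z.1 z.2) (I ×ˢ univ) (s, 0)) →
      ∀ s₀, ∃ H : ℝ → ℝ → ℝ, s₀ ∈ I → AnalyticAt ℝ (fun z : ℝ × ℝ => H z.1 z.2) (s₀, 0) ∧
        ∀ s ∈ I, H s = v s := by
    intro v hv s₀
    by_cases hs : s₀ ∈ I
    · obtain ⟨H, -, h1, h2⟩ := (hv s₀ hs).exists_analyticAt
      refine ⟨fun s t => H (s, t), fun _ => ⟨h2, fun s hs' => funext fun t => ?_⟩⟩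
      exact (h1 (mem_insert_of_mem _ ⟨hs', mem_univ t⟩)).symm
    · exact ⟨0, fun h => absurd h hs⟩
  have slice_an : ∀ (H : ℝ → ℝ → ℝ) (s : ℝ),
      AnalyticAt ℝ (fun z : ℝ × ℝ => H z.1 z.2) (s, 0) → AnalyticAt ℝ (H s) 0 := fun H s h =>
    AnalyticAt.comp (g := fun z : ℝ × ℝ => H z.1 z.2) (f := fun t => (s, t)) h
      (analyticAt_const.prod analyticAt_id)
  -- The function e^ω itself is extended; only its non-vanishing at (s₀, 0) is needed to solve the
  -- parametrised problem.
  choose W hW using ext (fun s t => Real.exp (w s t)) fun s hs =>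
    AnalyticWithinAt.rexp (hw s hs)
  choose N hN using ext μ hμ
  have Wan : ∀ s ∈ I, AnalyticAt ℝ (fun t => Real.exp (w s t)) 0 := fun s hs => by
    have := slice_an _ _ (hW s hs).1
    rwa [(hW s hs).2 s hs] at this
  have Nan : ∀ s ∈ I, AnalyticAt ℝ (μ s) 0 := fun s hs => by
    have := slice_an _ _ (hN s hs).1
    rwa [(hN s hs).2 s hs] at this
  obtain ⟨q, κ, hq, hκ, solve⟩ := C.exists_solution
  have hα : ev₀ (hat α) ≠ 0 := by rw [ev₀_hat C.analytic_α]; exact C.pos.ne'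
  have pointwise : ∀ s, ∃ Y : Fin 3 → Fin 4 → Series3, s ∈ I → ∃ a b c d i,
      IsSeriesSolution (hat α) (hat β) (hat σ) (hat p) q κ
        (curveSeries fun t => Real.exp (w s t)) (curveSeries (μ s)) a b c d i Y := by
    intro s
    by_cases hs : s ∈ I
    · obtain ⟨a, b, c, d, i, Y, h⟩ := solve _ (curveSeries (μ s))
        (by rw [ev₀_curveSeries (Wan s hs)]; exact (Real.exp_pos _).ne')
        (rs_one_curveSeries (Wan s hs)) (rs_one_curveSeries (Nan s hs))
      exact ⟨Y, fun _ => ⟨a, b, c, d, i, h⟩⟩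
    · exact ⟨0, fun h => absurd h hs⟩
  choose Y hY using pointwise
  have local_family : ∀ s₀, ∃ X : Fin 3 → Fin 4 → Series3, s₀ ∈ I → ∃ a b c d i,
      IsSeriesSolution (hat α) (hat β) (hat σ) (hat p) q κ
        (paramSeries (W s₀) s₀) (paramSeries (N s₀) s₀) a b c d i X := by
    intro s
    by_cases hs : s ∈ I
    · obtain ⟨a, b, c, d, i, Y, h⟩ := solve _ (paramSeries (N s) s)
        (by
          rw [ev₀_paramSeries (hW s hs).1, (hW s hs).2 s hs]
          exact (Real.exp_pos _).ne')
        (rs_one_paramSeries (hW s hs).1) (rs_one_paramSeries (hN s hs).1)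
      exact ⟨Y, fun _ => ⟨a, b, c, d, i, h⟩⟩
    · exact ⟨0, fun h => absurd h hs⟩
  choose X hX using local_family
  -- The slice at s − s₀ of the parametrised solution solves the problem for the fixed value s, so
  -- uniqueness identifies it with the pointwise solution.
  have hslice : ∀ s₀ ∈ I, ∀ᶠ s in 𝓝[I] s₀, ∀ k l, slice 2 (s - s₀) (X s₀ k l) = Y s k l := by
    intro s₀ hs₀
    obtain ⟨a, b, c, d, i, h⟩ := hX s₀ hs₀
    have h0 : Tendsto (fun s : ℝ => s - s₀) (𝓝[I] s₀) (𝓝 0) := by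
      have : Tendsto (fun s : ℝ => s - s₀) (𝓝 s₀) (𝓝 (s₀ - s₀)) :=
        (continuous_id.sub continuous_const).tendsto s₀
      rw [sub_self] at this
      exact this.mono_left nhdsWithin_le_nhds
    filter_upwards [h0.eventually h.slice, h0.eventually (slice_paramSeries (hW s₀ hs₀).1),
      h0.eventually (slice_paramSeries (hN s₀ hs₀).1), self_mem_nhdsWithin] with s h1 h2 h3 hs k l
    rw [add_sub_cancel, (hW s₀ hs₀).2 s hs] at h2
    rw [add_sub_cancel, (hN s₀ hs₀).2 s hs] at h3
    rw [h2, h3, rs_two_slice (rs_two_hat C.analytic_α), rs_two_slice (rs_two_hat C.analytic_β),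
      rs_two_slice (rs_two_hat C.analytic_σ), rs_two_slice (rs_two_hat C.analytic_p),
      rs_two_slice hq, rs_two_slice hκ] at h1
    obtain ⟨a', b', c', d', i', h'⟩ := hY s hs
    have := IsFrameSolution.unique hα
      (by rw [ev₀_curveSeries (Wan s hs)]; exact (Real.exp_pos _).ne') h1 h'
    exact congrFun (congrFun this k) l
  let F : ℝ → ℝ × Plane → Space := fun s₀ z =>
    WithLp.toLp 2 fun k => ev (X s₀ k 3) (ofPlane z.2 + (z.1 - s₀) • Pi.single 2 1)
  have hF : ∀ s₀ ∈ I, AnalyticAt ℝ (F s₀) (s₀, 0) := by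
    intro s₀ _
    refine analyticAt_space fun k => ?_
    refine AnalyticAt.comp (g := ev (X s₀ k 3))
      (f := fun z : ℝ × Plane => ofPlane z.2 + (z.1 - s₀) • (Pi.single 2 1 : Fin 3 → ℝ)) ?_ ?_
    · simpa using analyticAt_ev (X s₀ k 3)
    · exact ((ofPlane.comp (ContinuousLinearMap.snd ℝ ℝ Plane)).analyticAt _).add
        ((analyticAt_fst.sub analyticAt_const).smul analyticAt_const)
  have hG : ∀ s₀ ∈ I, ∀ᶠ s in 𝓝[I] s₀, ∀ᶠ y in 𝓝 0, F s₀ (s, y) = vec (fun k => Y s k 3) y := by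
    intro s₀ hs₀
    have h0 : Tendsto (fun s : ℝ => s - s₀) (𝓝[I] s₀) (𝓝 0) := by
      have : Tendsto (fun s : ℝ => s - s₀) (𝓝 s₀) (𝓝 (s₀ - s₀)) :=
        (continuous_id.sub continuous_const).tendsto s₀
      rw [sub_self] at this
      exact this.mono_left nhdsWithin_le_nhds
    filter_upwards [hslice s₀ hs₀,
      h0.eventually (eventually_all.2 fun k => ev_slice 2 (X s₀ k 3))] with s h1 h2
    filter_upwards [tendsto_ofPlane.eventually (eventually_all.2 h2)] with y hy
    ext k
    show ev (X s₀ k 3) (ofPlane y + (s - s₀) • Pi.single 2 1) = ev (Y s k 3) (ofPlane y)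
    rw [← h1 k 3, hy k]
    congr 1
    ext l
    fin_cases l <;> simp [ofPlane_apply]
  obtain ⟨f, hf1, hf2⟩ := exists_glued_family (I := I) (fun s => vec fun k => Y s k 3) F hF hG
  refine ⟨f, hf1, fun s hs => ⟨vec fun k => Y s k 2, ?_⟩⟩
  obtain ⟨a, b, c, d, i, h⟩ := hY s hs
  exact (h.isSurface C (fn_curveSeries (Wan s hs)) (fn_curveSeries (Nan s hs))).congr (hf2 s hs)

end FormalGerm

/-! ### Analytic division, inverse functions and changes of charts -/

namespace FormalGerm

-- The formal quotient converges: its coefficients are the shifted coefficients of `a`, which are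
-- dominated by those of ∂ᵢa.
open MvPowerSeries in
theorem exists_eq_X_mul {σ : Type*} [Fintype σ] (i : σ) {a : ConvSeries σ} (h : rs i a = 0) :
    ∃ b : ConvSeries σ, a = ⟨X i, conv_X i⟩ * b := by
  classical
  obtain ⟨b, hb⟩ := X_dvd_of_restr_eq_zero (congrArg Subtype.val h)
  have hcoeff : ∀ n, coeff n b = coeff (n + Finsupp.single i 1) (a : MvPowerSeries σ ℝ) := by
    intro n
    rw [hb, mul_comm, X, add_comm]
    rw [add_comm, coeff_add_mul_monomial, mul_one]
  have hconv : Conv b := by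
    refine conv_of_enorm_coeff_le ((conv_coe a).pderiv i) fun n => ?_
    rw [coeff_pderiv, hcoeff]
    rw [norm_mul]
    have h1 : (1 : ℝ) ≤ ‖((n i : ℝ) + 1)‖ := by
      rw [Real.norm_eq_abs]
      refine le_trans ?_ (le_abs_self _)
      linarith [(Nat.cast_nonneg (n i) : (0 : ℝ) ≤ _)]
    nlinarith [norm_nonneg (coeff (n + Finsupp.single i 1) (a : MvPowerSeries σ ℝ))]
  exact ⟨⟨b, hconv⟩, Subtype.ext hb⟩

open Kossowski (Plane Space pd det3 cross)

/-- The analytic inverse function theorem. -/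
theorem exists_analytic_inverse {E : Type*} [NormedAddCommGroup E] [NormedSpace ℝ E]
    [FiniteDimensional ℝ E] {Φ : E → E} {x₀ : E} (hΦ : AnalyticAt ℝ Φ x₀)
    (hinj : ∀ v, fderiv ℝ Φ x₀ v = 0 → v = 0) :
    ∃ κ : OpenPartialHomeomorph E E, x₀ ∈ κ.source ∧ (∀ x, κ x = Φ x) ∧
      AnalyticOnNhd ℝ κ κ.source ∧ AnalyticOnNhd ℝ κ.symm κ.target := by
  have : CompleteSpace E := FiniteDimensional.complete ℝ E
  have hinj' : Function.Injective (fderiv ℝ Φ x₀ : E →ₗ[ℝ] E) :=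
    (injective_iff_map_eq_zero _).2 hinj
  let L : E ≃L[ℝ] E := (LinearEquiv.ofInjectiveEndo _ hinj').toContinuousLinearEquiv
  have hL : HasFDerivAt Φ (L : E →L[ℝ] E) x₀ := by
    have : (L : E →L[ℝ] E) = fderiv ℝ Φ x₀ := by ext v; rfl
    rw [this]
    exact hΦ.differentiableAt.hasFDerivAt
  have hc : ContDiffAt ℝ ω Φ x₀ := hΦ.contDiffAt
  let κ := hc.toOpenPartialHomeomorph Φ hL (by simp)
  have hκ : ∀ x, κ x = Φ x := fun x => rfl
  have h0 : x₀ ∈ κ.source := hc.mem_toOpenPartialHomeomorph_source hL (by simp)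
  have hsymm : AnalyticAt ℝ κ.symm (Φ x₀) := by
    have h1 : Φ x₀ ∈ κ.target := hc.image_mem_toOpenPartialHomeomorph_target hL (by simp)
    have h2 : κ.symm (Φ x₀) = x₀ := κ.left_inv h0
    have := κ.contDiffAt_symm (f₀' := L) (n := ω) h1 (by rw [h2]; exact hL) (by rw [h2]; exact hc)
    exact this.analyticAt
  -- Shrink first the source and then the target to the open sets where the map and its inverse are
  -- analytic, as membership in the analytic atlas requires this on the whole domain.
  let κ₁ := κ.restrOpen {x | AnalyticAt ℝ Φ x} (isOpen_analyticAt ℝ Φ)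
  let κ₂ := (κ₁.symm.restrOpen {x | AnalyticAt ℝ κ.symm x} (isOpen_analyticAt ℝ κ.symm)).symm
  refine ⟨κ₂, ?_, fun x => rfl, fun x hx => ?_, fun x hx => ?_⟩
  · simp only [κ₂, κ₁, mfld_simps]
    exact ⟨⟨h0, hΦ⟩, hsymm⟩
  · simp only [κ₂, κ₁, mfld_simps] at hx
    exact hx.1.2
  · simp only [κ₂, κ₁, mfld_simps] at hx
    exact hx.2

theorem plane_ext_single (v : Plane) :
    v = v 0 • EuclideanSpace.single 0 1 + v 1 • EuclideanSpace.single 1 1 := by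
  ext k; fin_cases k <;> simp

theorem fderiv_plane {E : Type*} [NormedAddCommGroup E] [NormedSpace ℝ E] (h : Plane → E)
    (x v : Plane) : fderiv ℝ h x v = v 0 • pd 0 h x + v 1 • pd 1 h x := by
  conv_lhs => rw [plane_ext_single v]
  rw [map_add, map_smul, map_smul]
  rfl

/-- An analytic function which vanishes where the first coordinate does is a multiple of it. -/
theorem exists_eq_coord_mul {h : Plane → ℝ} (hh : AnalyticAt ℝ h 0)
    (h0 : ∀ᶠ y in 𝓝 (0 : Plane), y 0 = 0 → h y = 0) :
    ∃ k : Plane → ℝ, AnalyticAt ℝ k 0 ∧ ∀ᶠ y in 𝓝 (0 : Plane), h y = y 0 * k y := by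
  have h1 : rs 0 (hat h) = 0 := by
    have hu : Tendsto (fun x : Fin 3 → ℝ => Function.update x 0 0) (𝓝 0) (𝓝 0) := by
      have hc : Continuous fun x : Fin 3 → ℝ => Function.update x 0 0 :=
        continuous_id.update 0 continuous_const
      have := hc.tendsto 0
      rwa [show Function.update (0 : Fin 3 → ℝ) 0 0 = 0 from Function.update_eq_self 0 _] at this
    refine ev_injective ?_
    filter_upwards [hu.eventually (ev_hat hh), hu.eventually (tendsto_toPlane.eventually h0)]
      with x h2 h3
    rw [ev_rs, h2, h3 (by simp [toPlane_apply]), ev_zero]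
  obtain ⟨b, hb⟩ := exists_eq_X_mul 0 h1
  refine ⟨fn b, analyticAt_fn b, ?_⟩
  filter_upwards [fn_hat hh, fn_mul ⟨MvPowerSeries.X 0, conv_X 0⟩ b] with y h2 h3
  rw [← h2, hb, h3]
  congr 1
  show evalS (MvPowerSeries.X 0) (ofPlane y) = y 0
  rw [evalS_X]
  rfl

/-- An analytic function which vanishes where another one does is a multiple of it, if the
differential of the latter does not vanish. -/
theorem exists_eq_mul_of_vanishing {lam h : Plane → ℝ} (hlam : AnalyticAt ℝ lam 0)
    (hh : AnalyticAt ℝ h 0) (hlam0 : lam 0 = 0) (hd : fderiv ℝ lam 0 ≠ 0)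
    (h0 : ∀ᶠ y in 𝓝 (0 : Plane), lam y = 0 → h y = 0) :
    ∃ k : Plane → ℝ, AnalyticAt ℝ k 0 ∧ ∀ᶠ y in 𝓝 (0 : Plane), h y = k y * lam y := by
  -- A linear coordinate l completing dλ to a basis. The map (λ, l) is then a local analytic
  -- diffeomorphism, which reduces the claim to division by the first coordinate.
  obtain ⟨l, hl⟩ : ∃ l : Plane →L[ℝ] ℝ, ∀ v, fderiv ℝ lam 0 v = 0 → l v = 0 → v = 0 := by
    by_cases h1 : pd 0 lam 0 = 0
    · refine ⟨EuclideanSpace.proj 0, fun v hv hv' => ?_⟩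
      have h2 : pd 1 lam 0 ≠ 0 := by
        intro h2
        refine hd (ContinuousLinearMap.ext fun v => ?_)
        rw [fderiv_plane, h1, h2]; simp
      rw [fderiv_plane, h1, smul_zero, zero_add, smul_eq_mul] at hv
      have h3 : v 0 = 0 := hv'
      have h4 : v 1 = 0 := (mul_eq_zero.1 hv).resolve_right h2
      rw [plane_ext_single v, h3, h4]; simp
    · refine ⟨EuclideanSpace.proj 1, fun v hv hv' => ?_⟩
      have h3 : v 1 = 0 := hv'
      rw [fderiv_plane, h3, zero_smul, add_zero, smul_eq_mul] at hv
      have h4 : v 0 = 0 := (mul_eq_zero.1 hv).resolve_right h1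
      rw [plane_ext_single v, h3, h4]; simp
  let Ψ : Plane → Plane := fun y => lam y • EuclideanSpace.single 0 1 + l y • EuclideanSpace.single 1 1
  have hΨ : AnalyticAt ℝ Ψ 0 :=
    (hlam.smul analyticAt_const).add ((l.analyticAt 0).smul analyticAt_const)
  have hdΨ : HasFDerivAt Ψ ((fderiv ℝ lam 0).smulRight (EuclideanSpace.single 0 1)
      + l.smulRight (EuclideanSpace.single 1 1)) 0 :=
    (hlam.differentiableAt.hasFDerivAt.smul_const _).add (l.hasFDerivAt.smul_const _)
  obtain ⟨κ, hκ0, hκ, hκ1, hκ2⟩ := exists_analytic_inverse hΨ (by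
    intro v hv
    rw [hdΨ.fderiv] at hv
    have e0 := congrArg (fun z : Plane => z 0) hv
    have e1 := congrArg (fun z : Plane => z 1) hv
    simp at e0 e1
    exact hl v e0 e1)
  have hΨ0 : Ψ 0 = 0 := by simp [Ψ, hlam0]
  have h00 : (0 : Plane) ∈ κ.target := by
    have := κ.map_source hκ0
    rwa [hκ, hΨ0] at this
  have hs0 : κ.symm 0 = 0 := by
    have := κ.left_inv hκ0
    rwa [hκ, hΨ0] at this
  have hsan : AnalyticAt ℝ κ.symm 0 := hκ2 0 h00
  have hst : Tendsto κ.symm (𝓝 0) (𝓝 0) := by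
    have := hsan.continuousAt.tendsto
    rwa [hs0] at this
  obtain ⟨k, hk, hk'⟩ := exists_eq_coord_mul (h := fun y => h (κ.symm y))
    (AnalyticAt.comp (g := h) (by rwa [hs0]) hsan) (by
      filter_upwards [hst.eventually h0, κ.open_target.mem_nhds h00] with y h1 h2 h3
      refine h1 ?_
      have h4 : Ψ (κ.symm y) = y := by rw [← hκ]; exact κ.right_inv h2
      have h5 := congrArg (fun z : Plane => z 0) h4
      simp [Ψ] at h5
      rw [h5, h3])
  have hΨt : Tendsto Ψ (𝓝 0) (𝓝 0) := by
    have := hΨ.continuousAt.tendsto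
    rwa [hΨ0] at this
  refine ⟨fun y => k (Ψ y), AnalyticAt.comp (g := k) (by rwa [hΨ0]) hΨ, ?_⟩
  filter_upwards [hΨt.eventually hk', κ.open_source.mem_nhds hκ0] with y h1 h2
  rw [← hκ, κ.left_inv h2, hκ] at h1
  rw [h1, mul_comm]
  simp [Ψ]

section Charts

variable {M : Type*} [TopologicalSpace M] [ChartedSpace Plane M] [IsManifold (𝓡 2) ω M]

theorem trans_mem_maximalAtlas {e : OpenPartialHomeomorph M Plane}
    (he : e ∈ IsManifold.maximalAtlas (𝓡 2) ω M) {κ : OpenPartialHomeomorph Plane Plane}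
    (h1 : AnalyticOnNhd ℝ κ κ.source) (h2 : AnalyticOnNhd ℝ κ.symm κ.target) :
    e.trans κ ∈ IsManifold.maximalAtlas (𝓡 2) ω M := by
  have h1' : ContMDiffOn (𝓡 2) (𝓡 2) ω κ κ.source :=
    contMDiffOn_iff_contDiffOn.2 fun x hx => (h1 x hx).contDiffAt.contDiffWithinAt
  have h2' : ContMDiffOn (𝓡 2) (𝓡 2) ω κ.symm κ.target :=
    contMDiffOn_iff_contDiffOn.2 fun x hx => (h2 x hx).contDiffAt.contDiffWithinAt
  have h3 := contMDiffOn_of_mem_maximalAtlas he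
  have h4 := contMDiffOn_symm_of_mem_maximalAtlas he
  refine OpenPartialHomeomorph.mem_maximalAtlas_of_contMDiffOn _ ?_ ?_
  · rw [OpenPartialHomeomorph.trans_source]
    exact h1'.comp (h3.mono inter_subset_left) inter_subset_right
  · rw [OpenPartialHomeomorph.trans_target]
    exact h4.comp (h2'.mono inter_subset_left) inter_subset_right

end Charts

end FormalGerm

namespace FormalGerm

open Kossowski

/-! ### The metric in a chart -/

section Charts

variable {M : Type*} [TopologicalSpace M] [ChartedSpace Plane M] [IsManifold (𝓡 2) ω M]
  {g : BilinField M} {φ : OpenPartialHomeomorph M Plane}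

theorem mdifferentiable_of_mem_maximalAtlas (hφ : φ ∈ IsManifold.maximalAtlas (𝓡 2) ω M) :
    φ.MDifferentiable (𝓡 2) (𝓡 2) :=
  ⟨(contMDiffOn_of_mem_maximalAtlas hφ).mdifferentiableOn (by simp),
    (contMDiffOn_symm_of_mem_maximalAtlas hφ).mdifferentiableOn (by simp)⟩

/-- The differential of the inverse of a coordinate system. -/
noncomputable def coordMap (φ : OpenPartialHomeomorph M Plane) (x : Plane) :
    Plane →L[ℝ] TangentSpace (𝓡 2) (φ.symm x) :=
  mfderiv (𝓡 2) (𝓡 2) φ.symm x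

theorem coordVec_eq (φ : OpenPartialHomeomorph M Plane) (i : Fin 2) (x : Plane) :
    coordVec φ i x = coordMap φ x (EuclideanSpace.single i 1) := rfl

theorem coordMap_apply (φ : OpenPartialHomeomorph M Plane) (x a : Plane) :
    coordMap φ x a = a 0 • coordVec φ 0 x + a 1 • coordVec φ 1 x := by
  rw [coordVec_eq, coordVec_eq, ← map_smul, ← map_smul, ← map_add, ← plane_ext_single]

theorem coordMap_injective (hφ : φ ∈ IsManifold.maximalAtlas (𝓡 2) ω M) {x : Plane}
    (hx : x ∈ φ.target) {a : Plane} (ha : coordMap φ x a = 0) : a = 0 := by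
  have h := (mdifferentiable_of_mem_maximalAtlas hφ).comp_symm_deriv hx
  have h1 := DFunLike.congr_fun h a
  have h2 : mfderiv (𝓡 2) (𝓡 2) φ (φ.symm x) (coordMap φ x a) = a := h1
  rw [ha, map_zero] at h2
  exact h2.symm

theorem coordMap_surjective (hφ : φ ∈ IsManifold.maximalAtlas (𝓡 2) ω M) {x : Plane}
    (hx : x ∈ φ.target) (v : TangentSpace (𝓡 2) (φ.symm x)) : ∃ a, coordMap φ x a = v := by
  have h := (mdifferentiable_of_mem_maximalAtlas hφ).symm_comp_deriv (φ.map_target hx)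
  rw [φ.right_inv hx] at h
  exact ⟨_, DFunLike.congr_fun h v⟩

theorem eventually_of_chart {p : M} (hp : p ∈ φ.source) {P : M → Prop}
    (h : ∀ᶠ x in 𝓝 (φ p), P (φ.symm x)) : ∀ᶠ q in 𝓝 p, P q := by
  filter_upwards [(φ.continuousAt hp).eventually h, φ.open_source.mem_nhds hp] with q h1 h2
  rwa [φ.left_inv h2] at h1

theorem eventually_in_chart {p : M} (hp : p ∈ φ.source) {P : M → Prop}
    (h : ∀ᶠ q in 𝓝 p, P q) : ∀ᶠ x in 𝓝 (φ p), P (φ.symm x) := by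
  have h1 := φ.symm.continuousAt (φ.map_source hp)
  refine h1.eventually (p := P) ?_
  rwa [φ.left_inv hp]

theorem analyticAt_comp_symm {n : ℕ} {f : M → EuclideanSpace ℝ (Fin n)} {p : M}
    (hφ : IsCoordAt φ p) (hf : ContMDiffAt (𝓡 2) (𝓡 n) ω f p) :
    AnalyticAt ℝ (f ∘ φ.symm) (φ p) := by
  have h1 := contMDiffAt_symm_of_mem_maximalAtlas hφ.1 (φ.map_source hφ.2)
  have h2 : ContMDiffAt (𝓡 2) (𝓡 n) ω f (φ.symm (φ p)) := by rwa [φ.left_inv hφ.2]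
  exact (contMDiffAt_iff_contDiffAt.1 (h2.comp (φ p) h1)).analyticAt

theorem contMDiffAt_comp_chart {n : ℕ} {F : Plane → EuclideanSpace ℝ (Fin n)} {p : M}
    (hφ : IsCoordAt φ p) (hF : AnalyticAt ℝ F (φ p)) :
    ContMDiffAt (𝓡 2) (𝓡 n) ω (F ∘ φ) p :=
  (contMDiffAt_iff_contDiffAt.2 hF.contDiffAt).comp p
    (contMDiffAt_of_mem_maximalAtlas hφ.1 hφ.2)

theorem diff_coordMap {f : M → Space} (hφ : φ ∈ IsManifold.maximalAtlas (𝓡 2) ω M) {x : Plane}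
    (hx : x ∈ φ.target) (hf : MDifferentiableAt (𝓡 2) (𝓡 3) f (φ.symm x)) (a : Plane) :
    diff f (φ.symm x) (coordMap φ x a)
      = a 0 • pd 0 (f ∘ φ.symm) x + a 1 • pd 1 (f ∘ φ.symm) x := by
  have h1 : MDifferentiableAt (𝓡 2) (𝓡 2) φ.symm x :=
    (contMDiffAt_symm_of_mem_maximalAtlas hφ hx).mdifferentiableAt (by simp)
  have h2 := mfderiv_comp x hf h1
  rw [mfderiv_eq_fderiv] at h2
  have h3 := DFunLike.congr_fun h2 a
  rw [← fderiv_plane]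
  exact h3.symm

theorem eventually_mdifferentiableAt {f : M → Space} {p : M} (hφ : p ∈ φ.source)
    (hf : ContMDiffAt (𝓡 2) (𝓡 3) ω f p) :
    ∀ᶠ x in 𝓝 (φ p), MDifferentiableAt (𝓡 2) (𝓡 3) f (φ.symm x) := by
  refine eventually_in_chart hφ (P := fun q => MDifferentiableAt (𝓡 2) (𝓡 3) f q) ?_
  filter_upwards [(contMDiffAt_iff_contMDiffAt_nhds (by simp)).1 hf] with q hq
  exact hq.mdifferentiableAt (by simp)

theorem metric_coordMap (hs : ∀ (q : M) (v w : TangentSpace (𝓡 2) q), g q v w = g q w v)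
    (x a b : Plane) : g (φ.symm x) (coordMap φ x a) (coordMap φ x b)
      = a 0 * b 0 * coeff g φ 0 0 x + (a 0 * b 1 + a 1 * b 0) * coeff g φ 0 1 x
        + a 1 * b 1 * coeff g φ 1 1 x := by
  rw [coordMap_apply, coordMap_apply]
  simp only [map_add, map_smul, add_apply, smul_apply, smul_eq_mul, coeff]
  rw [hs (φ.symm x) (coordVec φ 1 x) (coordVec φ 0 x)]
  ring

/-- A positive semi-definite quadratic form in two variables is definite exactly when its
discriminant is non-zero. The test vector (−F, E) has square length E(EG − F²). -/
theorem isRegularPoint_iff (hg : IsKossowskiMetric g)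
    (hφ : φ ∈ IsManifold.maximalAtlas (𝓡 2) ω M) {x : Plane} (hx : x ∈ φ.target) :
    IsRegularPoint g (φ.symm x) ↔ discr g φ x ≠ 0 := by
  have hE : ∀ a : Plane, 0 ≤ a 0 * a 0 * coeff g φ 0 0 x
      + (a 0 * a 1 + a 1 * a 0) * coeff g φ 0 1 x + a 1 * a 1 * coeff g φ 1 1 x := fun a => by
    rw [← metric_coordMap hg.symm]; exact hg.nonneg _ _
  constructor
  · intro h h0
    unfold discr at h0
    have h1 : ∀ a : Plane, a ≠ 0 → 0 < a 0 * a 0 * coeff g φ 0 0 x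
        + (a 0 * a 1 + a 1 * a 0) * coeff g φ 0 1 x + a 1 * a 1 * coeff g φ 1 1 x := by
      intro a ha
      rw [← metric_coordMap hg.symm]
      exact h _ fun h2 => ha (coordMap_injective hφ hx h2)
    have h2 := h1 !₂[1, 0] (fun h => by simpa using congrArg (fun z : Plane => z 0) h)
    simp at h2
    have h3 := h1 !₂[-coeff g φ 0 1 x, coeff g φ 0 0 x]
      (fun h => h2.ne' (by simpa using congrArg (fun z : Plane => z 1) h))
    simp at h3
    nlinarith
  · intro h0 v hv
    obtain ⟨a, rfl⟩ := coordMap_surjective hφ hx v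
    have ha : a ≠ 0 := fun h => hv (by rw [h, map_zero])
    rw [metric_coordMap hg.symm]
    refine lt_of_le_of_ne (hE a) fun h1 => ?_
    have e0 := hE !₂[1, 0]
    have e1 := hE !₂[-coeff g φ 0 1 x, coeff g φ 0 0 x]
    simp at e0 e1
    unfold discr at h0
    set E := coeff g φ 0 0 x
    set F := coeff g φ 0 1 x
    set G := coeff g φ 1 1 x
    have h2 : (E * a 0 + F * a 1) ^ 2 + (E * G - F ^ 2) * a 1 ^ 2 = 0 := by
      linear_combination -E * h1
    have h3 : (G * a 1 + F * a 0) ^ 2 + (E * G - F ^ 2) * a 0 ^ 2 = 0 := by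
      linear_combination -G * h1
    have hpos : 0 < E * G - F ^ 2 := by
      refine lt_of_le_of_ne ?_ (Ne.symm h0)
      rcases e0.eq_or_lt with h4 | h4
      -- When E = 0, the form takes the value −4F² at (−(G + 1), 2F).
      · have h5 : F = 0 := by
          by_contra h5
          have := hE !₂[-(G + 1), 2 * F]
          have h6 := hE !₂[-(2 * G + 1), 2 * F]
          simp [← h4] at this h6
          have : 0 < F ^ 2 := by positivity
          nlinarith
        rw [← h4, h5]; simp
      · by_contra h5
        push Not at h5
        nlinarith
    have h4 : a 1 = 0 := by
      by_contra h5
      have : 0 < a 1 ^ 2 := by positivity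
      nlinarith [sq_nonneg (E * a 0 + F * a 1)]
    have h5 : a 0 = 0 := by
      by_contra h5
      have : 0 < a 0 ^ 2 := by positivity
      nlinarith [sq_nonneg (G * a 1 + F * a 0)]
    exact ha (by rw [plane_ext_single a, h4, h5]; simp)

end Charts

end FormalGerm

namespace FormalGerm

open Kossowski

/-! ### Changes of coordinates and the signed area density -/

section Transition

variable {M : Type*} [TopologicalSpace M] [ChartedSpace Plane M] [IsManifold (𝓡 2) ω M]
  {g : BilinField M} {φ ψ : OpenPartialHomeomorph M Plane}

theorem metric_congr (g : BilinField M) {q q' : M} (e : q = q') (v w : Plane) :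
    (g q : Plane →L[ℝ] Plane →L[ℝ] ℝ) v w = (g q' : Plane →L[ℝ] Plane →L[ℝ] ℝ) v w := by
  rw [e]

theorem coordMap_transition (hφ : φ ∈ IsManifold.maximalAtlas (𝓡 2) ω M)
    (hψ : ψ ∈ IsManifold.maximalAtlas (𝓡 2) ω M) {y : Plane} (hy : y ∈ ψ.target)
    (hy' : ψ.symm y ∈ φ.source) (a : Plane) :
    (coordMap ψ y a : Plane)
      = coordMap φ ((φ ∘ ψ.symm) y) (fderiv ℝ (φ ∘ ψ.symm) y a) := by
  have h1 : MDifferentiableAt (𝓡 2) (𝓡 2) ψ.symm y :=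
    (contMDiffAt_symm_of_mem_maximalAtlas hψ hy).mdifferentiableAt (by simp)
  have h2 : MDifferentiableAt (𝓡 2) (𝓡 2) φ (ψ.symm y) :=
    (contMDiffAt_of_mem_maximalAtlas hφ hy').mdifferentiableAt (by simp)
  have h3 : MDifferentiableAt (𝓡 2) (𝓡 2) φ.symm ((φ ∘ ψ.symm) y) :=
    (contMDiffAt_symm_of_mem_maximalAtlas hφ (φ.map_source hy')).mdifferentiableAt (by simp)
  have h4 : ψ.symm =ᶠ[𝓝 y] φ.symm ∘ (φ ∘ ψ.symm) := by
    filter_upwards [(ψ.symm.continuousAt hy).eventually (φ.open_source.mem_nhds hy')] with z hz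
    exact (φ.left_inv hz).symm
  have h5 := h4.mfderiv_eq (I := 𝓡 2) (I' := 𝓡 2)
  have h6 := mfderiv_comp y h3 (h2.comp y h1)
  have h7 := DFunLike.congr_fun (h5.trans h6) a
  rw [← mfderiv_eq_fderiv]
  exact h7

theorem analyticAt_transition (hφ : φ ∈ IsManifold.maximalAtlas (𝓡 2) ω M)
    (hψ : ψ ∈ IsManifold.maximalAtlas (𝓡 2) ω M) {y : Plane} (hy : y ∈ ψ.target)
    (hy' : ψ.symm y ∈ φ.source) : AnalyticAt ℝ (φ ∘ ψ.symm) y :=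
  (contMDiffAt_iff_contDiffAt.1 ((contMDiffAt_of_mem_maximalAtlas hφ hy').comp y
    (contMDiffAt_symm_of_mem_maximalAtlas hψ hy))).analyticAt

/-- The functional determinant of a map of the plane. -/
noncomputable def jacobian (κ : Plane → Plane) (y : Plane) : ℝ :=
  pd 0 κ y 0 * pd 1 κ y 1 - pd 0 κ y 1 * pd 1 κ y 0

/-- The Gram matrix changes by congruence with the Jacobian matrix, so its determinant acquires the
square of the functional determinant. -/
theorem discr_transition (hs : ∀ (q : M) (v w : TangentSpace (𝓡 2) q), g q v w = g q w v)
    (hφ : φ ∈ IsManifold.maximalAtlas (𝓡 2) ω M)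
    (hψ : ψ ∈ IsManifold.maximalAtlas (𝓡 2) ω M) {y : Plane} (hy : y ∈ ψ.target)
    (hy' : ψ.symm y ∈ φ.source) :
    discr g ψ y = jacobian (φ ∘ ψ.symm) y ^ 2 * discr g φ ((φ ∘ ψ.symm) y) := by
  have key : ∀ i j, coeff g ψ i j y = g (φ.symm ((φ ∘ ψ.symm) y))
      (coordMap φ ((φ ∘ ψ.symm) y) (pd i (φ ∘ ψ.symm) y))
      (coordMap φ ((φ ∘ ψ.symm) y) (pd j (φ ∘ ψ.symm) y)) := by
    intro i j
    have h1 := coordMap_transition hφ hψ hy hy' (EuclideanSpace.single i 1)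
    have h2 := coordMap_transition hφ hψ hy hy' (EuclideanSpace.single j 1)
    have h3 : ψ.symm y = φ.symm ((φ ∘ ψ.symm) y) := (φ.left_inv hy').symm
    have h4 := metric_congr g h3 (coordMap ψ y (EuclideanSpace.single i 1))
      (coordMap ψ y (EuclideanSpace.single j 1))
    exact h4.trans (by rw [h1, h2]; rfl)
  simp only [discr, key, metric_coordMap hs, jacobian]
  ring

theorem jacobian_ne_zero {κ : Plane → Plane} {y : Plane}
    (hinj : ∀ v, fderiv ℝ κ y v = 0 → v = 0) : jacobian κ y ≠ 0 := by
  intro h0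
  unfold jacobian at h0
  have h1 := hinj !₂[-(pd 1 κ y 0), pd 0 κ y 0] (by
    rw [fderiv_plane]
    ext k
    fin_cases k
    · simp; ring
    · simp; linear_combination h0)
  have h2 := hinj !₂[-(pd 1 κ y 1), pd 0 κ y 1] (by
    rw [fderiv_plane]
    ext k
    fin_cases k
    · simp; linear_combination -h0
    · simp; ring)
  have h3 : pd 0 κ y 0 = 0 := by simpa using congrArg (fun z : Plane => z 1) h1
  have h4 : pd 0 κ y 1 = 0 := by simpa using congrArg (fun z : Plane => z 1) h2
  have h5 := hinj (EuclideanSpace.single 0 1) (by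
    show pd 0 κ y = 0
    ext k
    fin_cases k
    exacts [h3, h4])
  have := congrArg (fun z : Plane => z 0) h5
  simp at this

theorem fderiv_transition_bijective (hφ : φ ∈ IsManifold.maximalAtlas (𝓡 2) ω M)
    (hψ : ψ ∈ IsManifold.maximalAtlas (𝓡 2) ω M) {y : Plane} (hy : y ∈ ψ.target)
    (hy' : ψ.symm y ∈ φ.source) :
    (∀ v, fderiv ℝ (φ ∘ ψ.symm) y v = 0 → v = 0) ∧ ∀ a, ∃ v, fderiv ℝ (φ ∘ ψ.symm) y v = a := by
  constructor
  · intro v hv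
    refine coordMap_injective hψ hy ?_
    have := coordMap_transition hφ hψ hy hy' v
    rw [hv, map_zero] at this
    exact this
  · intro a
    obtain ⟨b, hb⟩ := coordMap_surjective hψ hy
      (coordMap φ ((φ ∘ ψ.symm) y) a : Plane)
    refine ⟨b, ?_⟩
    have h1 := coordMap_transition hφ hψ hy hy' b
    have h2 : (coordMap ψ y b : Plane) = coordMap φ ((φ ∘ ψ.symm) y) a := hb
    have h3 : coordMap φ ((φ ∘ ψ.symm) y) (fderiv ℝ (φ ∘ ψ.symm) y b)
        = coordMap φ ((φ ∘ ψ.symm) y) a := h1.symm.trans h2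
    have h4 := coordMap_injective hφ (φ.map_source hy') (x := (φ ∘ ψ.symm) y)
      (a := fderiv ℝ (φ ∘ ψ.symm) y b - a) (by rw [map_sub, h3, sub_self])
    exact sub_eq_zero.1 h4

/-- In every coordinate system around a semi-definite point, the signed area density has a
non-vanishing differential. -/
theorem exists_density (hg : IsKossowskiMetric g) {p : M} (hp : IsSemidefinitePoint g p)
    (hψ : IsCoordAt ψ p) :
    ∃ lam : Plane → ℝ, AnalyticAt ℝ lam (ψ p) ∧ (∀ᶠ y in 𝓝 (ψ p), discr g ψ y = lam y ^ 2) ∧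
      lam (ψ p) = 0 ∧ fderiv ℝ lam (ψ p) ≠ 0 := by
  obtain ⟨φ, hφ, lam, hlam, hd⟩ := hg.density p hp
  have hy : ψ p ∈ ψ.target := ψ.map_source hψ.2
  have hs : ψ.symm (ψ p) = p := ψ.left_inv hψ.2
  have hy' : ψ.symm (ψ p) ∈ φ.source := by rw [hs]; exact hφ.2
  have hκp : (φ ∘ ψ.symm) (ψ p) = φ p := by simp only [Function.comp_apply, hs]
  have hx : φ p ∈ φ.target := φ.map_source hφ.2
  have hl0 : lam (φ p) = 0 := by
    have h1 : ¬ IsRegularPoint g (φ.symm (φ p)) := by rw [φ.left_inv hφ.2]; exact hp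
    rw [isRegularPoint_iff hg hφ.1 hx, not_not, hlam.2 _ hx] at h1
    exact pow_eq_zero_iff (two_ne_zero) |>.1 h1
  have hκ := analyticAt_transition hφ.1 hψ.1 hy hy'
  obtain ⟨hinj, hsurj⟩ := fderiv_transition_bijective hφ.1 hψ.1 hy hy'
  have hJ0 := jacobian_ne_zero hinj
  have hpd : ∀ i k, AnalyticAt ℝ (fun y => pd i (φ ∘ ψ.symm) y k) (ψ p) := fun i k =>
    AnalyticAt.comp (g := EuclideanSpace.proj (𝕜 := ℝ) k) (ContinuousLinearMap.analyticAt _ _)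
      (analyticAt_pd i hκ)
  have hJ : AnalyticAt ℝ (jacobian (φ ∘ ψ.symm)) (ψ p) :=
    ((hpd 0 0).mul (hpd 1 1)).sub ((hpd 0 1).mul (hpd 1 0))
  have hl : AnalyticAt ℝ lam ((φ ∘ ψ.symm) (ψ p)) := by rw [hκp]; exact hlam.1 _ hx
  -- The density transforms like the coefficient of an area form: multiply by the functional
  -- determinant.
  refine ⟨fun y => jacobian (φ ∘ ψ.symm) y * lam ((φ ∘ ψ.symm) y),
    hJ.mul (AnalyticAt.comp (g := lam) hl hκ), ?_, ?_, ?_⟩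
  · filter_upwards [ψ.open_target.mem_nhds hy,
      (ψ.symm.continuousAt hy).eventually (φ.open_source.mem_nhds hy')] with y h1 h2
    have h3 : discr g φ ((φ ∘ ψ.symm) y) = lam ((φ ∘ ψ.symm) y) ^ 2 := hlam.2 _ (φ.map_source h2)
    rw [discr_transition hg.symm hφ.1 hψ.1 h1 h2, h3]
    ring
  · show jacobian (φ ∘ ψ.symm) (ψ p) * lam ((φ ∘ ψ.symm) (ψ p)) = 0
    rw [hκp, hl0, mul_zero]
  -- Since λ vanishes at the point, the differential of the product is J · dλ ∘ dκ there, with J ≠ 0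
  -- and dκ surjective.
  · intro h0
    have h1 : HasFDerivAt (fun y => lam ((φ ∘ ψ.symm) y))
        ((fderiv ℝ lam ((φ ∘ ψ.symm) (ψ p))).comp (fderiv ℝ (φ ∘ ψ.symm) (ψ p))) (ψ p) :=
      hl.differentiableAt.hasFDerivAt.comp _ hκ.differentiableAt.hasFDerivAt
    have h2 := hJ.differentiableAt.hasFDerivAt.mul h1
    have h2' : fderiv ℝ (fun y => jacobian (φ ∘ ψ.symm) y * lam ((φ ∘ ψ.symm) y)) (ψ p) = _ :=
      h2.fderiv
    rw [h2'] at h0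
    refine hd (ContinuousLinearMap.ext fun a => ?_)
    obtain ⟨v, rfl⟩ := hsurj a
    have h3 := DFunLike.congr_fun h0 v
    simp only [add_apply, smul_apply, ContinuousLinearMap.comp_apply, hκp, hl0, smul_eq_mul,
      zero_mul, add_zero] at h3
    simpa [hJ0] using h3

end Transition

/-! ### Admissibility in coordinates -/

section Admissible

variable {M : Type*} [TopologicalSpace M] [ChartedSpace Plane M] [IsManifold (𝓡 2) ω M]
  {g : BilinField M} {φ : OpenPartialHomeomorph M Plane}

/-- The vector field with constant components `a` in a coordinate system. -/
noncomputable def constField (φ : OpenPartialHomeomorph M Plane) (a : Plane) (q : M) :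
    TangentSpace (𝓡 2) q :=
  VectorField.mpullback (𝓡 2) (𝓡 2) φ (fun _ => a) q

theorem isInvertible_mfderiv (hφ : φ ∈ IsManifold.maximalAtlas (𝓡 2) ω M) {q : M}
    (hq : q ∈ φ.source) : (mfderiv (𝓡 2) (𝓡 2) φ q).IsInvertible :=
  ⟨(mdifferentiable_of_mem_maximalAtlas hφ).mfderiv hq, rfl⟩

theorem contMDiffAt_const_section (a x : Plane) : ContMDiffAt (𝓡 2) (𝓡 2).tangent ω
    (fun y : Plane => (⟨y, a⟩ : TangentBundle (𝓡 2) Plane)) x := by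
  have h : ContDiffAt ℝ ω (fun _ : Plane => a) x := contDiffAt_const
  exact contMDiffAt_vectorSpace_iff_contDiffAt.2 h

theorem isAnalyticFieldAt_constField (hφ : φ ∈ IsManifold.maximalAtlas (𝓡 2) ω M) {q : M}
    (hq : q ∈ φ.source) (a : Plane) : IsAnalyticFieldAt (constField φ a) q :=
  ContMDiffAt.mpullback_vectorField_preimage (contMDiffAt_const_section a (φ q))
    (contMDiffAt_of_mem_maximalAtlas hφ hq) (isInvertible_mfderiv hφ hq) (by simp)

/-- These fields are pull-backs of constant fields of the plane, whose brackets vanish; the bracket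
terms of Θ then drop out. -/
theorem mlieBracket_constField (hφ : φ ∈ IsManifold.maximalAtlas (𝓡 2) ω M) {q : M}
    (hq : q ∈ φ.source) (a b : Plane) :
    VectorField.mlieBracket (𝓡 2) (constField φ a) (constField φ b) q = 0 := by
  have h := VectorField.mpullback_mlieBracket (I := 𝓡 2) (I' := 𝓡 2) (f := φ) (x₀ := q) (n := ω)
    ((contMDiffAt_const_section a (φ q)).mdifferentiableAt (by simp))
    ((contMDiffAt_const_section b (φ q)).mdifferentiableAt (by simp))
    (contMDiffAt_of_mem_maximalAtlas hφ hq) (by simp)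
  refine h.symm.trans ?_
  have h1 : VectorField.mlieBracket (𝓡 2) (fun y : Plane => (a : TangentSpace (𝓡 2) y))
      (fun y : Plane => (b : TangentSpace (𝓡 2) y)) = 0 := by
    refine VectorField.mlieBracketWithin_univ.symm.trans ?_
    refine VectorField.mlieBracketWithin_eq_lieBracketWithin.trans ?_
    funext y
    simp [VectorField.lieBracketWithin]
    rfl
  rw [h1, VectorField.mpullback_zero]
  rfl

theorem constField_symm (hφ : φ ∈ IsManifold.maximalAtlas (𝓡 2) ω M) {x : Plane}
    (hx : x ∈ φ.target) (a : Plane) : constField φ a (φ.symm x) = coordMap φ x a := by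
  have h1 := (mdifferentiable_of_mem_maximalAtlas hφ).comp_symm_deriv hx
  have h2 := (mdifferentiable_of_mem_maximalAtlas hφ).symm_comp_deriv (φ.map_target hx)
  rw [φ.right_inv hx] at h2
  have h3 : (mfderiv (𝓡 2) (𝓡 2) φ (φ.symm x)).inverse = mfderiv (𝓡 2) (𝓡 2) φ.symm x :=
    ContinuousLinearMap.inverse_eq h1 h2
  exact DFunLike.congr_fun h3 a

theorem fieldDeriv_constField (hφ : φ ∈ IsManifold.maximalAtlas (𝓡 2) ω M) {x : Plane}
    (hx : x ∈ φ.target) (a : Plane) {h : M → ℝ} {H : Plane → ℝ} (hH : AnalyticAt ℝ H x)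
    (e : h ∘ φ.symm =ᶠ[𝓝 x] H) :
    fieldDeriv (constField φ a) h (φ.symm x) = fderiv ℝ H x a := by
  have hq := φ.map_target hx
  have e' : h =ᶠ[𝓝 (φ.symm x)] H ∘ φ := by
    have h1 : ∀ᶠ y in 𝓝 (φ (φ.symm x)), (h ∘ φ.symm) y = H y := by rwa [φ.right_inv hx]
    filter_upwards [(φ.continuousAt hq).eventually h1, φ.open_source.mem_nhds hq] with q h2 h3
    rw [Function.comp_apply, φ.left_inv h3] at h2
    exact h2
  have h1 : MDifferentiableAt (𝓡 2) 𝓘(ℝ, ℝ) h (φ.symm x) := by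
    refine MDifferentiableAt.congr_of_eventuallyEq ?_ e'
    have h2 : MDifferentiableAt (𝓡 2) 𝓘(ℝ, ℝ) H (φ (φ.symm x)) := by
      rw [φ.right_inv hx]
      exact hH.differentiableAt.mdifferentiableAt
    exact h2.comp _ ((contMDiffAt_of_mem_maximalAtlas hφ hq).mdifferentiableAt (by simp))
  have h2 : MDifferentiableAt (𝓡 2) (𝓡 2) φ.symm x :=
    (contMDiffAt_symm_of_mem_maximalAtlas hφ hx).mdifferentiableAt (by simp)
  have h3 := mfderiv_comp x h1 h2
  rw [mfderiv_eq_fderiv, e.fderiv_eq] at h3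
  rw [fieldDeriv, constField_symm hφ hx]
  exact (DFunLike.congr_fun h3 a).symm

/-- The admissibility of a semi-definite point in terms of the coefficients of the metric. -/
theorem coeff_of_isSemidefinitePoint (hg : IsKossowskiMetric g)
    (hφ : φ ∈ IsManifold.maximalAtlas (𝓡 2) ω M) {x : Plane} (hx : x ∈ φ.target)
    (hE : coeff g φ 0 0 x ≠ 0) (h0 : discr g φ x = 0) :
    pd 0 (coeff g φ 0 1) x - pd 1 (coeff g φ 0 0) x / 2
      - coeff g φ 0 1 x / coeff g φ 0 0 x * (pd 0 (coeff g φ 0 0) x / 2) = 0 := by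
  have hq := φ.map_target hx
  have hsd : IsSemidefinitePoint g (φ.symm x) := by
    unfold IsSemidefinitePoint
    rw [isRegularPoint_iff hg hφ hx, h0]
    simp
  set c := coeff g φ 0 1 x / coeff g φ 0 0 x with hc
  -- The null direction −(F/E)∂_u + ∂_v, with its coefficients frozen at x.
  let z : Plane := !₂[-c, 1]
  let u : Plane := EuclideanSpace.single 0 1
  have hcE : c * coeff g φ 0 0 x = coeff g φ 0 1 x := div_mul_cancel₀ _ hE
  have hnull : InNullSpace g (φ.symm x) (constField φ z (φ.symm x)) := by
    intro w
    obtain ⟨b, rfl⟩ := coordMap_surjective hφ hx w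
    rw [constField_symm hφ hx, metric_coordMap hg.symm]
    unfold discr at h0
    have h1 : c * coeff g φ 0 1 x = coeff g φ 1 1 x := by
      have : coeff g φ 0 0 x * (c * coeff g φ 0 1 x - coeff g φ 1 1 x) = 0 := by
        linear_combination coeff g φ 0 1 x * hcE - h0
      have := (mul_eq_zero.1 this).resolve_left hE
      linarith
    simp [z]
    linear_combination (-b 0) * hcE - b 1 * h1
  -- Only Θ(∂_u, ∂_u, Z) is needed: it is √E(β_u − α_v), the numerator that must be divisible by λ.
  have hΘ := hg.admissible _ hsd (constField φ u) (constField φ u) (constField φ z)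
    (isAnalyticFieldAt_constField hφ hq u) (isAnalyticFieldAt_constField hφ hq u)
    (isAnalyticFieldAt_constField hφ hq z) hnull
  have aE := hg.analytic φ hφ 0 0 x hx
  have aF := hg.analytic φ hφ 0 1 x hx
  have key : ∀ a b : Plane, (fun q => g q (constField φ a q) (constField φ b q)) ∘ φ.symm
      =ᶠ[𝓝 x] fun y => a 0 * b 0 * coeff g φ 0 0 y
        + (a 0 * b 1 + a 1 * b 0) * coeff g φ 0 1 y + a 1 * b 1 * coeff g φ 1 1 y := by
    intro a b
    filter_upwards [φ.open_target.mem_nhds hx] with y hy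
    rw [Function.comp_apply, constField_symm hφ hy, constField_symm hφ hy,
      metric_coordMap hg.symm]
  have k1 : (fun q => g q (constField φ u q) (constField φ z q)) ∘ φ.symm
      =ᶠ[𝓝 x] fun y => coeff g φ 0 1 y - c * coeff g φ 0 0 y := by
    refine (key u z).trans (Eventually.of_forall fun y => ?_)
    simp [u, z]; ring
  have k2 : (fun q => g q (constField φ u q) (constField φ u q)) ∘ φ.symm
      =ᶠ[𝓝 x] coeff g φ 0 0 := by
    refine (key u u).trans (Eventually.of_forall fun y => ?_)
    simp [u]
  have f1 := fieldDeriv_constField hφ hx u (aF.sub (analyticAt_const.mul aE)) k1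
  have f2 := fieldDeriv_constField hφ hx z aE k2
  unfold pseudoConnection at hΘ
  rw [mlieBracket_constField hφ hq, mlieBracket_constField hφ hq, f1, f2] at hΘ
  have d1 : fderiv ℝ (fun y => coeff g φ 0 1 y - c * coeff g φ 0 0 y) x u
      = pd 0 (coeff g φ 0 1) x - c * pd 0 (coeff g φ 0 0) x := by
    have h1 := aF.differentiableAt.hasFDerivAt.sub (aE.differentiableAt.hasFDerivAt.const_mul c)
    have h2 : fderiv ℝ (fun y => coeff g φ 0 1 y - c * coeff g φ 0 0 y) x = _ := h1.fderiv
    rw [h2]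
    rfl
  have d2 : fderiv ℝ (coeff g φ 0 0) x z
      = pd 1 (coeff g φ 0 0) x - c * pd 0 (coeff g φ 0 0) x := by
    rw [fderiv_plane]; simp [z]; ring
  rw [d2] at hΘ
  simp only [map_zero, zero_apply] at hΘ
  have d1' : fderiv ℝ (coeff g φ 0 1 - (fun _ => c) * coeff g φ 0 0) x u
      = pd 0 (coeff g φ 0 1) x - c * pd 0 (coeff g φ 0 0) x := d1
  rw [d1'] at hΘ
  linear_combination hΘ

end Admissible

end FormalGerm

namespace FormalGerm

open Kossowski

/-! ### Adapted coordinates and the coframe of the metric -/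

section Charts

variable {M : Type*} [TopologicalSpace M] [ChartedSpace Plane M] [IsManifold (𝓡 2) ω M]
  {g : BilinField M} {ψ : OpenPartialHomeomorph M Plane}

/-- There are coordinates around a point of a regular curve in which the curve is the first
coordinate axis. -/
theorem exists_straightening {p : M} {γ : ℝ → M} (hγ : ContMDiffAt 𝓘(ℝ, ℝ) (𝓡 2) ω γ 0)
    (hγp : γ 0 = p) (hv : velocity γ 0 ≠ 0) :
    ∃ ψ : OpenPartialHomeomorph M Plane, IsCoordAt ψ p ∧ ψ p = 0 ∧
      ∀ᶠ t in 𝓝 0, ψ (γ t) = axis t := by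
  let e := chartAt Plane p
  have he : e ∈ IsManifold.maximalAtlas (𝓡 2) ω M := IsManifold.chart_mem_maximalAtlas p
  have hpe : p ∈ e.source := mem_chart_source Plane p
  have hγe : γ 0 ∈ e.source := by rw [hγp]; exact hpe
  let c : ℝ → Plane := e ∘ γ
  have hc : AnalyticAt ℝ c 0 := (contMDiffAt_iff_contDiffAt.1
    ((contMDiffAt_of_mem_maximalAtlas he hγe).comp 0 hγ)).analyticAt
  set c' := deriv c 0 with hc'
  have hc0 : c' ≠ 0 := by
    intro h0
    refine hv ?_
    have h1 := mfderiv_comp (0 : ℝ)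
      ((contMDiffAt_of_mem_maximalAtlas he hγe).mdifferentiableAt (by simp))
      (hγ.mdifferentiableAt (by simp))
    rw [mfderiv_eq_fderiv] at h1
    have h2 : fderiv ℝ c 0 (1 : ℝ) = mfderiv (𝓡 2) (𝓡 2) e (γ 0) (velocity γ 0) :=
      DFunLike.congr_fun h1 (1 : ℝ)
    have h3 : fderiv ℝ c 0 (1 : ℝ) = 0 := by
      rw [fderiv_apply_one_eq_deriv]; exact h0
    rw [h3] at h2
    have h4 := (mdifferentiable_of_mem_maximalAtlas he).symm_comp_deriv hγe
    have h5 := DFunLike.congr_fun h4 (velocity γ 0)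
    have h6 : mfderiv (𝓡 2) (𝓡 2) e.symm (e (γ 0))
      (mfderiv (𝓡 2) (𝓡 2) e (γ 0) (velocity γ 0)) = velocity γ 0 := h5
    rw [← h2] at h6
    rw [← h6]
    exact map_zero _
  -- The second coordinate moves along the velocity at 0 rotated by a right angle, so the
  -- differential at 0 has determinant |c'|² ≠ 0.
  let Φ : Plane → Plane := fun y => c (y 0) + y 1 • !₂[-(c' 1), c' 0]
  let π : Fin 2 → Plane →L[ℝ] ℝ := fun k => EuclideanSpace.proj k
  have hc00 : AnalyticAt ℝ c ((π 0) 0) := by rwa [map_zero]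
  have hΦ : AnalyticAt ℝ Φ 0 :=
    (AnalyticAt.comp (g := c) (f := π 0) hc00 ((π 0).analyticAt 0)).add
      (((π 1).analyticAt 0).smul analyticAt_const)
  have hdc : HasDerivAt c c' ((π 0) 0) := by
    rw [map_zero]; exact hc.differentiableAt.hasDerivAt
  have hdΦ : HasFDerivAt Φ ((π 0).smulRight c' + (π 1).smulRight !₂[-(c' 1), c' 0]) 0 := by
    refine HasFDerivAt.add ?_ ((π 1).hasFDerivAt.smul_const _)
    have := hdc.hasFDerivAt.comp (0 : Plane) (π 0).hasFDerivAt
    refine this.congr_fderiv ?_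
    ext v k
    simp
  have hnorm : 0 < c' 0 ^ 2 + c' 1 ^ 2 := by
    by_contra h
    have h0 : c' 0 = 0 := by nlinarith [sq_nonneg (c' 0), sq_nonneg (c' 1)]
    have h1 : c' 1 = 0 := by nlinarith [sq_nonneg (c' 0), sq_nonneg (c' 1)]
    exact hc0 (by rw [plane_ext_single c', h0, h1]; simp)
  obtain ⟨κ, hκ0, hκ, hκ1, hκ2⟩ := exists_analytic_inverse hΦ (by
    intro v hv
    rw [hdΦ.fderiv] at hv
    have e0 := congrArg (fun z : Plane => z 0) hv
    have e1 := congrArg (fun z : Plane => z 1) hv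
    simp [π] at e0 e1
    have h0 : v 0 * (c' 0 ^ 2 + c' 1 ^ 2) = 0 := by linear_combination c' 0 * e0 + c' 1 * e1
    have h1 : v 1 * (c' 0 ^ 2 + c' 1 ^ 2) = 0 := by linear_combination c' 0 * e1 - c' 1 * e0
    have h0' := (mul_eq_zero.1 h0).resolve_right hnorm.ne'
    have h1' := (mul_eq_zero.1 h1).resolve_right hnorm.ne'
    rw [plane_ext_single v, h0', h1']; simp)
  have hΦa : ∀ t, Φ (axis t) = c t := fun t => by
    simp only [Φ, axis_zero_coord, axis_one_coord, zero_smul, add_zero]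
  have hΦ0 : Φ 0 = e p := by
    have := hΦa 0
    rw [map_zero] at this
    rw [this, ← hγp]; rfl
  have hep : e p ∈ κ.target := by
    have := κ.map_source hκ0
    rwa [hκ, hΦ0] at this
  have hsrc : p ∈ (e.trans κ.symm).source := by
    rw [OpenPartialHomeomorph.trans_source]
    exact ⟨hpe, hep⟩
  refine ⟨e.trans κ.symm, ⟨trans_mem_maximalAtlas he hκ2 hκ1, hsrc⟩, ?_, ?_⟩
  · show κ.symm (e p) = 0
    have := κ.left_inv hκ0
    rwa [hκ, hΦ0] at this
  · filter_upwards [tendsto_axis.eventually (κ.open_source.mem_nhds hκ0)] with t ht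
    show κ.symm (c t) = axis t
    have := κ.left_inv ht
    rwa [hκ, hΦa] at this

theorem pos_coeff_of_straightening {p : M} {γ : ℝ → M}
    (hγ_nonnull : 0 < g (γ 0) (velocity γ 0) (velocity γ 0))
    (hγ : ContMDiffAt 𝓘(ℝ, ℝ) (𝓡 2) ω γ 0) (hγp : γ 0 = p)
    (hψ : IsCoordAt ψ p) (hψ0 : ψ p = 0) (ha : ∀ᶠ t in 𝓝 0, ψ (γ t) = axis t) :
    0 < coeff g ψ 0 0 0 := by
  have h0 : (0 : Plane) ∈ ψ.target := by rw [← hψ0]; exact ψ.map_source hψ.2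
  have hs : γ 0 = ψ.symm 0 := by rw [hγp, ← hψ0, ψ.left_inv hψ.2]
  have e : γ =ᶠ[𝓝 0] ψ.symm ∘ axis := by
    have h1 : ∀ᶠ t in 𝓝 0, γ t ∈ ψ.source :=
      hγ.continuousAt.eventually (ψ.open_source.mem_nhds (by rw [hγp]; exact hψ.2))
    filter_upwards [ha, h1] with t h2 h3
    rw [Function.comp_apply, ← h2, ψ.left_inv h3]
  have h00 : axis 0 ∈ ψ.target := by rwa [map_zero]
  have h1 := mfderiv_comp (0 : ℝ)
    ((contMDiffAt_symm_of_mem_maximalAtlas hψ.1 h00).mdifferentiableAt (by simp))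
    (axis.differentiableAt (x := 0)).mdifferentiableAt
  have h2 := DFunLike.congr_fun (e.mfderiv_eq.trans h1) (1 : ℝ)
  have h3 : (velocity γ 0 : Plane) = coordMap ψ (axis 0) (mfderiv 𝓘(ℝ, ℝ) (𝓡 2) axis 0 (1 : ℝ)) :=
    h2
  have h4 : mfderiv 𝓘(ℝ, ℝ) (𝓡 2) axis 0 (1 : ℝ) = (EuclideanSpace.single 0 1 : Plane) := by
    rw [mfderiv_eq_fderiv, axis.fderiv]
    show axis 1 = _
    simp [axis]
  have h5 : (velocity γ 0 : Plane) = coordVec ψ 0 (axis 0) := by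
    rw [h3, h4]; rfl
  have h6 := metric_congr g (hs.trans (by rw [map_zero] : ψ.symm 0 = ψ.symm (axis 0)))
    (velocity γ 0) (velocity γ 0)
  have h7 : 0 < coeff g ψ 0 0 (axis 0) := by
    refine lt_of_lt_of_eq hγ_nonnull (h6.trans ?_)
    rw [h5]
    rfl
  rwa [map_zero] at h7

theorem pd_mul {h h' : Plane → ℝ} {x : Plane} (i : Fin 2) (hh : DifferentiableAt ℝ h x)
    (hh' : DifferentiableAt ℝ h' x) :
    pd i (fun y => h y * h' y) x = h x * pd i h' x + h' x * pd i h x := by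
  have h1 : fderiv ℝ (fun y => h y * h' y) x = _ :=
    (hh.hasFDerivAt.mul hh'.hasFDerivAt).fderiv
  rw [pd, h1]
  rfl

theorem analyticAt_sqrt {h : Plane → ℝ} {x : Plane} (hh : AnalyticAt ℝ h x) (h0 : h x ≠ 0) :
    AnalyticAt ℝ (fun y => √(h y)) x :=
  (hh.contDiffAt (n := ω)).sqrt h0 |>.analyticAt

/-- A coframe of a Kossowski metric. -/
theorem exists_coframe (hg : IsKossowskiMetric g) {p : M} (hψ : IsCoordAt ψ p) (hψ0 : ψ p = 0)
    (hE : 0 < coeff g ψ 0 0 0) : ∃ α β σ k : Plane → ℝ, IsCoframe α β σ k ∧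
      ∀ᶠ y in 𝓝 0, α y * α y = coeff g ψ 0 0 y ∧ α y * β y = coeff g ψ 0 1 y ∧
        β y * β y + σ y * σ y = coeff g ψ 1 1 y := by
  have h0 : (0 : Plane) ∈ ψ.target := by rw [← hψ0]; exact ψ.map_source hψ.2
  set E := coeff g ψ 0 0
  set F := coeff g ψ 0 1
  set G := coeff g ψ 1 1
  have aE : AnalyticAt ℝ E 0 := hg.analytic ψ hψ.1 0 0 0 h0
  have aF : AnalyticAt ℝ F 0 := hg.analytic ψ hψ.1 0 1 0 h0
  have aG : AnalyticAt ℝ G 0 := hg.analytic ψ hψ.1 1 1 0 h0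
  have pE : ∀ᶠ y in 𝓝 0, 0 < E y := aE.continuousAt.eventually (lt_mem_nhds hE)
  have hdef : ∀ y, discr g ψ y = E y * G y - F y ^ 2 := fun y => rfl
  have aD : AnalyticAt ℝ (discr g ψ) 0 := (aE.mul aG).sub (aF.pow 2)
  have pD : ∀ᶠ y in 𝓝 0, 0 ≤ discr g ψ y := by
    filter_upwards [pE] with y hy
    have h1 := hg.nonneg (ψ.symm y) (coordMap ψ y !₂[-F y, E y])
    rw [metric_coordMap hg.symm] at h1
    simp at h1
    have h2 : 0 ≤ E y * discr g ψ y := by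
      rw [hdef]
      refine h1.trans_eq ?_
      show F y * F y * E y + (-(F y * E y) + -(E y * F y)) * F y + E y * E y * G y = _
      ring
    exact nonneg_of_mul_nonneg_right h2 hy
  -- This function is √E(β_u − α_v), written without square roots.
  let h : Plane → ℝ := fun y => pd 0 F y - pd 1 E y / 2 - F y / E y * (pd 0 E y / 2)
  have ah : AnalyticAt ℝ h 0 :=
    ((analyticAt_pd 0 aF).sub ((analyticAt_pd 1 aE).mul analyticAt_const)).sub
      ((aF.div aE hE.ne').mul ((analyticAt_pd 0 aE).mul analyticAt_const))
  obtain ⟨lam, k, alam, ak, hlam, hk⟩ : ∃ lam k : Plane → ℝ, AnalyticAt ℝ lam 0 ∧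
      AnalyticAt ℝ k 0 ∧ (∀ᶠ y in 𝓝 0, discr g ψ y = lam y ^ 2) ∧
      ∀ᶠ y in 𝓝 0, h y = k y * lam y := by
    -- At a regular point λ = √(EG − F²) is analytic and invertible, so division is immediate. At a
    -- semi-definite point h vanishes where λ does, and dλ ≠ 0 makes the quotient analytic.
    by_cases hp : IsRegularPoint g p
    · have hd : discr g ψ 0 ≠ 0 := by
        rw [← isRegularPoint_iff hg hψ.1 h0, ← hψ0, ψ.left_inv hψ.2]
        exact hp
      have hs : √(discr g ψ 0) ≠ 0 :=
        (Real.sqrt_pos.2 (lt_of_le_of_ne pD.self_of_nhds hd.symm)).ne'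
      have as := analyticAt_sqrt aD hd
      refine ⟨fun y => √(discr g ψ y), fun y => h y / √(discr g ψ y), as, ah.div as hs, ?_, ?_⟩
      · filter_upwards [pD] with y hy
        rw [Real.sq_sqrt hy]
      · filter_upwards [as.continuousAt.eventually_ne hs] with y hy
        rw [div_mul_cancel₀ _ hy]
    · obtain ⟨lam, h1, h2, h3, h4⟩ := exists_density hg hp hψ
      rw [hψ0] at h1 h2 h3 h4
      obtain ⟨k, hk1, hk2⟩ := exists_eq_mul_of_vanishing h1 ah h3 h4 (by
        filter_upwards [h2, pE, ψ.open_target.mem_nhds h0] with y h5 h6 h7 h8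
        refine coeff_of_isSemidefinitePoint hg hψ.1 h7 h6.ne' ?_
        rw [h5, h8]; simp)
      exact ⟨lam, k, h1, hk1, h2, hk2⟩
  have aα := analyticAt_sqrt aE hE.ne'
  have hα0 : 0 < √(E 0) := Real.sqrt_pos.2 hE
  have aβ : AnalyticAt ℝ (fun y => F y / √(E y)) 0 := aF.div aα hα0.ne'
  have h1 : ∀ᶠ y in 𝓝 0, √(E y) * √(E y) = E y := by
    filter_upwards [pE] with y hy using Real.mul_self_sqrt hy.le
  have h2 : ∀ᶠ y in 𝓝 0, √(E y) * (F y / √(E y)) = F y := by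
    filter_upwards [pE] with y hy using mul_div_cancel₀ _ (Real.sqrt_pos.2 hy).ne'
  refine ⟨fun y => √(E y), fun y => F y / √(E y), fun y => lam y / √(E y), k,
    ⟨aα, aβ, alam.div aα hα0.ne', ak, hα0, ?_⟩, ?_⟩
  · filter_upwards [pE, pd_congr 0 h1, pd_congr 1 h1, pd_congr 0 h2, aα.eventually_analyticAt,
      aβ.eventually_analyticAt, hk, h1, h2] with y h3 h4 h5 h6 h7 h8 h9 h10 h11
    rw [pd_mul 0 h7.differentiableAt h7.differentiableAt] at h4
    rw [pd_mul 1 h7.differentiableAt h7.differentiableAt] at h5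
    rw [pd_mul 0 h7.differentiableAt h8.differentiableAt] at h6
    have hs : √(E y) ≠ 0 := (Real.sqrt_pos.2 h3).ne'
    have h12 : h y = pd 0 F y - pd 1 E y / 2 - F y / E y * (pd 0 E y / 2) := rfl
    rw [h9] at h12
    have h13 : F y / E y * √(E y) = F y / √(E y) := by
      rw [div_mul_eq_mul_div, div_eq_div_iff h3.ne' hs, mul_assoc, h10]
    have h14 : √(E y) * (pd 0 (fun y => F y / √(E y)) y - pd 1 (fun y => √(E y)) y)
        = k y * lam y := by
      rw [h12]
      linear_combination h6 - h5 / 2 - F y / E y * h4 / 2 + pd 0 (fun y => √(E y)) y * h13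
    rw [mul_div_assoc', ← h14, mul_div_cancel_left₀ _ hs]
  · filter_upwards [pE, h1, h2, hlam] with y h3 h4 h5 h6
    refine ⟨h4, h5, ?_⟩
    rw [hdef] at h6
    have hs : √(E y) ≠ 0 := (Real.sqrt_pos.2 h3).ne'
    have : E y * (F y / √(E y) * (F y / √(E y)) + lam y / √(E y) * (lam y / √(E y)))
        = E y * G y := by
      have h7 : E y * (F y / √(E y) * (F y / √(E y)) + lam y / √(E y) * (lam y / √(E y)))
        = F y ^ 2 + lam y ^ 2 := by
        rw [div_mul_div_comm, div_mul_div_comm, h4, ← add_div, mul_div_cancel₀ _ h3.ne', pow_two,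
          pow_two]
      rw [h7, ← h6]; ring
    exact mul_left_cancel₀ h3.ne' this

end Charts

end FormalGerm

namespace FormalGerm

open Kossowski

/-! ### Transfer of the surface to the manifold -/

section Surfaces

variable {M : Type*} [TopologicalSpace M] [ChartedSpace Plane M] [IsManifold (𝓡 2) ω M]
  {g : BilinField M} {ψ : OpenPartialHomeomorph M Plane} {p : M}

theorem comp_chart_symm {E : Type*} (F : Plane → E) {x : Plane} (hx : x ∈ ψ.target) :
    (F ∘ ψ) ∘ ψ.symm =ᶠ[𝓝 x] F := by
  filter_upwards [ψ.open_target.mem_nhds hx] with y hy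
  simp only [Function.comp_apply, ψ.right_inv hy]

theorem IsSurface.isFrontalGerm {α β σ : Plane → ℝ} {w μ : ℝ → ℝ} {F N : Plane → Space}
    (S : IsSurface α β σ w μ F N) (hψ : IsCoordAt ψ p) (hψ0 : ψ p = 0) :
    IsFrontalGerm (F ∘ ψ) (N ∘ ψ) p := by
  have h0 : ψ p ∈ ψ.target := ψ.map_source hψ.2
  have hc := contMDiffAt_comp_chart (F := F) hψ (by rw [hψ0]; exact S.analytic)
  refine ⟨hc, contMDiffAt_comp_chart hψ (by rw [hψ0]; exact S.analytic_normal), ?_, ?_⟩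
  · refine eventually_of_chart hψ.2 ?_
    filter_upwards [ψ.open_target.mem_nhds h0, (hψ0 ▸ S.unit : ∀ᶠ y in 𝓝 (ψ p), _)] with y h1 h2
    rw [Function.comp_apply, ψ.right_inv h1]
    rw [real_inner_self_eq_norm_sq] at h2
    nlinarith [norm_nonneg (N y)]
  · refine eventually_of_chart hψ.2 (P := fun q => ∀ v : TangentSpace (𝓡 2) q,
      inner ℝ (diff (F ∘ ψ) q v) ((N ∘ ψ) q) = 0) ?_
    filter_upwards [ψ.open_target.mem_nhds h0, eventually_mdifferentiableAt hψ.2 hc,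
      pd_congr 0 (comp_chart_symm F h0), pd_congr 1 (comp_chart_symm F h0),
      (hψ0 ▸ S.normal₀ : ∀ᶠ y in 𝓝 (ψ p), _), (hψ0 ▸ S.normal₁ : ∀ᶠ y in 𝓝 (ψ p), _)]
      with y h1 h2 h3 h4 h5 h6 v
    obtain ⟨a, rfl⟩ := coordMap_surjective hψ.1 h1 v
    rw [diff_coordMap hψ.1 h1 h2, h3, h4, Function.comp_apply, ψ.right_inv h1, inner_add_left,
      inner_smul_left, inner_smul_left, h5, h6]
    simp

theorem IsSurface.isFirstFundamentalForm {α β σ : Plane → ℝ} {w μ : ℝ → ℝ} {F N : Plane → Space}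
    (S : IsSurface α β σ w μ F N) (hg : IsKossowskiMetric g) (hψ : IsCoordAt ψ p) (hψ0 : ψ p = 0)
    (hcoef : ∀ᶠ y in 𝓝 0, α y * α y = coeff g ψ 0 0 y ∧ α y * β y = coeff g ψ 0 1 y ∧
        β y * β y + σ y * σ y = coeff g ψ 1 1 y) :
    IsFirstFundamentalForm g (F ∘ ψ) p := by
  have h0 : ψ p ∈ ψ.target := ψ.map_source hψ.2
  have hc := contMDiffAt_comp_chart (F := F) hψ (by rw [hψ0]; exact S.analytic)
  refine eventually_of_chart hψ.2 (P := fun q => ∀ v w : TangentSpace (𝓡 2) q,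
      inner ℝ (diff (F ∘ ψ) q v) (diff (F ∘ ψ) q w) = g q v w) ?_
  filter_upwards [ψ.open_target.mem_nhds h0, eventually_mdifferentiableAt hψ.2 hc,
    pd_congr 0 (comp_chart_symm F h0), pd_congr 1 (comp_chart_symm F h0),
    (hψ0 ▸ S.form₀₀ : ∀ᶠ y in 𝓝 (ψ p), _), (hψ0 ▸ S.form₀₁ : ∀ᶠ y in 𝓝 (ψ p), _),
    (hψ0 ▸ S.form₁₁ : ∀ᶠ y in 𝓝 (ψ p), _), (hψ0 ▸ hcoef : ∀ᶠ y in 𝓝 (ψ p), _)]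
    with y h1 h2 h3 h4 h5 h6 h7 h8 v w
  obtain ⟨a, rfl⟩ := coordMap_surjective hψ.1 h1 v
  obtain ⟨b, rfl⟩ := coordMap_surjective hψ.1 h1 w
  rw [diff_coordMap hψ.1 h1 h2, diff_coordMap hψ.1 h1 h2, h3, h4, metric_coordMap hg.symm,
    ← h8.1, ← h8.2.1, ← h8.2.2, ← h5, ← h6, ← h7]
  simp only [inner_add_left, inner_add_right, inner_smul_left, inner_smul_right,
    real_inner_comm (pd 0 F y) (pd 1 F y)]
  simp
  ring

theorem iteratedDeriv_comp_axis {F : Plane → Space} (hF : AnalyticAt ℝ F 0) {c : ℝ → Space}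
    (hc : c =ᶠ[𝓝 0] fun t => F (axis t)) :
    deriv c =ᶠ[𝓝 0] (fun t => pd 0 F (axis t)) ∧
    iteratedDeriv 2 c =ᶠ[𝓝 0] (fun t => pd 0 (pd 0 F) (axis t)) ∧
    iteratedDeriv 3 c =ᶠ[𝓝 0] fun t => pd 0 (pd 0 (pd 0 F)) (axis t) := by
  have h1 := hc.deriv.trans (deriv_comp_axis hF)
  have h2 := h1.deriv.trans (deriv_comp_axis (analyticAt_pd 0 hF))
  have h3 := h2.deriv.trans (deriv_comp_axis (analyticAt_pd 0 (analyticAt_pd 0 hF)))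
  have e2 : iteratedDeriv 2 c = deriv (deriv c) := by
    rw [iteratedDeriv_succ, iteratedDeriv_one]
  have e3 : iteratedDeriv 3 c = deriv (deriv (deriv c)) := by
    rw [iteratedDeriv_succ, e2]
  rw [e2, e3]
  exact ⟨h1, h2, h3⟩

theorem IsSurface.normalCurvature {α β σ : Plane → ℝ} {w μ : ℝ → ℝ} {F N : Plane → Space}
    (S : IsSurface α β σ w μ F N) (hα : ContinuousAt α 0) (hα0 : 0 < α 0) {γ : ℝ → M}
    (ha : ∀ᶠ t in 𝓝 0, ψ (γ t) = axis t) :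
    ∀ᶠ t in 𝓝 0, Kossowski.normalCurvature (F ∘ ψ) (N ∘ ψ) γ t = Real.exp (w t) := by
  have hc : (F ∘ ψ) ∘ γ =ᶠ[𝓝 0] fun t => F (axis t) := by
    filter_upwards [ha] with t ht
    simp only [Function.comp_apply, ht]
  obtain ⟨h1, h2, -⟩ := iteratedDeriv_comp_axis S.analytic hc
  filter_upwards [h1, h2, ha, S.curvature, tendsto_axis.eventually S.form₀₀,
    tendsto_axis.eventually (hα.eventually (lt_mem_nhds hα0))] with t h3 h4 h5 h6 h7 h8
  rw [Kossowski.normalCurvature, h3, h4, Function.comp_apply, h5, h6,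
    ← real_inner_self_eq_norm_sq, h7]
  exact mul_div_cancel_left₀ _ (mul_pos h8 h8).ne'

theorem IsSurface.torsion_eq {α β σ : Plane → ℝ} {w μ : ℝ → ℝ} {F N : Plane → Space}
    (S : IsSurface α β σ w μ F N) {γ : ℝ → M} (ha : ∀ᶠ t in 𝓝 0, ψ (γ t) = axis t) :
    ∀ᶠ t in 𝓝 0, Kossowski.torsion ((F ∘ ψ) ∘ γ) t = μ t := by
  have hc : (F ∘ ψ) ∘ γ =ᶠ[𝓝 0] fun t => F (axis t) := by
    filter_upwards [ha] with t ht
    simp only [Function.comp_apply, ht]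
  obtain ⟨h1, h2, h3⟩ := iteratedDeriv_comp_axis S.analytic hc
  filter_upwards [h1, h2, h3, S.torsion, S.cross_pos] with t h4 h5 h6 h7 h8
  rw [Kossowski.torsion, h4, h5, h6, h7]
  exact mul_div_cancel_right₀ _ h8.ne'

/-- Positive definiteness is an open condition, being the non-vanishing of the discriminant, and a
null vector of df would have length zero for the metric. -/
theorem isImmersionGerm_of_isRegularPoint (hg : IsKossowskiMetric g) {f : M → Space}
    (hf : IsFirstFundamentalForm g f p) (hp : IsRegularPoint g p) : IsImmersionGerm f p := by
  let φ := chartAt Plane p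
  have hφ : φ ∈ IsManifold.maximalAtlas (𝓡 2) ω M := IsManifold.chart_mem_maximalAtlas p
  have hpφ : p ∈ φ.source := mem_chart_source Plane p
  have h0 := φ.map_source hpφ
  have hd : discr g φ (φ p) ≠ 0 := by
    rw [← isRegularPoint_iff hg hφ h0, φ.left_inv hpφ]
    exact hp
  have hcont : ContinuousAt (discr g φ) (φ p) :=
    (((hg.analytic φ hφ 0 0 _ h0).mul (hg.analytic φ hφ 1 1 _ h0)).sub
      ((hg.analytic φ hφ 0 1 _ h0).pow 2)).continuousAt
  have hreg : ∀ᶠ q in 𝓝 p, IsRegularPoint g q := by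
    refine eventually_of_chart hpφ ?_
    filter_upwards [hcont.eventually_ne hd, φ.open_target.mem_nhds h0] with x h1 h2
    exact (isRegularPoint_iff hg hφ h2).2 h1
  filter_upwards [hreg, hf] with q h1 h2 v w hvw
  by_contra hne
  have h3 := h1 (v - w) (sub_ne_zero.2 hne)
  rw [← h2] at h3
  have h4 : diff f q (v - w) = 0 := by
    have h5 : diff f q (v - w) = diff f q v - diff f q w := map_sub (mfderiv (𝓡 2) (𝓡 3) f q) v w
    rw [h5, hvw, sub_self]
  rw [h4] at h3
  simp at h3

theorem contMDiffWithinAt_family {F : ℝ → Plane → Space} {I : Set ℝ} {s : ℝ}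
    (hψ : IsCoordAt ψ p) (hψ0 : ψ p = 0)
    (hF : AnalyticWithinAt ℝ (fun z : ℝ × Plane => F z.1 z.2) (I ×ˢ univ) (s, 0)) :
    ContMDiffWithinAt (𝓘(ℝ, ℝ).prod (𝓡 2)) (𝓡 3) ω
      (fun z : ℝ × M => F z.1 (ψ z.2)) (I ×ˢ univ) (s, p) := by
  have h1 : ContMDiffWithinAt 𝓘(ℝ, ℝ × Plane) (𝓡 3) ω (fun z : ℝ × Plane => F z.1 z.2)
      (I ×ˢ univ) (s, ψ p) := by
    rw [hψ0]
    exact contMDiffWithinAt_iff_contDiffWithinAt.2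
      (contDiffWithinAt_omega_iff_analyticWithinAt.2 hF)
  have h2 : ContMDiffAt (𝓘(ℝ, ℝ).prod (𝓡 2)) 𝓘(ℝ, ℝ × Plane) ω
      (fun z : ℝ × M => (z.1, ψ z.2)) (s, p) :=
    contMDiffAt_fst.prodMk_space
      (ContMDiffAt.comp (s, p) (contMDiffAt_of_mem_maximalAtlas hψ.1 hψ.2) contMDiffAt_snd)
  have h3 : MapsTo (fun z : ℝ × M => (z.1, ψ z.2)) (I ×ˢ univ) (I ×ˢ univ) :=
    fun z hz => ⟨hz.1, mem_univ _⟩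
  exact h1.comp (s, p) h2.contMDiffWithinAt h3

end Surfaces

end FormalGerm

namespace FormalGerm

open Kossowski

/-! ### Vector algebra behind Brioschi's formula -/

section VectorAlgebra

theorem det3_rotate (a b c : Space) : det3 a b c = inner ℝ a (cross b c) := by
  rw [det3_eq, inner_space]
  simp [cross]
  ring

theorem det3_rotate' (a b c : Space) : det3 a b c = inner ℝ (cross a b) c := by
  rw [det3_eq, inner_space]
  simp [cross]
  ring

/-- Both vectors lie in the plane orthogonal to n, so their vector product is parallel to n. They
may be linearly dependent, as happens at singular points. -/
theorem cross_eq_smul {u v n : Space} (hn : inner ℝ n n = (1 : ℝ)) (hu : inner ℝ u n = (0 : ℝ))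
    (hv : inner ℝ v n = (0 : ℝ)) : cross u v = det3 u v n • n := by
  rw [inner_space] at hn hu hv
  rw [det3_eq]
  ext k
  fin_cases k
  · simp [cross]
    linear_combination (-(u 1 * v 2 - u 2 * v 1)) * hn - (n 1 * u 2 - n 2 * u 1) * hv
      + (n 1 * v 2 - n 2 * v 1) * hu
  · simp [cross]
    linear_combination (-(u 2 * v 0 - u 0 * v 2)) * hn - (n 2 * u 0 - n 0 * u 2) * hv
      + (n 2 * v 0 - n 0 * v 2) * hu
  · simp [cross]
    linear_combination (-(u 0 * v 1 - u 1 * v 0)) * hn - (n 0 * u 1 - n 1 * u 0) * hv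
      + (n 0 * v 1 - n 1 * v 0) * hu

theorem inner_cross_cross (a b c d : Space) : inner ℝ (cross a b) (cross c d)
    = inner ℝ a c * inner ℝ b d - inner ℝ a d * inner ℝ b c := by
  simp only [inner_space]
  simp [cross]
  ring

theorem det3_mul_det3 (a u v c : Space) : det3 a u v * det3 c u v = Matrix.det
    !![inner ℝ a c, inner ℝ a u, inner ℝ a v; inner ℝ u c, inner ℝ u u, inner ℝ u v;
      inner ℝ v c, inner ℝ v u, inner ℝ v v] := by
  rw [Matrix.det_fin_three]
  simp only [det3_eq, inner_space]
  simp
  ring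

/-- Brioschi's determinants in terms of the second fundamental form. -/
theorem brioschi_eq {a b c u v n nu nv : Space} (hn : inner ℝ n n = (1 : ℝ))
    (hu : inner ℝ u n = (0 : ℝ)) (hv : inner ℝ v n = (0 : ℝ))
    (ha : inner ℝ a n = -inner ℝ u nu) (hb : inner ℝ b n = -inner ℝ u nv)
    (hb' : inner ℝ b n = -inner ℝ v nu) (hc : inner ℝ c n = -inner ℝ v nv) :
    Matrix.det !![inner ℝ a c - inner ℝ b b, inner ℝ a u, inner ℝ a v;
        inner ℝ u c, inner ℝ u u, inner ℝ u v; inner ℝ v c, inner ℝ v u, inner ℝ v v]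
      - Matrix.det !![0, inner ℝ b u, inner ℝ b v; inner ℝ u b, inner ℝ u u, inner ℝ u v;
        inner ℝ v b, inner ℝ v u, inner ℝ v v]
      = det3 u v n ^ 3 * det3 nu nv n := by
  have h1 := det3_mul_det3 a u v c
  have h2 := det3_mul_det3 b u v b
  -- With u × v = Λn, Gram determinants of triples containing u and v become Λ² times products of
  -- normal components.
  have h3 : ∀ x, det3 x u v = det3 u v n * inner ℝ x n := fun x => by
    rw [det3_rotate, cross_eq_smul hn hu hv, inner_smul_right]
  rw [h3, h3] at h1
  rw [h3] at h2
  have h4 := inner_cross_cross u v nu nv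
  rw [cross_eq_smul hn hu hv, inner_smul_left, real_inner_comm, ← det3_rotate'] at h4
  simp only [conj_trivial] at h4
  -- The determinant of the second fundamental form is (u × v) · (ν_u × ν_v), which supplies the
  -- third factor Λ.
  have h5 : inner ℝ a n * inner ℝ c n - inner ℝ b n * inner ℝ b n
      = det3 u v n * det3 nu nv n := by
    rw [h4]
    nth_rewrite 1 [hb]
    rw [hb', ha, hc]
    ring
  rw [Matrix.det_fin_three] at h1 h2 ⊢
  rw [Matrix.det_fin_three]
  simp at h1 h2 ⊢
  linear_combination -h1 + h2 + det3 u v n ^ 2 * h5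

end VectorAlgebra

/-! ### Frontals in the coordinate plane -/

section Frontals

theorem pd_inner {A B : Plane → Space} {x : Plane} (i : Fin 2) (hA : AnalyticAt ℝ A x)
    (hB : AnalyticAt ℝ B x) : pd i (fun y => (inner ℝ (A y) (B y) : ℝ)) x
      = inner ℝ (A x) (pd i B x) + inner ℝ (pd i A x) (B x) := by
  have h := (hA.differentiableAt.hasFDerivAt.inner ℝ hB.differentiableAt.hasFDerivAt).fderiv
  rw [pd, h]
  simp [pd]

theorem pd_comm {A : Plane → Space} {x : Plane} (hA : AnalyticAt ℝ A x) (i j : Fin 2) :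
    pd i (pd j A) x = pd j (pd i A) x := by
  have key : ∀ k l, pd k (pd l A) x
      = fderiv ℝ (fderiv ℝ A) x (EuclideanSpace.single k 1) (EuclideanSpace.single l 1) := by
    intro k l
    have h : HasFDerivAt (pd l A) _ x :=
      hA.fderiv.differentiableAt.hasFDerivAt.clm_apply
        (hasFDerivAt_const (EuclideanSpace.single l (1 : ℝ)) x)
    rw [pd, h.fderiv]
    simp
  have hs : IsSymmSndFDerivAt ℝ A x :=
    (hA.contDiffAt (n := ω)).isSymmSndFDerivAt (by simp)
  rw [key, key]
  exact hs _ _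

/-- A frontal in the coordinate plane with a given first fundamental form. -/
structure IsPlaneFrontal (E F G : Plane → ℝ) (f N : Plane → Space) (x₀ : Plane) : Prop where
  analytic : AnalyticAt ℝ f x₀
  analytic_normal : AnalyticAt ℝ N x₀
  form₀₀ : E =ᶠ[𝓝 x₀] fun x => inner ℝ (pd 0 f x) (pd 0 f x)
  form₀₁ : F =ᶠ[𝓝 x₀] fun x => inner ℝ (pd 0 f x) (pd 1 f x)
  form₁₁ : G =ᶠ[𝓝 x₀] fun x => inner ℝ (pd 1 f x) (pd 1 f x)
  unit : ∀ᶠ x in 𝓝 x₀, inner ℝ (N x) (N x) = (1 : ℝ)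
  normal₀ : ∀ᶠ x in 𝓝 x₀, inner ℝ (pd 0 f x) (N x) = (0 : ℝ)
  normal₁ : ∀ᶠ x in 𝓝 x₀, inner ℝ (pd 1 f x) (N x) = (0 : ℝ)

variable {E F G : Plane → ℝ} {f N : Plane → Space} {x₀ : Plane}

/-- Differentiate the orthogonality of f_u and f_v to the normal; the mixed component appears twice
because f_uv = f_vu. -/
theorem IsPlaneFrontal.second_form (h : IsPlaneFrontal E F G f N x₀) : ∀ᶠ x in 𝓝 x₀,
    inner ℝ (pd 0 (pd 0 f) x) (N x) = (-inner ℝ (pd 0 f x) (pd 0 N x) : ℝ) ∧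
    inner ℝ (pd 1 (pd 0 f) x) (N x) = (-inner ℝ (pd 0 f x) (pd 1 N x) : ℝ) ∧
    inner ℝ (pd 1 (pd 0 f) x) (N x) = (-inner ℝ (pd 1 f x) (pd 0 N x) : ℝ) ∧
    inner ℝ (pd 1 (pd 1 f) x) (N x) = (-inner ℝ (pd 1 f x) (pd 1 N x) : ℝ) := by
  have z : ∀ i (x : Plane), pd i (fun _ : Plane => (0 : ℝ)) x = 0 := fun i x => by simp [pd]
  filter_upwards [h.analytic.eventually_analyticAt, h.analytic_normal.eventually_analyticAt,
    pd_congr 0 h.normal₀, pd_congr 1 h.normal₀, pd_congr 0 h.normal₁, pd_congr 1 h.normal₁]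
    with x af aN h1 h2 h3 h4
  rw [pd_inner _ (analyticAt_pd _ af) aN, z] at h1 h2 h3 h4
  rw [pd_comm af 0 1] at h3
  refine ⟨by linarith, by linarith, by linarith, by linarith⟩

theorem IsPlaneFrontal.discr_eq (h : IsPlaneFrontal E F G f N x₀) : ∀ᶠ x in 𝓝 x₀,
    E x * G x - F x ^ 2 = det3 (pd 0 f x) (pd 1 f x) (N x) ^ 2 := by
  filter_upwards [h.form₀₀, h.form₀₁, h.form₁₁, h.unit, h.normal₀, h.normal₁]
    with x h1 h2 h3 h4 h5 h6
  rw [h1, h2, h3]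
  have h7 := inner_cross_cross (pd 0 f x) (pd 1 f x) (pd 0 f x) (pd 1 f x)
  rw [cross_eq_smul h4 h5 h6, inner_smul_left, inner_smul_right, h4,
    real_inner_comm (pd 0 f x) (pd 1 f x)] at h7
  simp only [conj_trivial] at h7
  linarith

/-- Expressing the derivatives of E, F, G by scalar products of derivatives of f cancels the third
derivatives. No division occurs, so the identity also holds at singular points. -/
theorem IsPlaneFrontal.brioschi (h : IsPlaneFrontal E F G f N x₀) : ∀ᶠ x in 𝓝 x₀,
    Matrix.det
      !![-(1 / 2) * pd 1 (pd 1 E) x + pd 1 (pd 0 F) x - (1 / 2) * pd 0 (pd 0 G) x,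
          (1 / 2) * pd 0 E x, pd 0 F x - (1 / 2) * pd 1 E x;
         pd 1 F x - (1 / 2) * pd 0 G x, E x, F x;
         (1 / 2) * pd 1 G x, F x, G x]
    - Matrix.det
      !![0, (1 / 2) * pd 1 E x, (1 / 2) * pd 0 G x;
         (1 / 2) * pd 1 E x, E x, F x;
         (1 / 2) * pd 0 G x, F x, G x]
    = det3 (pd 0 f x) (pd 1 f x) (N x) ^ 3 * det3 (pd 0 N x) (pd 1 N x) (N x) := by
  have ev := h.analytic.eventually_analyticAt
  have E0 : pd 0 E =ᶠ[𝓝 x₀] fun x => 2 * inner ℝ (pd 0 (pd 0 f) x) (pd 0 f x) := by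
    filter_upwards [pd_congr 0 h.form₀₀, ev] with x h1 af
    rw [h1, pd_inner _ (analyticAt_pd _ af) (analyticAt_pd _ af),
      real_inner_comm (pd 0 f x)]
    ring
  have E1 : pd 1 E =ᶠ[𝓝 x₀] fun x => 2 * inner ℝ (pd 1 (pd 0 f) x) (pd 0 f x) := by
    filter_upwards [pd_congr 1 h.form₀₀, ev] with x h1 af
    rw [h1, pd_inner _ (analyticAt_pd _ af) (analyticAt_pd _ af),
      real_inner_comm (pd 0 f x)]
    ring
  have G0 : pd 0 G =ᶠ[𝓝 x₀] fun x => 2 * inner ℝ (pd 1 (pd 0 f) x) (pd 1 f x) := by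
    filter_upwards [pd_congr 0 h.form₁₁, ev] with x h1 af
    rw [h1, pd_inner _ (analyticAt_pd _ af) (analyticAt_pd _ af),
      pd_comm af 0 1, real_inner_comm (pd 1 f x)]
    ring
  have G1 : pd 1 G =ᶠ[𝓝 x₀] fun x => 2 * inner ℝ (pd 1 (pd 1 f) x) (pd 1 f x) := by
    filter_upwards [pd_congr 1 h.form₁₁, ev] with x h1 af
    rw [h1, pd_inner _ (analyticAt_pd _ af) (analyticAt_pd _ af),
      real_inner_comm (pd 1 f x)]
    ring
  have F0 : pd 0 F =ᶠ[𝓝 x₀] fun x => inner ℝ (pd 0 (pd 0 f) x) (pd 1 f x)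
      + inner ℝ (pd 1 (pd 0 f) x) (pd 0 f x) := by
    filter_upwards [pd_congr 0 h.form₀₁, ev] with x h1 af
    rw [h1, pd_inner _ (analyticAt_pd _ af) (analyticAt_pd _ af), pd_comm af 0 1,
      real_inner_comm (pd 0 f x)]
    ring
  have F1 : pd 1 F =ᶠ[𝓝 x₀] fun x => inner ℝ (pd 1 (pd 0 f) x) (pd 1 f x)
      + inner ℝ (pd 0 f x) (pd 1 (pd 1 f) x) := by
    filter_upwards [pd_congr 1 h.form₀₁, ev] with x h1 af
    rw [h1, pd_inner _ (analyticAt_pd _ af) (analyticAt_pd _ af)]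
    ring
  have mul2 : ∀ (i : Fin 2) (A B : Plane → Space) (x : Plane), AnalyticAt ℝ A x →
      AnalyticAt ℝ B x → pd i (fun y => 2 * (inner ℝ (A y) (B y) : ℝ)) x
        = 2 * (inner ℝ (A x) (pd i B x) + inner ℝ (pd i A x) (B x)) := by
    intro i A B x hA hB
    rw [← pd_inner i hA hB]
    have h1 := ((hA.differentiableAt.inner ℝ hB.differentiableAt).hasFDerivAt.const_mul 2).fderiv
    rw [pd, h1, pd]
    rfl
  have add2 : ∀ (i : Fin 2) (A B C D : Plane → Space) (x : Plane), AnalyticAt ℝ A x →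
      AnalyticAt ℝ B x → AnalyticAt ℝ C x → AnalyticAt ℝ D x →
      pd i (fun y => (inner ℝ (A y) (B y) : ℝ) + inner ℝ (C y) (D y)) x
        = (inner ℝ (A x) (pd i B x) + inner ℝ (pd i A x) (B x))
          + (inner ℝ (C x) (pd i D x) + inner ℝ (pd i C x) (D x)) := by
    intro i A B C D x hA hB hC hD
    rw [← pd_inner i hA hB, ← pd_inner i hC hD]
    have h1 := ((hA.differentiableAt.inner ℝ hB.differentiableAt).hasFDerivAt.fun_add
      (hC.differentiableAt.inner ℝ hD.differentiableAt).hasFDerivAt).fderiv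
    rw [pd, h1, pd]
    rfl
  filter_upwards [ev, h.form₀₀, h.form₀₁, h.form₁₁, E0, E1, F0, F1, G0, G1, pd_congr 1 E1,
    pd_congr 1 F0, pd_congr 0 G0, h.second_form, h.unit, h.normal₀, h.normal₁]
    with x af e0 f0 g0 e1 e2 f1 f2 g1 g2 e3 f3 g3 hs hn hu hv
  have a0 := analyticAt_pd 0 af
  have a1 := analyticAt_pd 1 af
  have a00 := analyticAt_pd 0 a0
  have a10 := analyticAt_pd 1 a0
  rw [mul2 1 _ _ x a10 a0] at e3
  rw [add2 1 _ _ _ _ x a00 a1 a10 a0] at f3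
  rw [mul2 0 _ _ x a10 a1, pd_comm af 0 1, pd_comm a0 0 1] at g3
  rw [e3, f3, g3, e1, e2, f1, f2, g1, g2, e0, f0, g0]
  rw [← brioschi_eq hn hu hv hs.1 hs.2.1 hs.2.2.1 hs.2.2.2]
  congr 2
  · congr 1
    simp only [real_inner_comm (pd 0 f x) (pd 1 f x), real_inner_comm (pd 1 f x) (pd 1 (pd 1 f) x)]
    ext i j
    fin_cases i <;> fin_cases j <;> simp <;> ring
  · simp only [real_inner_comm (pd 0 f x) (pd 1 f x), real_inner_comm (pd 1 (pd 0 f) x) (pd 1 f x),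
      real_inner_comm (pd 1 (pd 0 f) x) (pd 0 f x)]
    ext i j
    fin_cases i <;> fin_cases j <;> simp

end Frontals

end FormalGerm

/-! ### Singular points: non-degeneracy, wave fronts, limiting normal curvature -/

namespace FormalGerm

open Kossowski

/-- Equal squares mean equal absolute values, so being o(|y − x|) passes from one function to the
other. This avoids deciding the sign in λ = ±Λ. -/
theorem fderiv_eq_zero_of_sq_eventuallyEq {h h' : Plane → ℝ} {x : Plane}
    (hh : DifferentiableAt ℝ h x) (h0 : h x = 0) (h0' : h' x = 0)
    (e : ∀ᶠ y in 𝓝 x, h' y ^ 2 = h y ^ 2) (hd : fderiv ℝ h x = 0) : fderiv ℝ h' x = 0 := by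
  have h1 := hh.hasFDerivAt
  rw [hd, hasFDerivAt_iff_isLittleO] at h1
  refine HasFDerivAt.fderiv ?_
  rw [hasFDerivAt_iff_isLittleO]
  simp only [h0, h0', sub_zero, zero_apply] at h1 ⊢
  refine Asymptotics.IsLittleO.congr' (Asymptotics.IsLittleO.norm_left h1).norm_left ?_
    EventuallyEq.rfl |>.of_norm_left
  filter_upwards [e] with y hy
  rw [norm_norm, Real.norm_eq_abs, Real.norm_eq_abs]
  exact (sq_eq_sq_iff_abs_eq_abs _ _).1 hy.symm

theorem eq_zero_of_det3_ne_zero {u v n : Space} (h : det3 u v n ≠ 0) {s t : ℝ}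
    (e : s • u + t • v = 0) : s = 0 ∧ t = 0 := by
  have e0 := congrArg (fun z : Space => z 0) e
  have e1 := congrArg (fun z : Space => z 1) e
  have e2 := congrArg (fun z : Space => z 2) e
  simp at e0 e1 e2
  have hs : s * det3 u v n = 0 := by
    rw [det3_eq]
    linear_combination e0 * (v 1 * n 2 - v 2 * n 1) - e1 * (v 0 * n 2 - v 2 * n 0)
      + e2 * (v 0 * n 1 - v 1 * n 0)
  have ht : t * det3 u v n = 0 := by
    rw [det3_eq]
    linear_combination -(e0 * (u 1 * n 2 - u 2 * n 1)) + e1 * (u 0 * n 2 - u 2 * n 0)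
      - e2 * (u 0 * n 1 - u 1 * n 0)
  exact ⟨(mul_eq_zero.1 hs).resolve_right h, (mul_eq_zero.1 ht).resolve_right h⟩

theorem analyticAt_det3 {E : Type*} [NormedAddCommGroup E] [NormedSpace ℝ E]
    {a b c : E → Space} {x : E} (ha : AnalyticAt ℝ a x) (hb : AnalyticAt ℝ b x)
    (hc : AnalyticAt ℝ c x) : AnalyticAt ℝ (fun y => det3 (a y) (b y) (c y)) x := by
  simp only [det3_eq]
  have A := analyticAt_coord ha
  have B := analyticAt_coord hb
  have C := analyticAt_coord hc
  exact (((A 0).mul (((B 1).mul (C 2)).sub ((B 2).mul (C 1)))).sub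
    ((A 1).mul (((B 0).mul (C 2)).sub ((B 2).mul (C 0))))).add
    ((A 2).mul (((B 0).mul (C 1)).sub ((B 1).mul (C 0))))

section

variable {M : Type*} [TopologicalSpace M] [ChartedSpace Plane M] [IsManifold (𝓡 2) ω M]
  {g : BilinField M} {φ : OpenPartialHomeomorph M Plane} {p : M} {f ν : M → Space}

theorem diff_coordVec {f : M → Space} (hφ : φ ∈ IsManifold.maximalAtlas (𝓡 2) ω M) {x : Plane}
    (hx : x ∈ φ.target) (hf : MDifferentiableAt (𝓡 2) (𝓡 3) f (φ.symm x)) (i : Fin 2) :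
    diff f (φ.symm x) (coordVec φ i x) = pd i (f ∘ φ.symm) x := by
  rw [coordVec_eq, diff_coordMap hφ hx hf]
  fin_cases i <;> simp

theorem isPlaneFrontal (hφ : IsCoordAt φ p) (hf : IsFrontalGerm f ν p)
    (hI : IsFirstFundamentalForm g f p) :
    IsPlaneFrontal (coeff g φ 0 0) (coeff g φ 0 1) (coeff g φ 1 1) (f ∘ φ.symm) (ν ∘ φ.symm)
      (φ p) := by
  have hx := φ.open_target.mem_nhds (φ.map_source hφ.2)
  have hm := eventually_mdifferentiableAt hφ.2 hf.analytic
  have hI' := eventually_in_chart hφ.2 hI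
  have ho' := eventually_in_chart hφ.2 hf.orthogonal
  have key : ∀ i j, coeff g φ i j =ᶠ[𝓝 (φ p)]
      fun x => inner ℝ (pd i (f ∘ φ.symm) x) (pd j (f ∘ φ.symm) x) := by
    intro i j
    filter_upwards [hx, hm, hI'] with x h1 h2 h3
    rw [← diff_coordVec hφ.1 h1 h2, ← diff_coordVec hφ.1 h1 h2, h3]
    rfl
  have key' : ∀ i, ∀ᶠ x in 𝓝 (φ p),
      inner ℝ (pd i (f ∘ φ.symm) x) ((ν ∘ φ.symm) x) = (0 : ℝ) := by
    intro i
    filter_upwards [hx, hm, ho'] with x h1 h2 h3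
    rw [← diff_coordVec hφ.1 h1 h2]
    exact h3 _
  refine ⟨analyticAt_comp_symm hφ hf.analytic, analyticAt_comp_symm hφ hf.analytic_normal,
    key 0 0, key 0 1, key 1 1, ?_, key' 0, key' 1⟩
  filter_upwards [eventually_in_chart hφ.2 hf.unit] with x hx
  rw [real_inner_self_eq_norm_sq, Function.comp_apply, hx]
  norm_num

/-- Both det(f_u, f_v, ν) and the density of the metric square to EG − F², and the latter has a
non-zero differential in every chart. -/
theorem isNondegenerateSingularPoint (hg : IsKossowskiMetric g) (hp : IsSemidefinitePoint g p)
    (hf : IsFrontalGerm f ν p) (hI : IsFirstFundamentalForm g f p) :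
    IsNondegenerateSingularPoint f ν p := by
  intro φ hφ
  have h := isPlaneFrontal hφ hf hI
  obtain ⟨lam, h1, h2, h3, h4⟩ := exists_density hg hp hφ
  have e : ∀ᶠ x in 𝓝 (φ p), lam x ^ 2 = frontalDensity f ν φ x ^ 2 := by
    filter_upwards [h.discr_eq, h2] with x h5 h6
    rw [← h6]
    exact h5
  have h0 : frontalDensity f ν φ (φ p) = 0 := by
    have := e.self_of_nhds
    rw [h3] at this
    exact (pow_eq_zero_iff two_ne_zero).1 (by rw [← this]; simp)
  have han : AnalyticAt ℝ (frontalDensity f ν φ) (φ p) :=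
    analyticAt_det3 (analyticAt_pd 0 h.analytic) (analyticAt_pd 1 h.analytic) h.analytic_normal
  exact ⟨h0, fun h5 => h4 (fderiv_eq_zero_of_sq_eventuallyEq han.differentiableAt h0 h3 e h5)⟩

/-- At regular points the Euler density is ±det(ν_u, ν_v, ν). Regular points accumulate at p, so by
continuity the squares agree at p, where the Euler density does not vanish. -/
theorem exists_det3_normal_ne_zero (hg : IsKossowskiMetric g) (hp : IsSemidefinitePoint g p)
    (hpar : IsNonParabolic g p) (hf : IsFrontalGerm f ν p) (hI : IsFirstFundamentalForm g f p) :
    ∃ φ : OpenPartialHomeomorph M Plane, IsCoordAt φ p ∧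
      det3 (pd 0 (ν ∘ φ.symm) (φ p)) (pd 1 (ν ∘ φ.symm) (φ p)) (ν (φ.symm (φ p))) ≠ 0 := by
  obtain ⟨φ, hφ, lam, Om, hlam, hOm, hne⟩ := hpar
  refine ⟨φ, hφ, fun hΨ => ?_⟩
  have hx := φ.map_source hφ.2
  have h := isPlaneFrontal hφ hf hI
  obtain ⟨lam', -, h2, -, h4⟩ := exists_density hg hp hφ
  -- The density witnessing non-parabolicity carries no condition on its differential, so the
  -- accumulation of regular points is taken from another density, whose differential is non-zero.
  have hfreq : ∃ᶠ x in 𝓝 (φ p), lam x ≠ 0 := by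
    intro h0
    refine h4 ?_
    have : lam' =ᶠ[𝓝 (φ p)] fun _ => 0 := by
      filter_upwards [h0, h2, φ.open_target.mem_nhds hx] with x h5 h6 h7
      rw [hlam.2 x h7, not_not.1 h5] at h6
      exact (pow_eq_zero_iff two_ne_zero).1 (by rw [← h6]; simp)
    rw [this.fderiv_eq]
    simp
  have hN := h.analytic_normal
  have aΨ : AnalyticAt ℝ (fun x => det3 (pd 0 (ν ∘ φ.symm) x) (pd 1 (ν ∘ φ.symm) x)
      ((ν ∘ φ.symm) x)) (φ p) := analyticAt_det3 (analyticAt_pd 0 hN) (analyticAt_pd 1 hN) hN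
  have hc := ((hOm.1 _ hx).continuousAt.pow 2).sub (aΨ.continuousAt.pow 2)
  have hne' : Om (φ p) ^ 2 - det3 (pd 0 (ν ∘ φ.symm) (φ p)) (pd 1 (ν ∘ φ.symm) (φ p))
      ((ν ∘ φ.symm) (φ p)) ^ 2 ≠ 0 := by
    rw [Function.comp_apply, hΨ]
    simpa using hne
  refine hfreq ?_
  filter_upwards [h.brioschi, h.discr_eq, hc.eventually_ne hne', φ.open_target.mem_nhds hx]
    with x h5 h6 h7 h8 h9
  refine h7 ?_
  have hd : discr g φ x = lam x ^ 2 := hlam.2 x h8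
  have hreg : IsRegularPoint g (φ.symm x) := by
    rw [isRegularPoint_iff hg hφ.1 h8, hd]
    exact pow_ne_zero 2 h9
  have h10 := hOm.2 x h8 hreg
  have h6' : lam x ^ 2 = det3 (pd 0 (f ∘ φ.symm) x) (pd 1 (f ∘ φ.symm) x)
      ((ν ∘ φ.symm) x) ^ 2 := by
    rw [← hd]
    exact h6
  rw [gaussCurvature, hd] at h10
  rw [h5] at h10
  show Om x ^ 2 - det3 (pd 0 (ν ∘ φ.symm) x) (pd 1 (ν ∘ φ.symm) x) ((ν ∘ φ.symm) x) ^ 2 = 0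
  set Λ := det3 (pd 0 (f ∘ φ.symm) x) (pd 1 (f ∘ φ.symm) x) ((ν ∘ φ.symm) x)
  set Ψ := det3 (pd 0 (ν ∘ φ.symm) x) (pd 1 (ν ∘ φ.symm) x) ((ν ∘ φ.symm) x)
  have hl : lam x ^ 8 ≠ 0 := pow_ne_zero 8 h9
  -- Here K = Λ³Ψ/λ⁴. Squaring Ωλ⁴ = Λ³Ψλ and using Λ² = λ² removes the sign ambiguity.
  have h11 : Om x * (lam x ^ 2) ^ 2 = Λ ^ 3 * Ψ * lam x := by
    rw [h10]
    field_simp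
  have h12 : lam x ^ 8 * (Om x ^ 2 - Ψ ^ 2) = 0 := by
    have h13 : (Om x * (lam x ^ 2) ^ 2) ^ 2 = (Λ ^ 2) ^ 3 * Ψ ^ 2 * lam x ^ 2 := by
      rw [h11]; ring
    rw [← h6'] at h13
    linear_combination h13
  exact (mul_eq_zero.1 h12).resolve_left hl

/-- The unit normal alone is already an immersion near p, because ν_u, ν_v, ν are linearly
independent at p. -/
theorem isWaveFrontGerm (hg : IsKossowskiMetric g) (hp : IsSemidefinitePoint g p)
    (hpar : IsNonParabolic g p) (hf : IsFrontalGerm f ν p) (hI : IsFirstFundamentalForm g f p) :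
    IsWaveFrontGerm f ν p := by
  obtain ⟨φ, hφ, hne⟩ := exists_det3_normal_ne_zero hg hp hpar hf hI
  have hx := φ.map_source hφ.2
  have hN := analyticAt_comp_symm hφ hf.analytic_normal
  have aΨ : AnalyticAt ℝ (fun x => det3 (pd 0 (ν ∘ φ.symm) x) (pd 1 (ν ∘ φ.symm) x)
      ((ν ∘ φ.symm) x)) (φ p) := analyticAt_det3 (analyticAt_pd 0 hN) (analyticAt_pd 1 hN) hN
  refine eventually_of_chart hφ.2 (P := fun q => Function.Injective
    fun v : TangentSpace (𝓡 2) q => (diff f q v, diff ν q v)) ?_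
  filter_upwards [aΨ.continuousAt.eventually_ne hne, φ.open_target.mem_nhds hx,
    eventually_mdifferentiableAt hφ.2 hf.analytic_normal] with x h1 h2 h3 v w hvw
  obtain ⟨a, rfl⟩ := coordMap_surjective hφ.1 h2 v
  obtain ⟨b, rfl⟩ := coordMap_surjective hφ.1 h2 w
  have h4 := (Prod.mk.inj hvw).2
  rw [diff_coordMap hφ.1 h2 h3, diff_coordMap hφ.1 h2 h3] at h4
  have h5 := eq_zero_of_det3_ne_zero h1 (s := a 0 - b 0) (t := a 1 - b 1) (by
    rw [sub_smul, sub_smul, sub_add_sub_comm, h4, sub_self])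
  have h6 : a = b := by
    ext k
    fin_cases k
    exacts [sub_eq_zero.1 h5.1, sub_eq_zero.1 h5.2]
  rw [h6]

/-- In adjusted coordinates f_v(p) = 0 kills the contributions of ∂_v, so the normal acceleration of
the image of γ at p is u'(0)² f_uu · ν. Vanishing of the limiting normal curvature would force that
of the normal curvature of this curve. -/
theorem limitingNormalCurvature_ne_zero (hf : IsFrontalGerm f ν p)
    (hI : IsFirstFundamentalForm g f p) {γ : ℝ → M}
    (hγ : ContMDiffAt 𝓘(ℝ, ℝ) (𝓡 2) ω γ 0) (hγp : γ 0 = p)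
    (hn : normalCurvature f ν γ 0 ≠ 0) (hφ : IsAdjustedCoord f φ p) :
    limitingNormalCurvature f ν φ p ≠ 0 := by
  obtain ⟨hφ, hφ0, hv⟩ := hφ
  have h := isPlaneFrontal hφ hf hI
  have hγφ : γ 0 ∈ φ.source := by rw [hγp]; exact hφ.2
  have hs : φ.symm (φ p) = p := φ.left_inv hφ.2
  let F := f ∘ φ.symm
  let N := ν ∘ φ.symm
  let c : ℝ → Plane := φ ∘ γ
  have hc : AnalyticAt ℝ c 0 := (contMDiffAt_iff_contDiffAt.1
    ((contMDiffAt_of_mem_maximalAtlas hφ.1 hγφ).comp 0 hγ)).analyticAt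
  have hc0 : c 0 = φ p := by simp only [c, Function.comp_apply, hγp]
  have htc : Tendsto c (𝓝 0) (𝓝 (φ p)) := by
    have := hc.continuousAt.tendsto
    rwa [hc0] at this
  have e : f ∘ γ =ᶠ[𝓝 0] F ∘ c := by
    filter_upwards [hγ.continuousAt.eventually (φ.open_source.mem_nhds hγφ)] with t ht
    simp only [F, c, Function.comp_apply, φ.left_inv ht]
  have hdF : deriv (F ∘ c) =ᶠ[𝓝 0] fun t => fderiv ℝ F (c t) (deriv c t) := by
    filter_upwards [htc.eventually h.analytic.eventually_analyticAt, hc.eventually_analyticAt]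
      with t h1 h2
    exact (h1.differentiableAt.hasFDerivAt.comp_hasDerivAt t
      h2.differentiableAt.hasDerivAt).deriv
  have hNc : HasDerivAt (N ∘ c) (fderiv ℝ N (φ p) (deriv c 0)) 0 := by
    have h1 : HasFDerivAt N (fderiv ℝ N (φ p)) (c 0) := by
      rw [hc0]; exact h.analytic_normal.differentiableAt.hasFDerivAt
    exact h1.comp_hasDerivAt 0 hc.differentiableAt.hasDerivAt
  have hFc : AnalyticAt ℝ (F ∘ c) 0 :=
    AnalyticAt.comp (g := F) (by rw [hc0]; exact h.analytic) hc
  have horth : (fun t => (inner ℝ (deriv (F ∘ c) t) ((N ∘ c) t) : ℝ)) =ᶠ[𝓝 0] fun _ => 0 := by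
    filter_upwards [hdF, htc.eventually h.normal₀, htc.eventually h.normal₁] with t h1 h2 h3
    rw [h1, fderiv_plane, inner_add_left, inner_smul_left, inner_smul_left]
    show _ * inner ℝ (pd 0 (f ∘ φ.symm) (c t)) ((ν ∘ φ.symm) (c t))
      + _ * inner ℝ (pd 1 (f ∘ φ.symm) (c t)) ((ν ∘ φ.symm) (c t)) = 0
    rw [h2, h3]
    simp
  have hd2 := (hFc.deriv.differentiableAt.hasDerivAt.inner ℝ hNc).deriv
  have hd2' := horth.deriv_eq
  rw [hd2'] at hd2
  simp only [deriv_const] at hd2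
  have hsf := h.second_form.self_of_nhds
  have hNp : (N ∘ c) 0 = ν p := by
    simp only [N, c, Function.comp_apply, hγp, hs]
  have hNp' : (ν ∘ φ.symm) (φ p) = ν p := by rw [Function.comp_apply, hs]
  have hdF0 : deriv (F ∘ c) 0 = deriv c 0 0 • pd 0 F (φ p) := by
    have h1 : deriv (F ∘ c) 0 = fderiv ℝ F (c 0) (deriv c 0) := hdF.self_of_nhds
    have h2 : pd 1 F (φ p) = 0 := hv
    rw [hc0, fderiv_plane, h2, smul_zero, add_zero] at h1
    exact h1
  -- Differentiating the orthogonality of the velocity to ν expresses the normal acceleration by dν.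
  -- The mixed term f_u · ν_v equals f_v · ν_u, which is zero at p.
  have hacc : (inner ℝ (deriv (deriv (F ∘ c)) 0) (ν p) : ℝ)
      = deriv c 0 0 ^ 2 * inner ℝ (pd 0 (pd 0 F) (φ p)) (ν p) := by
    obtain ⟨s1, s2, s3, -⟩ := hsf
    rw [s2] at s3
    have h2 : pd 1 (f ∘ φ.symm) (φ p) = 0 := hv
    rw [h2, inner_zero_left] at s3
    rw [hNp'] at s1
    rw [hNp, hdF0, fderiv_plane, inner_smul_left, inner_add_right, inner_smul_right,
      inner_smul_right] at hd2
    simp only [conj_trivial] at hd2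
    linear_combination -hd2 - deriv c 0 0 ^ 2 * s1 + deriv c 0 0 * deriv c 0 1 * s3
  have hnc : normalCurvature f ν γ 0 = inner ℝ (deriv (deriv (F ∘ c)) 0) (ν p)
      / ‖deriv (F ∘ c) 0‖ ^ 2 := by
    have e2 : iteratedDeriv 2 (f ∘ γ) = deriv (deriv (f ∘ γ)) := by
      rw [iteratedDeriv_succ, iteratedDeriv_one]
    rw [normalCurvature, e2, e.deriv.deriv_eq, e.deriv_eq, hγp]
  rw [hnc, hacc, hdF0] at hn
  unfold limitingNormalCurvature
  intro h0
  refine hn ?_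
  rcases div_eq_zero_iff.1 h0 with h1 | h1
  · have h1' : (inner ℝ (pd 0 (pd 0 F) (φ p)) (ν p) : ℝ) = 0 := h1
    rw [h1', mul_zero, zero_div]
  · have h2 : pd 0 F (φ p) = 0 := by
      have := (pow_eq_zero_iff two_ne_zero).1 h1
      exact norm_eq_zero.1 this
    rw [h2]
    simp

end

end FormalGerm

/-! ### The theorem -/

theorem corollaryC {M : Type*} [TopologicalSpace M] [ChartedSpace Kossowski.Plane M]
    [IsManifold (𝓡 2) ω M]
    (g : Kossowski.BilinField M) (hg : Kossowski.IsKossowskiMetric g)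
    (p : M) (γ : ℝ → M) (hγ : ContMDiffAt 𝓘(ℝ, ℝ) (𝓡 2) ω γ 0) (hγp : γ 0 = p)
    (hγ_nonnull : 0 < g (γ 0) (Kossowski.velocity γ 0) (Kossowski.velocity γ 0))
    (I : Set ℝ) (hI : I.OrdConnected) (w μ : ℝ → ℝ → ℝ)
    (hw : ∀ s ∈ I, AnalyticWithinAt ℝ (fun z : ℝ × ℝ => w z.1 z.2) (I ×ˢ univ) (s, 0))
    (hμ : ∀ s ∈ I, AnalyticWithinAt ℝ (fun z : ℝ × ℝ => μ z.1 z.2) (I ×ˢ univ) (s, 0)) :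
    ∃ f : ℝ → M → Kossowski.Space,
      (∀ s ∈ I, ContMDiffWithinAt (𝓘(ℝ, ℝ).prod (𝓡 2)) (𝓡 3) ω
        (fun z : ℝ × M => f z.1 z.2) (I ×ˢ univ) (s, p)) ∧
      ∀ s ∈ I, ∃ ν : M → Kossowski.Space,
        Kossowski.IsFrontalGerm (f s) ν p ∧
        Kossowski.IsFirstFundamentalForm g (f s) p ∧
        (∀ᶠ t in 𝓝 (0 : ℝ), Kossowski.normalCurvature (f s) ν γ t = Real.exp (w s t)) ∧
        (∀ᶠ t in 𝓝 (0 : ℝ), Kossowski.torsion (f s ∘ γ) t = μ s t) ∧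
        (Kossowski.IsRegularPoint g p → Kossowski.IsImmersionGerm (f s) p) ∧
        (Kossowski.IsSemidefinitePoint g p → Kossowski.IsNonParabolic g p →
          Kossowski.IsWaveFrontGerm (f s) ν p ∧
          Kossowski.HasNonvanishingLimitingNormalCurvature (f s) ν p) := by
  have hv : Kossowski.velocity γ 0 ≠ 0 := by
    intro h
    rw [h, map_zero] at hγ_nonnull
    exact lt_irrefl _ hγ_nonnull
  obtain ⟨ψ, hψ, hψ0, ha⟩ := FormalGerm.exists_straightening hγ hγp hv
  have hE := FormalGerm.pos_coeff_of_straightening hγ_nonnull hγ hγp hψ hψ0 ha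
  obtain ⟨α, β, σ, k, C, hcoef⟩ := FormalGerm.exists_coframe hg hψ hψ0 hE
  obtain ⟨F, hF, hS⟩ := C.exists_surface_family w μ hw hμ
  refine ⟨fun s => F s ∘ ψ, fun s hs => FormalGerm.contMDiffWithinAt_family hψ hψ0 (hF s hs),
    fun s hs => ?_⟩
  obtain ⟨N, S⟩ := hS s hs
  have hf := S.isFrontalGerm hψ hψ0
  have hI := S.isFirstFundamentalForm hg hψ hψ0 hcoef
  have hn := S.normalCurvature C.analytic_α.continuousAt C.pos ha
  have hn0 : Kossowski.normalCurvature (F s ∘ ψ) (N ∘ ψ) γ 0 ≠ 0 := by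
    rw [hn.self_of_nhds]
    exact (Real.exp_pos _).ne'
  exact ⟨N ∘ ψ, hf, hI, hn, S.torsion_eq ha,
    FormalGerm.isImmersionGerm_of_isRegularPoint hg hI,
    fun hp hpar => ⟨FormalGerm.isWaveFrontGerm hg hp hpar hf hI,
      FormalGerm.isNondegenerateSingularPoint hg hp hf hI,
      fun _ hφ => FormalGerm.limitingNormalCurvature_ne_zero hf hI hγ hγp hn0 hφ⟩⟩
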